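/- For real $\alpha>2$ let $D_1^\alpha=\{(z,t)\in\mathbb{R}^2\times\mathbb{R} : (|z|^\alpha+|t|^\alpha)^{1/\alpha}\le 1\}$, where $|z|$ is the Euclidean norm of $z\in\mathbb{R}^2$, and for $R>0$ let $D_R^\alpha=\{(Rz,Rt) : (z,t)\in D_1^\alpha\}$ be its Euclidean dilates. Write $|D|$ for the three-dimensional Lebesgue measure of a set $D$ and $\#$ for the number of elements of a finite set. Then for every fixed $\alpha>2$, as $R\to\infty$, $$\bigl|\#(\mathbb{Z}^3\cap D_R^\alpha)-|D_R^\alpha|\bigr| = O\bigl((R^{3/2}+R^{2-2/\alpha})\log R\bigr),$$ where the implied constant may depend on $\alpha$. -/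

import Mathlib

open MeasureTheory Filter Asymptotics

namespace EuclideanDilates

/-- The ambient space of points `(z, t)`, where `z` lies in the Euclidean plane and `t` is real.
Its `volume` is three-dimensional Lebesgue measure. -/
abbrev Space : Type := EuclideanSpace ℝ (Fin 2) × ℝ

/-- The function `(|z|^α + |t|^α)^(1/α)`, with `|z|` the Euclidean norm of `z`. -/
noncomputable def gauge (α : ℝ) (p : Space) : ℝ :=
  (‖p.1‖ ^ α + |p.2| ^ α) ^ (1 / α)

/-- The unit body `{(z, t) : (|z|^α + |t|^α)^(1/α) ≤ 1}`. -/
def unitBody (α : ℝ) : Set Space :=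
  {p | gauge α p ≤ 1}

/-- The Euclidean dilate `{(R z, R t) : (z, t) in the unit body}`. -/
def dilate (α R : ℝ) : Set Space :=
  (fun p : Space => (R • p.1, R * p.2)) '' unitBody α

/-- The points with integer coordinates. -/
def integerLattice : Set Space :=
  Set.range fun n : ℤ × ℤ × ℤ => (!₂[(n.1 : ℝ), (n.2.1 : ℝ)], (n.2.2 : ℝ))

/-- The error `|#(ℤ³ ∩ D) - |D||` for the dilate `D` of parameter `R`. Both the count and the volume
are finite, as is shown below. -/
noncomputable def latticeError (α R : ℝ) : ℝ :=
  |((integerLattice ∩ dilate α R).ncard : ℝ) - (volume (dilate α R)).toReal|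

theorem abs_le_of_mem_dilate {α R : ℝ} (hα : 0 < α) {p : Space} (hp : p ∈ dilate α R) :
    ‖p.1‖ ≤ |R| ∧ |p.2| ≤ |R| := by
  obtain ⟨q, hq, rfl⟩ := hp
  have h1 : 0 ≤ ‖q.1‖ ^ α := by positivity
  have h2 : 0 ≤ |q.2| ^ α := by positivity
  have hs : ‖q.1‖ ^ α + |q.2| ^ α ≤ 1 := by
    by_contra! h
    exact absurd hq (not_le.mpr (Real.one_lt_rpow h (by positivity)))
  have hz : ‖q.1‖ ≤ 1 := by
    by_contra! h
    linarith [Real.one_lt_rpow h hα]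
  have ht : |q.2| ≤ 1 := by
    by_contra! h
    linarith [Real.one_lt_rpow h hα]
  refine ⟨?_, ?_⟩
  · simpa [norm_smul] using mul_le_mul_of_nonneg_left hz (abs_nonneg R)
  · simpa [abs_mul] using mul_le_mul_of_nonneg_left ht (abs_nonneg R)

theorem volume_dilate_ne_top {α : ℝ} (hα : 0 < α) (R : ℝ) : volume (dilate α R) ≠ ⊤ := by
  have hsub : dilate α R ⊆ Metric.closedBall 0 |R| := by
    intro p hp
    rw [mem_closedBall_zero_iff, Prod.norm_def]
    exact max_le (abs_le_of_mem_dilate hα hp).1 (abs_le_of_mem_dilate hα hp).2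
  exact ((measure_mono hsub).trans_lt measure_closedBall_lt_top).ne

theorem finite_integerLattice_inter_dilate {α : ℝ} (hα : 0 < α) (R : ℝ) :
    (integerLattice ∩ dilate α R).Finite := by
  let I : Set ℤ := Set.Icc (-⌈|R|⌉) ⌈|R|⌉
  have hI : ∀ n : ℤ, |(n : ℝ)| ≤ |R| → n ∈ I := by
    intro n hn
    have h := abs_le.mp (hn.trans (Int.le_ceil _))
    exact ⟨by exact_mod_cast h.1, by exact_mod_cast h.2⟩
  have hfin : (I ×ˢ I ×ˢ I).Finite :=
    (Set.finite_Icc _ _).prod ((Set.finite_Icc _ _).prod (Set.finite_Icc _ _))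
  refine (hfin.image fun n : ℤ × ℤ × ℤ =>
    ((!₂[(n.1 : ℝ), (n.2.1 : ℝ)], (n.2.2 : ℝ)) : Space)).subset ?_
  rintro _ ⟨⟨n, rfl⟩, hn⟩
  obtain ⟨h1, h2⟩ := abs_le_of_mem_dilate hα hn
  have ha := (PiLp.norm_apply_le (!₂[(n.1 : ℝ), (n.2.1 : ℝ)]) 0).trans h1
  have hb := (PiLp.norm_apply_le (!₂[(n.1 : ℝ), (n.2.1 : ℝ)]) 1).trans h1
  exact ⟨n, ⟨hI _ (by simpa using ha), hI _ (by simpa using hb), hI _ h2⟩, rfl⟩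

end EuclideanDilates

/-! Cut the body by the horizontal planes at integer heights. Each slice is a disc of radius `rad α
R n`, so the lattice error splits into the circle problem errors of the slices and the error of
replacing the volume integral by a sum of slice areas (`latticeError_le`). The squared radius is a
concave decreasing function of the height, so the second error is controlled by the slice areas near
the pole, which are O(R^(2-2/α)) (`exists_abs_sum_rad_sq_sub_integral_le`).

The circle errors must be shown to cancel between slices. Monotonicity places the lattice count of a
disc between difference quotients of the Riesz mean Σ (r² - |k|²)₊ at the radii r and μr with μ = 1
± 1/(Kρ) (`mul_circleCount_le`). Poisson summation expands that mean in Bessel-type kernels, and the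
differential equation of the kernel gives π/2 · r⁴ plus r^(3/2) times an absolutely convergent
series with terms |k|^(-5/2) Im(Z e(|k| r)) (`exists_rieszMean_asymptotic`). Summed over a block of
heights, every frequency |k| contributes an exponential sum with phase |k| r(n). The radius is a
concave function of the height, so van der Corput's second derivative test applies
(`norm_sum_expi_le`). The difference of the phases at r and μr gains a further factor |k|/K for |k|
≤ K. All in all the frequency k costs |k|^(-2), whose lattice sum is only logarithmic
(`IsConcaveBlock.norm_phaseDiff_le_sqrt`, `exists_abs_sum_latticeWave_le`).

The result for a block of N radii of size ρ with second differences of size λ is log R times Nρ/K +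
KN√(ρλ) + √(ρ/λ) + NK (`exists_abs_sum_circleError_le_log`). Dyadic blocks of heights make λ nearly
constant. Away from the flat equator, with K = √R, and near the pole, with K the square root of the
distance to it, the blocks add up to R^(3/2) log R. At the equator λ degenerates like (T/R)^(α-2)/R,
and the term √(ρ/λ) grows until T = R^(1-2/α). Below that height the trivial bound O(R) for each
slice takes over (`exists_abs_circleError_le`). Both contribute R^(2-2/α), up to the logarithm. -/

namespace EuclideanDilates

/-! ### The Bessel kernel: differential equation and sine asymptotics -/

/-- The function `∫_{-1}^1 (1-u²)^{3/2} cos (su) du`, a multiple of `s⁻² J₂(s)`. -/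
noncomputable def besselKernel (s : ℝ) : ℝ :=
  ∫ u in (-1 : ℝ)..1, (1 - u ^ 2) ^ (3 / 2 : ℝ) * Real.cos (s * u)

theorem hasDerivAt_integral_comp_mul {φ g g' : ℝ → ℝ} (hφ : Continuous φ)
    (hg : ∀ x, HasDerivAt g (g' x) x) (hg' : Continuous g') (hb : ∀ x, |g' x| ≤ 1) (s : ℝ) :
    HasDerivAt (fun s => ∫ u in (-1 : ℝ)..1, φ u * g (s * u))
      (∫ u in (-1 : ℝ)..1, φ u * u * g' (s * u)) s := by
  have hgc : Continuous g := continuous_iff_continuousAt.2 fun x => (hg x).continuousAt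
  refine (intervalIntegral.hasDerivAt_integral_of_dominated_loc_of_deriv_le
    (F := fun s u => φ u * g (s * u)) (F' := fun s u => φ u * u * g' (s * u))
    (bound := fun u => |φ u * u|) (s := Set.univ) Filter.univ_mem ?_ ?_ ?_ ?_ ?_ ?_).2
  · exact Eventually.of_forall fun s => (by fun_prop : Continuous _).aestronglyMeasurable
  · exact (by fun_prop : Continuous _).intervalIntegrable _ _
  · exact (by fun_prop : Continuous _).aestronglyMeasurable
  · refine Eventually.of_forall fun u _ x _ => ?_
    rw [Real.norm_eq_abs, abs_mul]
    exact mul_le_of_le_one_right (abs_nonneg _) (hb _)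
  · exact (by fun_prop : Continuous _).intervalIntegrable _ _
  · refine Eventually.of_forall fun u _ x _ => ?_
    have := ((hg (x * u)).comp x ((hasDerivAt_id x).mul_const u)).const_mul (φ u)
    refine this.congr_deriv ?_
    simp; ring

theorem continuous_one_sub_sq_rpow {p : ℝ} (hp : 0 ≤ p) :
    Continuous fun u : ℝ => (1 - u ^ 2) ^ p :=
  (by fun_prop : Continuous fun u : ℝ => 1 - u ^ 2).rpow_const fun _ => Or.inr hp

/-- The derivative of `besselKernel`. -/
noncomputable def besselKernelDeriv (s : ℝ) : ℝ :=
  -∫ u in (-1 : ℝ)..1, (1 - u ^ 2) ^ (3 / 2 : ℝ) * u * Real.sin (s * u)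

theorem hasDerivAt_besselKernel (s : ℝ) :
    HasDerivAt besselKernel (besselKernelDeriv s) s := by
  have h := hasDerivAt_integral_comp_mul (continuous_one_sub_sq_rpow (p := 3 / 2) (by norm_num))
    Real.hasDerivAt_cos (by fun_prop) (fun x => by simpa using Real.abs_sin_le_one x) s
  refine h.congr_deriv ?_
  rw [besselKernelDeriv, ← intervalIntegral.integral_neg]
  simp

theorem one_sub_sq_rpow_five_half {u : ℝ} (hu : u ∈ Set.uIcc (-1 : ℝ) 1) :
    (1 - u ^ 2) ^ (5 / 2 : ℝ) = (1 - u ^ 2) ^ (3 / 2 : ℝ) - (1 - u ^ 2) ^ (3 / 2 : ℝ) * u ^ 2 := by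
  rw [Set.uIcc_of_le (by norm_num)] at hu
  have h0 : 0 ≤ 1 - u ^ 2 := by nlinarith [hu.1, hu.2]
  rw [show (5 / 2 : ℝ) = 3 / 2 + 1 by norm_num, Real.rpow_add_one' h0 (by norm_num)]
  ring

/-- Integration by parts, with boundary terms killed by the zeros of (1-u²)^(5/2) at ±1. This is
where the first-order term of the differential equation comes from. -/
theorem mul_integral_rpow_five_half_mul_cos (s : ℝ) :
    s * ∫ u in (-1 : ℝ)..1, (1 - u ^ 2) ^ (5 / 2 : ℝ) * Real.cos (s * u) =
      -5 * besselKernelDeriv s := by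
  have h1 : ∀ u ∈ Set.uIcc (-1 : ℝ) 1, HasDerivAt (fun u : ℝ => (1 - u ^ 2) ^ (5 / 2 : ℝ))
      (-5 * ((1 - u ^ 2) ^ (3 / 2 : ℝ) * u)) u := by
    intro u _
    have h := ((hasDerivAt_pow 2 u).const_sub 1).rpow_const (p := 5 / 2) (Or.inr (by norm_num))
    refine h.congr_deriv ?_
    rw [show (5 / 2 - 1 : ℝ) = 3 / 2 by norm_num]
    push_cast; ring
  have h2 : ∀ u ∈ Set.uIcc (-1 : ℝ) 1, HasDerivAt (fun u : ℝ => Real.sin (s * u))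
      (s * Real.cos (s * u)) u := by
    intro u _
    have := ((hasDerivAt_id u).const_mul s).sin
    refine this.congr_deriv ?_
    simp; ring
  have h3 := intervalIntegral.integral_mul_deriv_eq_deriv_mul h1 h2
    (Continuous.intervalIntegrable (by
      have := continuous_one_sub_sq_rpow (p := 3 / 2) (by norm_num); fun_prop) _ _)
    (Continuous.intervalIntegrable (by fun_prop) _ _)
  have hz : ((0 : ℝ)) ^ (5 / 2 : ℝ) = 0 := Real.zero_rpow (by norm_num)
  norm_num [hz] at h3
  rw [besselKernelDeriv, ← intervalIntegral.integral_const_mul, ← intervalIntegral.integral_neg,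
    ← intervalIntegral.integral_const_mul]
  convert h3 using 1
  · congr 1; ext u; ring
  · congr 1; ext u; ring

/-- Differentiating under the integral brings out u² = 1 - (1-u²). The part with 1 gives -B, the
other is the integral with exponent 5/2, which equals -(5/s)B'. Hence B'' + (5/s)B' + B = 0. -/
theorem hasDerivAt_besselKernelDeriv {s : ℝ} (hs : s ≠ 0) :
    HasDerivAt besselKernelDeriv (-besselKernel s - 5 / s * besselKernelDeriv s) s := by
  have hc := continuous_one_sub_sq_rpow (p := 3 / 2) (by norm_num)
  have hc5 := continuous_one_sub_sq_rpow (p := 5 / 2) (by norm_num)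
  have h := (hasDerivAt_integral_comp_mul
    (φ := fun u => (1 - u ^ 2) ^ (3 / 2 : ℝ) * u) (by fun_prop)
    Real.hasDerivAt_sin (by fun_prop) (fun x => Real.abs_cos_le_one x) s).neg
  refine h.congr_deriv ?_
  have h5 : -(5 / s) * besselKernelDeriv s =
      ∫ u in (-1 : ℝ)..1, (1 - u ^ 2) ^ (5 / 2 : ℝ) * Real.cos (s * u) := by
    have := mul_integral_rpow_five_half_mul_cos s
    field_simp
    linarith
  have h6 : ∫ u in (-1 : ℝ)..1, (1 - u ^ 2) ^ (5 / 2 : ℝ) * Real.cos (s * u) =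
      besselKernel s -
        ∫ u in (-1 : ℝ)..1, (1 - u ^ 2) ^ (3 / 2 : ℝ) * u * u * Real.cos (s * u) := by
    rw [besselKernel, ← intervalIntegral.integral_sub
      (Continuous.intervalIntegrable (by fun_prop) _ _)
      (Continuous.intervalIntegrable (by fun_prop) _ _)]
    refine intervalIntegral.integral_congr fun u hu => ?_
    simp only [one_sub_sq_rpow_five_half hu]
    ring
  linarith

/-- The rescaled kernel `s^{5/2} B(s)`, which is asymptotically a sine wave. -/
noncomputable def besselWave (s : ℝ) : ℝ := s ^ (5 / 2 : ℝ) * besselKernel s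

noncomputable def besselWaveDeriv (s : ℝ) : ℝ :=
  s ^ (5 / 2 : ℝ) * (besselKernelDeriv s + 5 / (2 * s) * besselKernel s)

theorem hasDerivAt_rpow_five_half {s : ℝ} (hs : 0 < s) :
    HasDerivAt (fun s : ℝ => s ^ (5 / 2 : ℝ)) (5 / (2 * s) * s ^ (5 / 2 : ℝ)) s := by
  refine (Real.hasDerivAt_rpow_const (p := 5 / 2) (Or.inl hs.ne')).congr_deriv ?_
  rw [Real.rpow_sub_one hs.ne']
  field_simp

theorem hasDerivAt_besselWave {s : ℝ} (hs : 0 < s) :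
    HasDerivAt besselWave (besselWaveDeriv s) s := by
  refine ((hasDerivAt_rpow_five_half hs).mul (hasDerivAt_besselKernel s)).congr_deriv ?_
  rw [besselWaveDeriv]; ring

/-- The power s^(5/2) is the one that removes the first-order term: what remains is W'' = -W with a
perturbation 15/(4s²) that is integrable at infinity. -/
theorem hasDerivAt_besselWaveDeriv {s : ℝ} (hs : 0 < s) :
    HasDerivAt besselWaveDeriv (-besselWave s + 15 / (4 * s ^ 2) * besselWave s) s := by
  have h1 : HasDerivAt (fun s : ℝ => 5 / (2 * s)) (-5 / (2 * s ^ 2)) s := by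
    refine ((((hasDerivAt_id s).const_mul 2).inv (by simp [hs.ne'])).const_mul 5).congr_deriv ?_
    simp; field_simp
  refine ((hasDerivAt_rpow_five_half hs).mul ((hasDerivAt_besselKernelDeriv hs.ne').add
    (h1.mul (hasDerivAt_besselKernel s)))).congr_deriv ?_
  simp only [besselWave, Pi.add_apply, Pi.mul_apply]
  field_simp
  ring

/-- The energy W² + W'² would be constant without the perturbation. With it, the logarithmic
derivative is at most 15/(4s²), and the factor exp(15/(4s)) absorbs this: the derivative of the
product is minus a multiple of (W - W')². -/
theorem exists_besselWave_energy_le :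
    ∃ C : ℝ, 0 < C ∧ ∀ s, 1 ≤ s → besselWave s ^ 2 + besselWaveDeriv s ^ 2 ≤ C ^ 2 := by
  set F : ℝ → ℝ := fun s => (besselWave s ^ 2 + besselWaveDeriv s ^ 2) * Real.exp (15 / (4 * s))
  have hE : ∀ s : ℝ, 0 < s → HasDerivAt F
      ((2 * besselWave s * besselWaveDeriv s + 2 * besselWaveDeriv s *
        (-besselWave s + 15 / (4 * s ^ 2) * besselWave s)) * Real.exp (15 / (4 * s)) +
        (besselWave s ^ 2 + besselWaveDeriv s ^ 2) *
          (Real.exp (15 / (4 * s)) * (-15 / (4 * s ^ 2)))) s := by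
    intro s hs
    have h1 : HasDerivAt (fun s : ℝ => 15 / (4 * s)) (-15 / (4 * s ^ 2)) s := by
      refine ((((hasDerivAt_id s).const_mul 4).inv (by simp [hs.ne'])).const_mul 15).congr_deriv ?_
      simp; field_simp
    refine ((((hasDerivAt_besselWave hs).pow 2).add
      ((hasDerivAt_besselWaveDeriv hs).pow 2)).mul h1.exp).congr_deriv ?_
    simp
  have hanti : AntitoneOn F (Set.Ici 1) := by
    refine antitoneOn_of_deriv_nonpos (convex_Ici 1) ?_ ?_ ?_
    · exact fun s hs => (hE s (by linarith [Set.mem_Ici.1 hs])).continuousAt.continuousWithinAt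
    · intro s hs
      rw [interior_Ici] at hs
      exact (hE s (by linarith [Set.mem_Ioi.1 hs])).differentiableAt.differentiableWithinAt
    · intro s hs
      rw [interior_Ici] at hs
      have hs0 : 0 < s := by linarith [Set.mem_Ioi.1 hs]
      rw [(hE s hs0).deriv]
      have : (2 * besselWave s * besselWaveDeriv s + 2 * besselWaveDeriv s *
        (-besselWave s + 15 / (4 * s ^ 2) * besselWave s)) * Real.exp (15 / (4 * s)) +
        (besselWave s ^ 2 + besselWaveDeriv s ^ 2) *
          (Real.exp (15 / (4 * s)) * (-15 / (4 * s ^ 2))) =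
        -(15 / (4 * s ^ 2) * Real.exp (15 / (4 * s)) *
          (besselWave s - besselWaveDeriv s) ^ 2) := by
        field_simp; ring
      rw [this]
      have : 0 ≤ 15 / (4 * s ^ 2) * Real.exp (15 / (4 * s)) *
          (besselWave s - besselWaveDeriv s) ^ 2 := by positivity
      linarith
  -- The summand 1 makes the constant positive and gives F 1 ≤ (F 1 + 1)².
  refine ⟨F 1 + 1, ?_, fun s hs => ?_⟩
  · have : 0 ≤ F 1 := by positivity
    linarith
  have h0 : 0 ≤ F 1 := by positivity
  have h1 : F s ≤ F 1 := hanti Set.self_mem_Ici hs hs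
  have h2 : besselWave s ^ 2 + besselWaveDeriv s ^ 2 ≤ F s :=
    le_mul_of_one_le_right (by positivity) (Real.one_le_exp (by positivity))
  nlinarith

/-- The wave `s^{5/2} B(s)` is a sine wave up to `O(1/s)`. -/
theorem exists_besselWave_asymptotic :
    ∃ (Z : ℂ) (C : ℝ), 0 < C ∧ ∀ s : ℝ, 1 ≤ s → |besselWave s| ≤ C ∧
      |besselWave s - (Z * Complex.exp (s * Complex.I)).im| ≤ C / s := by
  obtain ⟨C, hC, hE⟩ := exists_besselWave_energy_le
  have hw : ∀ s, 1 ≤ s → |besselWave s| ≤ C := fun s hs =>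
    abs_le_of_sq_le_sq (by nlinarith [hE s hs]) hC.le
  -- Variation of constants: with the rotation e^(is) taken out, W' + iW would be constant for W'' =
  -- -W, so the derivative of Y consists of the perturbation alone.
  set Y : ℝ → ℂ := fun s =>
    Complex.exp (-(s * Complex.I)) * (besselWaveDeriv s + besselWave s * Complex.I) with hY
  have hYd : ∀ s : ℝ, 0 < s → HasDerivAt Y
      (Complex.exp (-(s * Complex.I)) * ((15 / (4 * s ^ 2) * besselWave s : ℝ) : ℂ)) s := by
    intro s hs
    have h1 : HasDerivAt (fun s : ℝ => Complex.exp (-(s * Complex.I)))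
        (Complex.exp (-(s * Complex.I)) * (-Complex.I)) s := by
      have := (((hasDerivAt_id (s : ℂ)).mul_const Complex.I).neg.cexp).comp_ofReal
      simpa using this
    refine (h1.mul ((hasDerivAt_besselWaveDeriv hs).ofReal_comp.add
      ((hasDerivAt_besselWave hs).ofReal_comp.mul_const Complex.I))).congr_deriv ?_
    simp only [Pi.add_apply]; push_cast
    linear_combination (-Complex.exp (-(s * Complex.I)) * besselWave s) * Complex.I_sq
  -- The derivative of Y is at most 15C/(4s²) ≤ 4C/s², which integrates to the stated bound.
  have hdist : ∀ a b : ℝ, 1 ≤ a → a ≤ b → ‖Y b - Y a‖ ≤ 4 * C * (1 / a - 1 / b) := by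
    intro a b ha hab
    have := image_norm_le_of_norm_deriv_right_le_deriv_boundary' (f := fun s => Y s - Y a)
      (f' := fun s => Complex.exp (-(s * Complex.I)) * ((15 / (4 * s ^ 2) * besselWave s : ℝ) : ℂ))
      (a := a) (b := b) (B := fun s => 4 * C * (1 / a - 1 / s)) (B' := fun s => 4 * C * (1 / s ^ 2))
      ?_ ?_ (by simp) ?_ ?_ ?_ (Set.right_mem_Icc.2 hab)
    · exact this
    · exact fun s hs => ((hYd s (by linarith [hs.1])).sub_const
        _).continuousAt.continuousWithinAt
    · exact fun s hs => ((hYd s (by linarith [hs.1])).sub_const _).hasDerivWithinAt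
    · refine fun s hs => ContinuousAt.continuousWithinAt ?_
      have : s ≠ 0 := by linarith [hs.1]
      fun_prop (disch := assumption)
    · intro s hs
      have hs0 : s ≠ 0 := by linarith [hs.1]
      have := ((hasDerivAt_inv hs0).const_sub (1 / a)).const_mul (4 * C)
      simp only [one_div] at this ⊢
      refine (this.congr_deriv ?_).hasDerivWithinAt
      ring
    · intro s hs
      have hs0 : 0 < s := by linarith [hs.1]
      rw [norm_mul, Complex.norm_real, Real.norm_eq_abs, abs_mul,
        show -((s : ℂ) * Complex.I) = ((-s : ℝ) : ℂ) * Complex.I by push_cast; ring,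
        Complex.norm_exp_ofReal_mul_I, one_mul, abs_of_nonneg (by positivity)]
      calc 15 / (4 * s ^ 2) * |besselWave s| ≤ 15 / (4 * s ^ 2) * C := by
            gcongr; exact hw s (by linarith [hs.1])
        _ ≤ 4 * C * (1 / s ^ 2) := by
            field_simp; linarith
  have hcauchy : CauchySeq fun n : ℕ => Y (n + 1) := by
    refine cauchySeq_of_le_tendsto_0' (fun n : ℕ => 4 * C * (1 / ((n : ℝ) + 1))) ?_ ?_
    · intro n m hnm
      rw [dist_comm, dist_eq_norm]
      have hnm' : (n : ℝ) ≤ m := by exact_mod_cast hnm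
      refine (hdist _ _ (by simp) (by linarith)).trans ?_
      gcongr
      have : 0 ≤ 1 / ((m : ℝ) + 1) := by positivity
      linarith
    · simpa using tendsto_one_div_add_atTop_nhds_zero_nat.const_mul (4 * C)
  obtain ⟨Z, hZ⟩ := cauchySeq_tendsto_of_complete hcauchy
  have hlim : ∀ s : ℝ, 1 ≤ s → ‖Z - Y s‖ ≤ 4 * C / s := by
    intro s hs
    refine le_of_tendsto (hZ.sub_const (Y s)).norm ?_
    filter_upwards [eventually_ge_atTop ⌈s⌉₊] with n hn
    have hn' : s ≤ n := Nat.ceil_le.1 hn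
    refine (hdist s _ hs (by linarith)).trans ?_
    rw [div_eq_mul_one_div (4 * C) s]
    gcongr
    have : 0 ≤ 1 / ((n : ℝ) + 1) := by positivity
    linarith
  refine ⟨Z, 4 * C, by positivity, fun s hs => ⟨by linarith [hw s hs], ?_⟩⟩
  have hYs : besselWave s = (Y s * Complex.exp (s * Complex.I)).im := by
    rw [hY]
    simp only
    rw [mul_right_comm, ← Complex.exp_add]
    simp
  conv_lhs => rw [hYs]
  rw [← Complex.sub_im, ← sub_mul]
  refine (Complex.abs_im_le_norm _).trans ?_
  rw [norm_mul, Complex.norm_exp_ofReal_mul_I, mul_one, norm_sub_rev]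
  exact hlim s hs

/-! ### Fourier transforms of truncated paraboloids -/

section FourierTransform

open scoped FourierTransform

/-- The truncated paraboloid in one variable. -/
noncomputable def ramp (c a : ℝ) : ℝ := max (c - a ^ 2) 0

theorem continuous_ramp : Continuous fun p : ℝ × ℝ => ramp p.1 p.2 := by
  unfold ramp; fun_prop

theorem ramp_eq_zero {c a : ℝ} (h : c ≤ a ^ 2) : ramp c a = 0 :=
  max_eq_right (by linarith)

theorem ramp_eq_zero_of_sqrt_le {c a : ℝ} (h : √c ≤ |a|) : ramp c a = 0 :=
  ramp_eq_zero (by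
    have h1 := Real.le_sqrt' (x := c) (y := a ^ 2)
    rw [Real.sqrt_le_iff] at h
    simpa using h.2)

theorem support_subset_of_ramp {E : Type*} [Zero E] {c X : ℝ} (hX : √c ≤ X) {f : ℝ → E}
    (hf : ∀ a, ramp c a = 0 → f a = 0) : Function.support f ⊆ Set.Ioc (-X) X := by
  intro a ha
  by_contra h
  refine ha (hf a (ramp_eq_zero_of_sqrt_le (hX.trans ?_)))
  by_contra! h'
  exact h ⟨(abs_lt.1 h').1, (abs_lt.1 h').2.le⟩

/-- Compact support supplies the decay that Poisson summation asks of the function, so only the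
summability of the transform is left to check. -/
theorem tsum_eq_tsum_fourier_of_hasCompactSupport {f : ℝ → ℂ} (hc : Continuous f)
    (hs : HasCompactSupport f) (hF : Summable fun n : ℤ => 𝓕 f n) :
    ∑' n : ℤ, f n = ∑' n : ℤ, 𝓕 f n := by
  have hO : f =O[cocompact ℝ] fun x : ℝ => |x| ^ (-2 : ℝ) := by
    rw [hasCompactSupport_iff_eventuallyEq, coclosedCompact_eq_cocompact] at hs
    exact hs.trans_isBigO (isBigO_zero _ _)
  simpa using Real.tsum_eq_tsum_fourier_of_rpow_decay_of_summable hc one_lt_two hO hF 0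

/-- The Fourier transform of a ramp. -/
noncomputable def rampFourier (c ξ : ℝ) : ℂ := 𝓕 (fun a => (ramp c a : ℂ)) ξ

/-- The freedom in `X` allows one common interval for a family of parameters c; this makes the
dependence on c visibly continuous. -/
theorem rampFourier_eq {c X : ℝ} (hX : √c ≤ X) (ξ : ℝ) :
    rampFourier c ξ =
      ∫ a in -X..X, (ramp c a : ℂ) * Complex.exp ((-2 * Real.pi * a * ξ : ℝ) * Complex.I) := by
  rw [rampFourier, Real.fourier_real_eq_integral_exp_smul,
    ← intervalIntegral.integral_eq_integral_of_support_subset (a := -X) (b := X)]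
  · simp only [smul_eq_mul, mul_comm]
  · exact support_subset_of_ramp hX fun a ha => by simp [ha]

/-- Two integrations by parts: the ramp is continuous and vanishes at ±√c, so the boundary term of
order 1/ξ is absent. -/
theorem norm_rampFourier_le (c : ℝ) {ξ : ℝ} (hξ : 1 ≤ |ξ|) :
    ‖rampFourier c ξ‖ ≤ (4 * √c + 4) * |ξ| ^ (-2 : ℝ) := by
  rw [rampFourier_eq le_rfl]
  rcases le_or_gt c 0 with hc | hc
  · simp only [Real.sqrt_eq_zero_of_nonpos hc, neg_zero, intervalIntegral.integral_same, norm_zero]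
    positivity
  have hξ0 : ξ ≠ 0 := by rintro rfl; norm_num at hξ
  set l : ℂ := (-2 * Real.pi * ξ : ℝ) * Complex.I with hl
  have hl0 : l ≠ 0 := by
    rw [hl]; simp [Real.pi_ne_zero, hξ0]
  have hln : ‖l‖ = 2 * Real.pi * |ξ| := by
    rw [hl]; simp [abs_of_pos Real.pi_pos]
  have hsq : √c ^ 2 = c := Real.sq_sqrt hc.le
  have hint : ∫ a in -√c..√c, (ramp c a : ℂ) *
        Complex.exp ((-2 * Real.pi * a * ξ : ℝ) * Complex.I) =
      ∫ a in -√c..√c, ((c : ℂ) - (a : ℂ) ^ 2) * Complex.exp (l * a) := by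
    refine intervalIntegral.integral_congr fun a ha => ?_
    rw [Set.uIcc_of_le (by linarith [Real.sqrt_nonneg c])] at ha
    have : ramp c a = c - a ^ 2 := max_eq_left (by nlinarith [ha.1, ha.2])
    simp only [this]
    push_cast
    congr 2
    rw [hl]; push_cast; ring
  -- An explicit antiderivative of (c - a²)e^(la). Its term of order 1/l vanishes at the endpoints a
  -- = ±√c.
  set H : ℝ → ℂ := fun a => Complex.exp (l * a) *
    (((c : ℂ) - (a : ℂ) ^ 2) / l + 2 * a / l ^ 2 - 2 / l ^ 3) with hH
  have hHd : ∀ a : ℝ, HasDerivAt H (((c : ℂ) - (a : ℂ) ^ 2) * Complex.exp (l * a)) a := by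
    intro a
    have h1 : HasDerivAt (fun z : ℂ => Complex.exp (l * z) *
        ((c - z ^ 2) / l + 2 * z / l ^ 2 - 2 / l ^ 3))
        ((c - (a : ℂ) ^ 2) * Complex.exp (l * a)) (a : ℂ) := by
      have e1 : HasDerivAt (fun z : ℂ => Complex.exp (l * z)) (Complex.exp (l * a) * l) (a : ℂ) := by
        simpa using ((hasDerivAt_id (a : ℂ)).const_mul l).cexp
      have e2 : HasDerivAt (fun z : ℂ => (c - z ^ 2) / l + 2 * z / l ^ 2 - 2 / l ^ 3)
          (-(2 * a) / l + 2 / l ^ 2) (a : ℂ) := by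
        have := ((((hasDerivAt_pow 2 (a : ℂ)).const_sub (c : ℂ)).div_const l).add
          (((hasDerivAt_id (a : ℂ)).const_mul 2).div_const (l ^ 2))).sub_const (2 / l ^ 3)
        refine this.congr_deriv ?_
        simp
      refine (e1.mul e2).congr_deriv ?_
      field_simp
      ring
    exact h1.comp_ofReal
  have hHb : ∀ a : ℝ, a ^ 2 = c → ‖H a‖ ≤ (2 * √c + 2) * |ξ| ^ (-2 : ℝ) := by
    intro a ha
    have ha' : |a| = √c := by rw [← ha, Real.sqrt_sq_eq_abs]
    have hexp : ‖Complex.exp (l * a)‖ = 1 := by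
      rw [hl, show ((-2 * Real.pi * ξ : ℝ) : ℂ) * Complex.I * (a : ℂ) =
        ((-2 * Real.pi * ξ * a : ℝ) : ℂ) * Complex.I by push_cast; ring,
        Complex.norm_exp_ofReal_mul_I]
    have hz : (c : ℂ) - (a : ℂ) ^ 2 = 0 := by rw [← ha]; push_cast; ring
    have hl1 : |ξ| ≤ ‖l‖ := by rw [hln]; nlinarith [Real.pi_gt_three]
    rw [hH]
    simp only [hz, norm_mul, hexp, one_mul, zero_div, zero_add]
    rw [Real.rpow_neg (abs_nonneg _), Real.rpow_two]
    calc ‖2 * (a : ℂ) / l ^ 2 - 2 / l ^ 3‖ ≤ ‖2 * (a : ℂ) / l ^ 2‖ + ‖2 / l ^ 3‖ := norm_sub_le _ _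
      _ = 2 * √c / ‖l‖ ^ 2 + 2 / ‖l‖ ^ 3 := by
          simp [ha']
      _ ≤ 2 * √c / |ξ| ^ 2 + 2 / |ξ| ^ 2 := by
          gcongr
          calc |ξ| ^ 2 ≤ |ξ| ^ 3 := pow_le_pow_right₀ hξ (by norm_num)
            _ ≤ ‖l‖ ^ 3 := by gcongr
      _ = _ := by ring
  rw [hint, intervalIntegral.integral_eq_sub_of_hasDerivAt (fun a _ => hHd a)
    (Continuous.intervalIntegrable (by fun_prop) _ _)]
  refine (norm_sub_le _ _).trans ?_
  have h1 := hHb (√c) hsq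
  have h2 := hHb (-√c) (by rw [neg_sq, hsq])
  linarith

theorem hasCompactSupport_ramp (c : ℝ) : HasCompactSupport fun a => (ramp c a : ℂ) := by
  refine HasCompactSupport.intro (isCompact_Icc (a := -√c) (b := √c)) fun a ha => ?_
  rw [ramp_eq_zero_of_sqrt_le, Complex.ofReal_zero]
  by_contra! h
  exact ha ⟨(abs_lt.1 h).1.le, (abs_lt.1 h).2.le⟩

theorem summable_rampFourier (c : ℝ) : Summable fun n : ℤ => rampFourier c n := by
  refine Summable.of_norm_bounded_eventually
    ((Real.summable_abs_int_rpow one_lt_two).mul_left (4 * √c + 4)) ?_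
  rw [Filter.eventually_cofinite]
  refine (Set.finite_singleton (0 : ℤ)).subset fun n hn => ?_
  by_contra h
  refine hn (norm_rampFourier_le c ?_)
  rw [← Int.cast_abs]
  exact_mod_cast Int.one_le_abs h

theorem tsum_ramp (c : ℝ) : ∑' n : ℤ, (ramp c n : ℂ) = ∑' n : ℤ, rampFourier c n :=
  tsum_eq_tsum_fourier_of_hasCompactSupport
    (by have := continuous_ramp.comp (Continuous.prodMk_right c); fun_prop)
    (hasCompactSupport_ramp c) (summable_rampFourier c)

theorem integral_ramp (c : ℝ) : ∫ a, ramp c a = 4 / 3 * (max c 0) ^ (3 / 2 : ℝ) := by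
  rw [← intervalIntegral.integral_eq_integral_of_support_subset
    (support_subset_of_ramp (le_refl (√c)) fun _ => id)]
  rcases le_or_gt c 0 with hc | hc
  · rw [Real.sqrt_eq_zero_of_nonpos hc, max_eq_right hc, Real.zero_rpow (by norm_num)]
    simp
  have hsq : √c ^ 2 = c := Real.sq_sqrt hc.le
  have h1 : ∫ a in -√c..√c, ramp c a = ∫ a in -√c..√c, (c - a ^ 2) := by
    refine intervalIntegral.integral_congr fun a ha => ?_
    rw [Set.uIcc_of_le (by linarith [Real.sqrt_nonneg c])] at ha
    exact max_eq_left (by nlinarith [ha.1, ha.2])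
  rw [h1, intervalIntegral.integral_sub (by simp) (by simp)]
  simp only [intervalIntegral.integral_const, integral_pow, smul_eq_mul]
  rw [max_eq_left hc.le, show (3 / 2 : ℝ) = 1 + 1 / 2 by norm_num, Real.rpow_add hc,
    Real.rpow_one, ← Real.sqrt_eq_rpow]
  norm_num
  have : √c ^ 3 = c * √c := by rw [pow_succ, hsq]
  rw [neg_pow, this]
  ring

/-- The truncated paraboloid in the plane has a radial Fourier transform. -/
theorem integral_exp_mul_ramp {x : ℝ} (hx : 0 < x) (p q : ℝ) :
    𝓕 (fun b : ℝ => rampFourier (x - b ^ 2) p) q =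
      ((4 / 3 * x ^ 2 * besselKernel (2 * Real.pi * √x * √(p ^ 2 + q ^ 2)) : ℝ) : ℂ) := by
  -- The outer variable b is the first coordinate and pairs with q; the inner one pairs with p.
  set F : ℝ → ℝ → ℝ × ℝ → ℂ := fun p q u =>
    Complex.exp ((-2 * Real.pi * (u.1 * q + u.2 * p) : ℝ) * Complex.I) *
      (ramp (x - u.1 ^ 2) u.2 : ℂ) with hF
  have hFi : ∀ p q, Integrable (F p q) (volume.prod volume) := by
    intro p q
    refine Continuous.integrable_of_hasCompactSupport ?_ ?_
    · have : Continuous fun u : ℝ × ℝ => ramp (x - u.1 ^ 2) u.2 :=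
        continuous_ramp.comp (by fun_prop : Continuous fun u : ℝ × ℝ => (x - u.1 ^ 2, u.2))
      fun_prop
    · refine HasCompactSupport.intro
        ((isCompact_Icc (a := -√x) (b := √x)).prod (isCompact_Icc (a := -√x) (b := √x)))
        fun u hu => ?_
      have : ramp (x - u.1 ^ 2) u.2 = 0 := by
        refine ramp_eq_zero ?_
        by_contra! h
        refine hu ⟨abs_le.1 (Real.abs_le_sqrt ?_), abs_le.1 (Real.abs_le_sqrt ?_)⟩ <;>
          nlinarith [sq_nonneg u.1, sq_nonneg u.2]
      simp [hF, this]
  have h1 : 𝓕 (fun b : ℝ => rampFourier (x - b ^ 2) p) q = ∫ u, F p q u ∂(volume.prod volume) := by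
    rw [integral_prod _ (hFi p q), Real.fourier_real_eq_integral_exp_smul]
    refine integral_congr_ae (Eventually.of_forall fun b => ?_)
    simp only [rampFourier]
    rw [Real.fourier_real_eq_integral_exp_smul, smul_eq_mul, ← integral_const_mul]
    refine integral_congr_ae (Eventually.of_forall fun a => ?_)
    simp only [hF, smul_eq_mul]
    rw [← mul_assoc, ← Complex.exp_add]
    congr 2
    push_cast; ring
  set ρ := √(p ^ 2 + q ^ 2) with hρ
  -- The truncated paraboloid is rotation invariant, so the plane may be rotated until the frequency
  -- lies on the first axis. The unit ω comes from an argument of q + ip, so the zero frequency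
  -- needs no separate case.
  have hrot : ∫ u, F p q u ∂(volume.prod volume) = ∫ u, F 0 ρ u ∂(volume.prod volume) := by
    set w : ℂ := ⟨q, p⟩ with hw
    have hwn : ‖w‖ = ρ := by
      rw [Complex.norm_def, Complex.normSq_mk, hρ]; ring_nf
    obtain ⟨ω, hω⟩ : ∃ ω : Circle, (ρ : ℂ) * ω = w := by
      refine ⟨Circle.exp w.arg, ?_⟩
      rw [Circle.coe_exp, ← hwn, Complex.norm_mul_exp_arg_mul_I]
    have hre : q = ρ * (ω : ℂ).re := by
      have := congrArg Complex.re hω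
      simpa [hw] using this.symm
    have him : p = ρ * (ω : ℂ).im := by
      have := congrArg Complex.im hω
      simpa [hw] using this.symm
    have hns : (ω : ℂ).re ^ 2 + (ω : ℂ).im ^ 2 = 1 := by
      have := Circle.normSq_coe ω
      rw [Complex.normSq_apply] at this
      linarith
    rw [← Measure.volume_eq_prod, ← Complex.volume_preserving_equiv_real_prod.integral_comp' (F p q),
      ← Complex.volume_preserving_equiv_real_prod.integral_comp' (F 0 ρ),
      ← (LinearIsometryEquiv.measurePreserving (rotation ω)).integral_comp
        (rotation ω).toHomeomorph.measurableEmbedding]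
    refine integral_congr_ae (Eventually.of_forall fun z => ?_)
    simp only [hF, rotation_apply, Complex.measurableEquivRealProd_apply, Complex.mul_re,
      Complex.mul_im]
    refine congrArg₂ (· * ·) (congrArg (fun t : ℝ => Complex.exp (t * Complex.I)) ?_)
      (congrArg ((↑) : ℝ → ℂ) ?_)
    · rw [hre, him]
      linear_combination (-2 * Real.pi * ρ * z.re) * hns
    · rw [ramp, ramp]
      congr 1
      linear_combination (-z.re ^ 2 - z.im ^ 2) * hns
  have hsx : √x ^ 2 = x := Real.sq_sqrt hx.le
  have hsx0 : 0 < √x := Real.sqrt_pos.2 hx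
  -- The inner frequency is now 0, so the inner integral is the area under a ramp, of order c^(3/2).
  -- This explains the exponent in the kernel.
  have h2 : ∫ u, F 0 ρ u ∂(volume.prod volume) =
      ∫ u : ℝ, Complex.exp ((-2 * Real.pi * (u * ρ) : ℝ) * Complex.I) *
        ((4 / 3 * (max (x - u ^ 2) 0) ^ (3 / 2 : ℝ) : ℝ) : ℂ) := by
    rw [integral_prod _ (hFi 0 ρ)]
    refine integral_congr_ae (Eventually.of_forall fun b => ?_)
    simp only [hF, mul_zero, add_zero]
    rw [integral_const_mul, ← integral_ramp, integral_complex_ofReal]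
  have hsupp : Function.support
      (fun u : ℝ => Complex.exp ((-2 * Real.pi * (u * ρ) : ℝ) * Complex.I) *
        ((4 / 3 * (max (x - u ^ 2) 0) ^ (3 / 2 : ℝ) : ℝ) : ℂ)) ⊆ Set.Ioc (-√x) (√x) := by
    refine support_subset_of_ramp le_rfl fun u hu => ?_
    rw [ramp] at hu
    simp [hu, Real.zero_rpow]
  -- Substitution u = √x t, followed by the splitting of the exponential into cosine and sine.
  have h3 : ∫ u in -√x..√x, Complex.exp ((-2 * Real.pi * (u * ρ) : ℝ) * Complex.I) *
        ((4 / 3 * (max (x - u ^ 2) 0) ^ (3 / 2 : ℝ) : ℝ) : ℂ) =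
      √x * ∫ t in (-1 : ℝ)..1, (4 / 3 * x ^ (3 / 2 : ℝ) : ℝ) *
        (((1 - t ^ 2) ^ (3 / 2 : ℝ) * Real.cos (2 * Real.pi * √x * ρ * t) : ℝ) -
        ((1 - t ^ 2) ^ (3 / 2 : ℝ) * Real.sin (2 * Real.pi * √x * ρ * t) : ℝ) * Complex.I) := by
    have := intervalIntegral.integral_comp_mul_right (a := -1) (b := 1) (c := √x)
      (fun u : ℝ => Complex.exp ((-2 * Real.pi * (u * ρ) : ℝ) * Complex.I) *
        ((4 / 3 * (max (x - u ^ 2) 0) ^ (3 / 2 : ℝ) : ℝ) : ℂ)) hsx0.ne'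
    rw [neg_one_mul, one_mul] at this
    rw [eq_comm, ← Complex.real_smul, ← eq_inv_smul_iff₀ hsx0.ne', ← this]
    refine intervalIntegral.integral_congr fun t ht => ?_
    rw [Set.uIcc_of_le (by norm_num)] at ht
    have ht0 : 0 ≤ 1 - t ^ 2 := by nlinarith [ht.1, ht.2]
    have hm : max (x - (t * √x) ^ 2) 0 = x * (1 - t ^ 2) := by
      rw [mul_pow, hsx, max_eq_left]
      · ring
      · nlinarith
    simp only [hm]
    rw [Real.mul_rpow hx.le ht0, show ((-2 * Real.pi * (t * √x * ρ) : ℝ) : ℂ) =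
      -((2 * Real.pi * √x * ρ * t : ℝ) : ℂ) by push_cast; ring, Complex.exp_mul_I,
      Complex.cos_neg, Complex.sin_neg, ← Complex.ofReal_cos, ← Complex.ofReal_sin]
    push_cast
    ring
  have hodd : ∫ t in (-1 : ℝ)..1, (1 - t ^ 2) ^ (3 / 2 : ℝ) * Real.sin (2 * Real.pi * √x * ρ * t) = 0 := by
    have := intervalIntegral.integral_comp_neg (a := -1) (b := 1)
      (fun t => (1 - t ^ 2) ^ (3 / 2 : ℝ) * Real.sin (2 * Real.pi * √x * ρ * t))
    simp only [even_two, Even.neg_pow, mul_neg, Real.sin_neg, neg_neg,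
      intervalIntegral.integral_neg] at this
    linarith
  have hc := continuous_one_sub_sq_rpow (p := 3 / 2) (by norm_num)
  rw [h1, hrot, h2, ← intervalIntegral.integral_eq_integral_of_support_subset hsupp, h3,
    intervalIntegral.integral_const_mul, intervalIntegral.integral_sub
      (Continuous.intervalIntegrable (by fun_prop) _ _)
      (Continuous.intervalIntegrable (by fun_prop) _ _), intervalIntegral.integral_mul_const,
    intervalIntegral.integral_ofReal, intervalIntegral.integral_ofReal, hodd, ← besselKernel,
    show x ^ (3 / 2 : ℝ) = x * √x by
      rw [show (3 / 2 : ℝ) = 1 + 1 / 2 by norm_num, Real.rpow_add hx, Real.rpow_one,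
        ← Real.sqrt_eq_rpow]]
  have : (√x : ℂ) ^ 2 = x := by exact_mod_cast hsx
  push_cast
  linear_combination (4 / 3 * (x : ℂ) * besselKernel (2 * Real.pi * √x * ρ)) * this

/-- Integrating the derivative of u(1-u²)^(3/2), which vanishes at both ends, gives 4B(0) =
3∫√(1-u²), that is, three times the area of a half disc. The value yields the main term of the Riesz
mean. -/
theorem besselKernel_zero : besselKernel 0 = 3 * Real.pi / 8 := by
  have h1 : ∀ u ∈ Set.uIcc (-1 : ℝ) 1, HasDerivAt (fun u : ℝ => u * (1 - u ^ 2) ^ (3 / 2 : ℝ))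
      ((1 - u ^ 2) ^ (3 / 2 : ℝ) - 3 * u ^ 2 * (1 - u ^ 2) ^ (1 / 2 : ℝ)) u := by
    intro u _
    have h := (hasDerivAt_id u).mul
      (((hasDerivAt_pow 2 u).const_sub 1).rpow_const (p := 3 / 2) (Or.inr (by norm_num)))
    refine h.congr_deriv ?_
    rw [show (3 / 2 - 1 : ℝ) = 1 / 2 by norm_num]
    simp
    ring
  have hc := continuous_one_sub_sq_rpow (p := 3 / 2) (by norm_num)
  have hc' := continuous_one_sub_sq_rpow (p := 1 / 2) (by norm_num)
  have h2 := intervalIntegral.integral_eq_sub_of_hasDerivAt h1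
    (Continuous.intervalIntegrable (by fun_prop) _ _)
  have h3 : ∀ u ∈ Set.uIcc (-1 : ℝ) 1,
      (1 - u ^ 2) ^ (3 / 2 : ℝ) - 3 * u ^ 2 * (1 - u ^ 2) ^ (1 / 2 : ℝ) =
        4 * ((1 - u ^ 2) ^ (3 / 2 : ℝ) * Real.cos (0 * u)) - 3 * √(1 - u ^ 2) := by
    intro u hu
    rw [Set.uIcc_of_le (by norm_num)] at hu
    have h0 : 0 ≤ 1 - u ^ 2 := by nlinarith [hu.1, hu.2]
    rw [Real.sqrt_eq_rpow, show (3 / 2 : ℝ) = 1 / 2 + 1 by norm_num,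
      Real.rpow_add_one' h0 (by norm_num), zero_mul, Real.cos_zero]
    ring
  rw [intervalIntegral.integral_congr h3, intervalIntegral.integral_sub
    (Continuous.intervalIntegrable (by fun_prop) _ _)
    (Continuous.intervalIntegrable (by fun_prop) _ _), intervalIntegral.integral_const_mul,
    intervalIntegral.integral_const_mul, integral_sqrt_one_sub_sq, ← besselKernel] at h2
  norm_num at h2
  linarith

/-! ### Poisson summation for the Riesz mean in the plane -/

/-- The Euclidean norm of an integer vector. -/
noncomputable def planeNorm (k : ℤ × ℤ) : ℝ := √((k.1 : ℝ) ^ 2 + (k.2 : ℝ) ^ 2)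

theorem planeNorm_zero : planeNorm 0 = 0 := by simp [planeNorm]

theorem norm_le_planeNorm (k : ℤ × ℤ) : ‖k‖ ≤ planeNorm k := by
  rw [Prod.norm_def, Int.norm_eq_abs, Int.norm_eq_abs]
  exact max_le (Real.abs_le_sqrt (by nlinarith [sq_nonneg (k.2 : ℝ)]))
    (Real.abs_le_sqrt (by nlinarith [sq_nonneg (k.1 : ℝ)]))

theorem one_le_norm {k : ℤ × ℤ} (hk : k ≠ 0) : 1 ≤ ‖k‖ := by
  rw [Prod.norm_def, Int.norm_eq_abs, Int.norm_eq_abs, ← Int.cast_abs, ← Int.cast_abs]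
  by_contra! h
  obtain ⟨h1, h2⟩ := max_lt_iff.1 h
  refine hk (Prod.ext (Int.abs_lt_one_iff.1 ?_) (Int.abs_lt_one_iff.1 ?_))
  · exact_mod_cast h1
  · exact_mod_cast h2

theorem one_le_planeNorm {k : ℤ × ℤ} (hk : k ≠ 0) : 1 ≤ planeNorm k :=
  (one_le_norm hk).trans (norm_le_planeNorm k)

/-- Lattice sums are easiest in the sup norm `‖k‖`, whose spheres are boxes. At k = 0 both sides are
the default value 0 ^ (-p) = 0, which is also what removes the zero frequency from the wave series
below. -/
theorem planeNorm_rpow_neg_le (k : ℤ × ℤ) {p : ℝ} (hp : 0 < p) :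
    planeNorm k ^ (-p) ≤ ‖k‖ ^ (-p) := by
  rcases eq_or_ne k 0 with rfl | hk
  · simp [planeNorm_zero]
  · exact Real.rpow_le_rpow_of_nonpos (by linarith [one_le_norm hk]) (norm_le_planeNorm k)
      (by linarith)

theorem planeNorm_rpow_nonneg (k : ℤ × ℤ) (p : ℝ) : 0 ≤ planeNorm k ^ p :=
  Real.rpow_nonneg (Real.sqrt_nonneg _) _

theorem summable_norm_rpow_neg {p : ℝ} (hp : 2 < p) : Summable fun k : ℤ × ℤ => ‖k‖ ^ (-p) := by
  have h := (EisensteinSeries.summable_one_div_norm_rpow hp).comp_injective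
    (finTwoArrowEquiv ℤ).symm.injective
  refine h.congr fun k => ?_
  simp [EisensteinSeries.norm_eq_max_natAbs, Prod.norm_def, Int.norm_eq_abs]

theorem summable_planeNorm_rpow_neg {p : ℝ} (hp : 2 < p) :
    Summable fun k : ℤ × ℤ => planeNorm k ^ (-p) :=
  (summable_norm_rpow_neg hp).of_nonneg_of_le (fun k => planeNorm_rpow_nonneg k _)
    fun k => planeNorm_rpow_neg_le k (by linarith)

/-- The Riesz mean `∑ (x - |k|²)₊` over the integer vectors of the plane. -/
noncomputable def rieszMean (x : ℝ) : ℝ := ∑' k : ℤ × ℤ, ramp (x - (k.1 : ℝ) ^ 2) k.2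

theorem finite_sq_add_sq_le (x : ℝ) : {k : ℤ × ℤ | (k.1 : ℝ) ^ 2 + (k.2 : ℝ) ^ 2 ≤ x}.Finite := by
  refine ((Set.finite_Icc (-⌈√x⌉) ⌈√x⌉).prod (Set.finite_Icc (-⌈√x⌉) ⌈√x⌉)).subset fun k hk => ?_
  have hk' : (k.1 : ℝ) ^ 2 + (k.2 : ℝ) ^ 2 ≤ x := hk
  have key : ∀ n : ℤ, (n : ℝ) ^ 2 ≤ x → n ∈ Set.Icc (-⌈√x⌉) ⌈√x⌉ := by
    intro n hn
    have := abs_le.1 ((Real.abs_le_sqrt hn).trans (Int.le_ceil _))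
    exact ⟨by exact_mod_cast this.1, by exact_mod_cast this.2⟩
  exact ⟨key _ (by nlinarith [sq_nonneg (k.2 : ℝ)]), key _ (by nlinarith [sq_nonneg (k.1 : ℝ)])⟩

theorem summable_ramp (x : ℝ) : Summable fun k : ℤ × ℤ => ramp (x - (k.1 : ℝ) ^ 2) k.2 := by
  refine summable_of_hasFiniteSupport ((finite_sq_add_sq_le x).subset fun k hk => ?_)
  by_contra h
  refine hk (ramp_eq_zero ?_)
  simp only [Set.mem_ofPred_eq, not_le] at h
  linarith

theorem continuous_rampFourier {x : ℝ} (p : ℝ) :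
    Continuous fun b : ℝ => rampFourier (x - b ^ 2) p := by
  have h : ∀ b : ℝ, rampFourier (x - b ^ 2) p = _ := fun b =>
    rampFourier_eq (X := √x) (Real.sqrt_le_sqrt (by nlinarith [sq_nonneg b])) p
  simp only [h]
  refine intervalIntegral.continuous_parametric_intervalIntegral_of_continuous' ?_ _ _
  have : Continuous fun u : ℝ × ℝ => ramp (x - u.1 ^ 2) u.2 :=
    continuous_ramp.comp (by fun_prop : Continuous fun u : ℝ × ℝ => (x - u.1 ^ 2, u.2))
  simp only [Function.uncurry_def]
  fun_prop

theorem rampFourier_eq_zero {c : ℝ} (hc : c ≤ 0) (p : ℝ) : rampFourier c p = 0 := by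
  rw [rampFourier_eq (X := 0) (by rw [Real.sqrt_eq_zero_of_nonpos hc])]
  simp

theorem exists_abs_besselKernel_le :
    ∃ C : ℝ, 0 < C ∧ ∀ s : ℝ, 1 ≤ s → |besselKernel s| ≤ C * s ^ (-(5 / 2) : ℝ) := by
  obtain ⟨Z, C, hC, h⟩ := exists_besselWave_asymptotic
  refine ⟨C, hC, fun s hs => ?_⟩
  have hs0 : 0 < s := by linarith
  have h1 := (h s hs).1
  rw [besselWave, abs_mul, abs_of_pos (by positivity)] at h1
  rw [Real.rpow_neg hs0.le, ← div_eq_mul_inv, le_div_iff₀ (by positivity)]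
  linarith

theorem one_le_two_pi_mul {r : ℝ} (hr : 1 ≤ r) {k : ℤ × ℤ} (hk : k ≠ 0) :
    1 ≤ 2 * Real.pi * r * planeNorm k := by
  have h1 : 1 ≤ 2 * Real.pi := by linarith [Real.pi_gt_three]
  exact one_le_mul_of_one_le_of_one_le (one_le_mul_of_one_le_of_one_le h1 hr) (one_le_planeNorm hk)

theorem summable_besselKernel {r : ℝ} (hr : 1 ≤ r) :
    Summable fun k : ℤ × ℤ => besselKernel (2 * Real.pi * r * planeNorm k) := by
  obtain ⟨C, hC, h⟩ := exists_abs_besselKernel_le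
  refine Summable.of_norm_bounded_eventually
    ((summable_planeNorm_rpow_neg (p := 5 / 2) (by norm_num)).mul_left C) ?_
  rw [Filter.eventually_cofinite]
  refine (Set.finite_singleton (0 : ℤ × ℤ)).subset fun k hk => ?_
  by_contra hk0
  refine hk ?_
  rw [Real.norm_eq_abs]
  refine (h _ (one_le_two_pi_mul hr hk0)).trans ?_
  have h1 : 1 ≤ 2 * Real.pi * r :=
    one_le_mul_of_one_le_of_one_le (by linarith [Real.pi_gt_three]) hr
  gcongr C * ?_
  have h2 := one_le_planeNorm hk0
  exact Real.rpow_le_rpow_of_nonpos (by linarith) (by nlinarith) (by norm_num)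

/-- Poisson summation for the Riesz mean. -/
theorem rieszMean_sq_eq_tsum {r : ℝ} (hr : 1 ≤ r) :
    rieszMean (r ^ 2) =
      4 / 3 * r ^ 4 * ∑' k : ℤ × ℤ, besselKernel (2 * Real.pi * r * planeNorm k) := by
  have hr0 : 0 < r := by linarith
  have hsum : Summable fun k : ℤ × ℤ =>
      ((4 / 3 * (r ^ 2) ^ 2 * besselKernel (2 * Real.pi * r * planeNorm k) : ℝ) : ℂ) :=
    Complex.summable_ofReal.2 ((summable_besselKernel hr).mul_left _)
  have hF : ∀ j l : ℤ, 𝓕 (fun b : ℝ => rampFourier (r ^ 2 - b ^ 2) j) l =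
      ((4 / 3 * (r ^ 2) ^ 2 * besselKernel (2 * Real.pi * r * planeNorm (j, l)) : ℝ) : ℂ) := by
    intro j l
    rw [integral_exp_mul_ramp (by positivity), Real.sqrt_sq hr0.le, planeNorm]
  -- Rows with |b| > M miss the disc, so the outer sum is finite and may be exchanged with the sum
  -- over the inner frequency.
  set M : ℤ := ⌈r⌉ with hM
  have hout : ∀ b : ℤ, b ∉ Finset.Icc (-M) M → r ^ 2 - (b : ℝ) ^ 2 ≤ 0 := by
    intro b hb
    by_contra! h
    refine hb ?_
    have h1 : |(b : ℝ)| ≤ r := abs_le_of_sq_le_sq (by linarith) hr0.le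
    have := abs_le.1 (h1.trans (Int.le_ceil _))
    exact Finset.mem_Icc.2 ⟨by exact_mod_cast this.1, by exact_mod_cast this.2⟩
  -- Poisson summation along each row.
  have h1 : ((rieszMean (r ^ 2) : ℝ) : ℂ) =
      ∑ b ∈ Finset.Icc (-M) M, ∑' j : ℤ, rampFourier (r ^ 2 - (b : ℝ) ^ 2) j := by
    rw [rieszMean, Complex.ofReal_tsum,
      (Complex.summable_ofReal.2 (summable_ramp (r ^ 2))).tsum_prod,
      tsum_eq_sum (s := Finset.Icc (-M) M)]
    · exact Finset.sum_congr rfl fun b _ => tsum_ramp (r ^ 2 - (b : ℝ) ^ 2)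
    · intro b hb
      refine (tsum_ramp (r ^ 2 - (b : ℝ) ^ 2)).trans ?_
      simp only [rampFourier_eq_zero (hout b hb), tsum_zero]
  -- Poisson summation across the rows, for a fixed inner frequency j.
  have h2 : ∀ j : ℤ, ∑ b ∈ Finset.Icc (-M) M, rampFourier (r ^ 2 - (b : ℝ) ^ 2) j =
      ∑' l : ℤ, ((4 / 3 * (r ^ 2) ^ 2 *
        besselKernel (2 * Real.pi * r * planeNorm (j, l)) : ℝ) : ℂ) := by
    intro j
    simp only [← hF]
    rw [← tsum_eq_tsum_fourier_of_hasCompactSupport (continuous_rampFourier _), tsum_eq_sum]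
    · exact fun b hb => rampFourier_eq_zero (hout b hb) _
    · refine HasCompactSupport.intro (isCompact_Icc (a := -r) (b := r)) fun b hb => ?_
      refine rampFourier_eq_zero ?_ _
      by_contra! h
      exact hb (abs_le.1 (abs_le_of_sq_le_sq (by linarith) hr0.le))
    · simp only [hF]
      exact hsum.prod_factor j
  rw [← Summable.tsum_finsetSum fun b _ => summable_rampFourier _] at h1
  simp only [h2] at h1
  rw [← hsum.tsum_prod, ← Complex.ofReal_tsum, Complex.ofReal_inj, tsum_mul_left] at h1
  rw [h1]
  ring

/-- The oscillating series `∑ |k|^{-5/2} Im (Z e(|k| r))` over the nonzero integer vectors. -/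
noncomputable def latticeWave (Z : ℂ) (r : ℝ) : ℝ :=
  ∑' k : ℤ × ℤ, planeNorm k ^ (-(5 / 2) : ℝ) *
    (Z * Complex.exp ((2 * Real.pi * r * planeNorm k : ℝ) * Complex.I)).im

theorem abs_im_mul_exp_le (Z : ℂ) (t : ℝ) : |(Z * Complex.exp (t * Complex.I)).im| ≤ ‖Z‖ := by
  refine (Complex.abs_im_le_norm _).trans ?_
  rw [norm_mul, Complex.norm_exp_ofReal_mul_I, mul_one]

theorem summable_latticeWave (Z : ℂ) (r : ℝ) :
    Summable fun k : ℤ × ℤ => planeNorm k ^ (-(5 / 2) : ℝ) *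
      (Z * Complex.exp ((2 * Real.pi * r * planeNorm k : ℝ) * Complex.I)).im := by
  refine Summable.of_norm_bounded
    ((summable_planeNorm_rpow_neg (p := 5 / 2) (by norm_num)).mul_right ‖Z‖) fun k => ?_
  rw [norm_mul, Real.norm_of_nonneg (planeNorm_rpow_nonneg _ _)]
  exact mul_le_mul_of_nonneg_left (abs_im_mul_exp_le _ _) (planeNorm_rpow_nonneg _ _)

/-- The frequency 0 gives 4/3 · 3π/8 · r⁴. For k ≠ 0 the kernel is s^(-5/2) times a sine wave with
relative error O(1/s), where s = 2πr|k|. This turns r⁴ into r^(3/2) and the error into r^(1/2); the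
sum over k converges because 5/2 > 2. -/
theorem exists_rieszMean_asymptotic :
    ∃ (Z : ℂ) (C : ℝ), 0 < C ∧ ∀ r : ℝ, 1 ≤ r →
      |rieszMean (r ^ 2) - Real.pi / 2 * r ^ 4 - r ^ (3 / 2 : ℝ) * latticeWave Z r| ≤
        C * r ^ (1 / 2 : ℝ) := by
  obtain ⟨Z, C, hC, h⟩ := exists_besselWave_asymptotic
  set A := ∑' k : ℤ × ℤ, planeNorm k ^ (-(5 / 2) : ℝ) with hA
  have hA0 : 0 ≤ A := tsum_nonneg fun k => planeNorm_rpow_nonneg _ _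
  -- The numerical factors left over from 4/3 · s^(-5/2); they are absorbed in the amplitude Z.
  set c : ℝ := 4 / 3 * (2 * Real.pi) ^ (-(5 / 2) : ℝ) with hc
  have hc0 : 0 < c := by positivity
  refine ⟨c * Z, c * C * A + 1, by positivity, fun r hr => ?_⟩
  have hr0 : 0 < r := by linarith
  have hsB := summable_besselKernel hr
  have hsW := summable_latticeWave (c * Z) r
  have hsplit : ∑' k : ℤ × ℤ, besselKernel (2 * Real.pi * r * planeNorm k) =
      3 * Real.pi / 8 + ∑' k : ℤ × ℤ,
        if k = 0 then 0 else besselKernel (2 * Real.pi * r * planeNorm k) := by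
    rw [hsB.tsum_eq_add_tsum_ite 0, planeNorm_zero, mul_zero, besselKernel_zero]
  have hs' : Summable fun k : ℤ × ℤ =>
      if k = 0 then 0 else besselKernel (2 * Real.pi * r * planeNorm k) := by
    refine Summable.of_norm_bounded hsB.norm fun k => ?_
    split_ifs <;> simp
  have hpow : r ^ (3 / 2 : ℝ) = r ^ 4 * r ^ (-(5 / 2) : ℝ) := by
    rw [← Real.rpow_natCast, ← Real.rpow_add hr0]; norm_num
  have hpow' : r ^ (1 / 2 : ℝ) = r ^ (3 / 2 : ℝ) / r := by
    rw [← Real.rpow_sub_one hr0.ne']; norm_num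
  rw [rieszMean_sq_eq_tsum hr, hsplit, latticeWave]
  have heq : 4 / 3 * r ^ 4 * (3 * Real.pi / 8 + ∑' k : ℤ × ℤ,
        if k = 0 then 0 else besselKernel (2 * Real.pi * r * planeNorm k)) -
        Real.pi / 2 * r ^ 4 - r ^ (3 / 2 : ℝ) * ∑' k : ℤ × ℤ, planeNorm k ^ (-(5 / 2) : ℝ) *
          (c * Z * Complex.exp ((2 * Real.pi * r * planeNorm k : ℝ) * Complex.I)).im =
      ∑' k : ℤ × ℤ, (4 / 3 * r ^ 4 *
        (if k = 0 then 0 else besselKernel (2 * Real.pi * r * planeNorm k)) -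
        r ^ (3 / 2 : ℝ) * (planeNorm k ^ (-(5 / 2) : ℝ) *
          (c * Z * Complex.exp ((2 * Real.pi * r * planeNorm k : ℝ) * Complex.I)).im)) := by
    rw [(hs'.mul_left _).tsum_sub (hsW.mul_left _), tsum_mul_left, tsum_mul_left]
    ring
  rw [heq, ← Real.norm_eq_abs]
  refine (tsum_of_norm_bounded
    (((summable_planeNorm_rpow_neg (p := 5 / 2) (by norm_num)).hasSum.mul_left
      (c * C * r ^ (1 / 2 : ℝ)))) fun k => ?_).trans ?_
  · rcases eq_or_ne k 0 with rfl | hk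
    · simp [planeNorm_zero]
    rw [if_neg hk, Real.norm_eq_abs]
    set s := 2 * Real.pi * r * planeNorm k with hs
    have hs1 : 1 ≤ s := one_le_two_pi_mul hr hk
    have hs0 : 0 < s := by linarith
    have hN := one_le_planeNorm hk
    have hB : besselKernel s = s ^ (-(5 / 2) : ℝ) * besselWave s := by
      rw [besselWave, ← mul_assoc, ← Real.rpow_add hs0]; simp
    have hspow : s ^ (-(5 / 2) : ℝ) = (2 * Real.pi) ^ (-(5 / 2) : ℝ) * r ^ (-(5 / 2) : ℝ) *
        planeNorm k ^ (-(5 / 2) : ℝ) := by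
      rw [hs, Real.mul_rpow (by positivity) (by positivity),
        Real.mul_rpow (by positivity) (by positivity)]
    have him : (c * Z * Complex.exp (s * Complex.I)).im =
        c * (Z * Complex.exp (s * Complex.I)).im := by
      rw [mul_assoc, Complex.im_ofReal_mul]
    have : 4 / 3 * r ^ 4 * besselKernel s - r ^ (3 / 2 : ℝ) * (planeNorm k ^ (-(5 / 2) : ℝ) *
          (c * Z * Complex.exp (s * Complex.I)).im) =
        c * r ^ (3 / 2 : ℝ) * planeNorm k ^ (-(5 / 2) : ℝ) *
          (besselWave s - (Z * Complex.exp (s * Complex.I)).im) := by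
      rw [hB, hspow, him, hpow, hc]
      ring
    rw [this, abs_mul, abs_of_nonneg (by positivity), hpow']
    have h1 : C / s ≤ C / r := by
      gcongr
      rw [hs]
      have : 1 ≤ 2 * Real.pi * planeNorm k :=
        one_le_mul_of_one_le_of_one_le (by linarith [Real.pi_gt_three]) hN
      nlinarith
    calc _ ≤ c * r ^ (3 / 2 : ℝ) * planeNorm k ^ (-(5 / 2) : ℝ) * (C / r) := by
          gcongr
          exact (h s hs1).2.trans h1
      _ = _ := by ring
  · have : 0 ≤ r ^ (1 / 2 : ℝ) := by positivity
    rw [← hA]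
    nlinarith

end FourierTransform

/-! ### Exponential sums: Kusmin–Landau and van der Corput -/

/-- The additive character `e(x) = exp(2πix)`. -/
noncomputable def expi (x : ℝ) : ℂ := Complex.exp ((2 * Real.pi * x : ℝ) * Complex.I)

theorem norm_expi (x : ℝ) : ‖expi x‖ = 1 := Complex.norm_exp_ofReal_mul_I _

theorem expi_add (x y : ℝ) : expi (x + y) = expi x * expi y := by
  rw [expi, expi, expi, ← Complex.exp_add]; push_cast; ring_nf

theorem expi_sub_int (x : ℝ) (n : ℤ) : expi (x - n) = expi x := by
  rw [expi, expi, Complex.exp_eq_exp_iff_exists_int]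
  exact ⟨-n, by push_cast; ring⟩

theorem expi_eq_sq (x : ℝ) :
    expi x = (Real.cos (Real.pi * x) + Real.sin (Real.pi * x) * Complex.I) ^ 2 := by
  rw [Complex.ofReal_cos, Complex.ofReal_sin, ← Complex.exp_mul_I, ← Complex.exp_nat_mul, expi]
  push_cast; ring_nf

theorem two_mul_le_sin_pi_mul {δ x : ℝ} (hδ : 0 ≤ δ) (h1 : δ ≤ x) (h2 : x ≤ 1 - δ) :
    2 * δ ≤ Real.sin (Real.pi * x) := by
  have hpi := Real.pi_pos
  have key : ∀ y, δ ≤ y → y ≤ 1 / 2 → 2 * δ ≤ Real.sin (Real.pi * y) := by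
    intro y hy hy'
    have := Real.mul_le_sin (x := Real.pi * y) (by nlinarith) (by nlinarith)
    rw [show 2 / Real.pi * (Real.pi * y) = 2 * y by field_simp] at this
    linarith
  rcases le_total x (1 / 2) with h | h
  · exact key x h1 h
  · have := key (1 - x) (by linarith) (by linarith)
    rwa [show Real.pi * (1 - x) = Real.pi - Real.pi * x by ring, Real.sin_pi_sub] at this

theorem cot_sub_cot {x y : ℝ} (hx : Real.sin x ≠ 0) (hy : Real.sin y ≠ 0) :
    Real.cos x / Real.sin x - Real.cos y / Real.sin y =
      Real.sin (y - x) / (Real.sin x * Real.sin y) := by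
  rw [Real.sin_sub]; field_simp

/-- The Kusmin–Landau inequality. -/
theorem norm_sum_expi_le_of_monotone {f : ℕ → ℝ} {a b : ℕ} {δ : ℝ} (hδ : 0 < δ) (hδ' : δ ≤ 1 / 2)
    (ν : ℤ) (hmono : ∀ n, a ≤ n → n + 1 < b → f (n + 1) - f n ≤ f (n + 2) - f (n + 1))
    (h1 : ∀ n, a ≤ n → n < b → ν + δ ≤ f (n + 1) - f n)
    (h2 : ∀ n, a ≤ n → n < b → f (n + 1) - f n ≤ ν + 1 - δ) :
    ‖∑ n ∈ Finset.Ico a b, expi (f n)‖ ≤ 2 / δ := by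
  rcases le_or_gt b a with hab | hab
  · rw [Finset.Ico_eq_empty_of_le hab]
    simp only [Finset.sum_empty, norm_zero]; positivity
  set x : ℕ → ℝ := fun n => Real.pi * (f (n + 1) - f n - ν) with hx
  set q : ℕ → ℝ := fun n => Real.cos (x n) / Real.sin (x n) with hq
  -- With θ the step of f at n, 1/(1 - e(θ)) = 1/2 + (i/2) cot πθ. Hence e(f n) is c n times a
  -- difference of consecutive terms (`hcE`), and the sum can be treated by partial summation.
  set c : ℕ → ℂ := fun n => 1 / 2 + q n / 2 * Complex.I with hc
  have hsin : ∀ n, a ≤ n → n < b → 2 * δ ≤ Real.sin (x n) := fun n hn hn' =>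
    two_mul_le_sin_pi_mul hδ.le (by linarith [h1 n hn hn']) (by linarith [h2 n hn hn'])
  have hqb : ∀ n, a ≤ n → n < b → |q n| ≤ 1 / (2 * δ) := by
    intro n hn hn'
    have := hsin n hn hn'
    rw [hq, abs_div, abs_of_pos (by linarith : 0 < Real.sin (x n))]
    exact div_le_div₀ (by norm_num) (Real.abs_cos_le_one _) (by positivity) this
  have hcb : ∀ n, a ≤ n → n < b → ‖c n‖ ≤ 1 / (2 * δ) := by
    intro n hn hn'
    have h3 : ‖c n‖ ≤ 1 / 2 + |q n| / 2 := by
      refine (norm_add_le _ _).trans ?_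
      simp
    have h4 : 1 ≤ 1 / (2 * δ) := by rw [le_div_iff₀ (by positivity)]; linarith
    linarith [hqb n hn hn']
  have hcE : ∀ n, a ≤ n → n < b → expi (f n) = c n * (expi (f n) - expi (f (n + 1))) := by
    intro n hn hn'
    have hs : Real.sin (x n) ≠ 0 := by linarith [hsin n hn hn']
    have hsC : (Real.sin (x n) : ℂ) ≠ 0 := Complex.ofReal_ne_zero.2 hs
    have hE : expi (f (n + 1)) = expi (f n) *
        (Real.cos (x n) + Real.sin (x n) * Complex.I) ^ 2 := by
      rw [← expi_eq_sq, expi_sub_int, ← expi_add]; congr 1; ring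
    have hcs : (Real.cos (x n) : ℂ) ^ 2 = 1 - (Real.sin (x n) : ℂ) ^ 2 := by
      have := Real.cos_sq' (x n)
      exact_mod_cast this
    have hone : c n * (1 - (Real.cos (x n) + Real.sin (x n) * Complex.I) ^ 2) = 1 := by
      rw [hc, hq]
      simp only [Complex.ofReal_div]
      field_simp
      ring_nf
      simp only [show Complex.I ^ 3 = -Complex.I by rw [pow_succ, Complex.I_sq]; ring,
        Complex.I_sq, hcs, show (Real.cos (x n) : ℂ) ^ 3 = Real.cos (x n) *
        (1 - (Real.sin (x n) : ℂ) ^ 2) by rw [pow_succ', hcs]]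
      ring
    rw [hE]
    linear_combination (-expi (f n)) * hone
  -- The cotangent is monotone along the increasing steps, so the total variation of c telescopes to
  -- half the difference of the extreme cotangents.
  have hind : ∀ b', a < b' → b' ≤ b →
      ‖∑ n ∈ Finset.Ico a b', expi (f n) + c (b' - 1) * expi (f b')‖ ≤
        ‖c a‖ + (q a - q (b' - 1)) / 2 := by
    intro b' hb'
    induction b', hb' using Nat.le_induction with
    | base =>
      intro hb
      rw [Nat.succ_eq_add_one, Finset.sum_Ico_succ_top le_rfl, Finset.Ico_self, Finset.sum_empty,
        zero_add, Nat.add_sub_cancel, sub_self, zero_div, add_zero]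
      have := hcE a le_rfl hb
      have h5 : expi (f a) + c a * expi (f (a + 1)) = c a * expi (f a) := by
        linear_combination this
      rw [h5, norm_mul, norm_expi, mul_one]
    | succ b' hb' ih =>
      intro hb
      have ih := ih (by omega)
      obtain ⟨m, rfl⟩ : ∃ m, b' = m + 1 := ⟨b' - 1, by omega⟩
      rw [Finset.sum_Ico_succ_top (by omega)]
      rw [Nat.add_sub_cancel] at ih ⊢
      have h5 := hcE (m + 1) (by omega) (by omega)
      have h6 : ∑ n ∈ Finset.Ico a (m + 1), expi (f n) + expi (f (m + 1)) +
          c (m + 1) * expi (f (m + 1 + 1)) = (∑ n ∈ Finset.Ico a (m + 1), expi (f n) +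
          c m * expi (f (m + 1))) + (c (m + 1) - c m) * expi (f (m + 1)) := by
        linear_combination h5
      rw [h6]
      refine (norm_add_le _ _).trans ?_
      have hqm : q (m + 1) ≤ q m := by
        have hs1 := hsin m (by omega) (by omega)
        have hs2 := hsin (m + 1) (by omega) (by omega)
        have h7 := cot_sub_cot (x := x m) (y := x (m + 1)) (by linarith) (by linarith)
        have h8 : 0 ≤ Real.sin (x (m + 1) - x m) := by
          have ha := hmono m (by omega) (by omega)
          have hb1 := h2 (m + 1) (by omega) (by omega)
          have hb2 := h1 m (by omega) (by omega)
          refine Real.sin_nonneg_of_nonneg_of_le_pi ?_ ?_ <;> simp only [hx]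
          · nlinarith [Real.pi_pos]
          · nlinarith [Real.pi_pos]
        have h9 : 0 ≤ q m - q (m + 1) := by
          simp only [hq]
          rw [h7]
          exact div_nonneg h8 (mul_nonneg (by linarith) (by linarith))
        linarith
      have h10 : ‖(c (m + 1) - c m) * expi (f (m + 1))‖ = (q m - q (m + 1)) / 2 := by
        rw [norm_mul, norm_expi, mul_one, hc]
        simp only
        rw [show (1 / 2 + (q (m + 1) : ℂ) / 2 * Complex.I - (1 / 2 + (q m : ℂ) / 2 * Complex.I)) =
          (((q (m + 1) - q m) / 2 : ℝ) : ℂ) * Complex.I by push_cast; ring, norm_mul,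
          Complex.norm_I, mul_one, Complex.norm_real, Real.norm_eq_abs, abs_of_nonpos (by linarith)]
        ring
      rw [h10]
      linarith
  have hfin := hind b hab le_rfl
  have hlast : ‖c (b - 1) * expi (f b)‖ ≤ 1 / (2 * δ) := by
    rw [norm_mul, norm_expi, mul_one]
    exact hcb _ (by omega) (by omega)
  have htri : ‖∑ n ∈ Finset.Ico a b, expi (f n)‖ ≤
      ‖∑ n ∈ Finset.Ico a b, expi (f n) + c (b - 1) * expi (f b)‖ + ‖c (b - 1) * expi (f b)‖ := by
    have := norm_sub_le (∑ n ∈ Finset.Ico a b, expi (f n) + c (b - 1) * expi (f b))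
      (c (b - 1) * expi (f b))
    rwa [add_sub_cancel_right] at this
  have hca := hcb a le_rfl hab
  have hqa := abs_le.1 (hqb a le_rfl hab)
  have hqb' := abs_le.1 (hqb (b - 1) (by omega) (by omega))
  have : 2 / δ = 4 * (1 / (2 * δ)) := by field_simp; norm_num
  rw [this]
  have : 0 < 1 / (2 * δ) := by positivity
  linarith [hqa.2, hqb'.1]

/-- Since g grows by at least lam at each step, the indices with values in a window of length d span
at most d/lam steps. -/
theorem card_le_of_gap {g : ℕ → ℝ} {s : Finset ℕ} {lam u d : ℝ} (hlam : 0 < lam) (hd : 0 ≤ d)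
    (hgap : ∀ n ∈ s, ∀ m ∈ s, n ≤ m → lam * ((m : ℝ) - n) ≤ g m - g n)
    (h1 : ∀ n ∈ s, u ≤ g n) (h2 : ∀ n ∈ s, g n ≤ u + d) : (s.card : ℝ) ≤ d / lam + 1 := by
  rcases s.eq_empty_or_nonempty with rfl | hs
  · simp only [Finset.card_empty, Nat.cast_zero]; positivity
  have hmM : s.min' hs ≤ s.max' hs := s.min'_le_max' hs
  have hcard : s.card ≤ s.max' hs + 1 - s.min' hs := by
    rw [← Nat.card_Icc]
    exact Finset.card_le_card fun n hn => Finset.mem_Icc.2 ⟨s.min'_le n hn, s.le_max' n hn⟩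
  have hcard' : (s.card : ℝ) ≤ (s.max' hs : ℝ) - s.min' hs + 1 := by
    have : s.card + s.min' hs ≤ s.max' hs + 1 := by omega
    have : (s.card : ℝ) + s.min' hs ≤ s.max' hs + 1 := by exact_mod_cast this
    linarith
  have h3 := hgap _ (s.min'_mem hs) _ (s.max'_mem hs) hmM
  have h4 := h1 _ (s.min'_mem hs)
  have h5 := h2 _ (s.max'_mem hs)
  have h6 : (s.max' hs : ℝ) - s.min' hs ≤ d / lam := by
    rw [le_div_iff₀ hlam]; linarith
  linarith

theorem exists_filter_eq_Ico {g : ℕ → ℝ} {a b : ℕ}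
    (hg : ∀ n m, a ≤ n → n ≤ m → m < b → g n ≤ g m) (u v : ℝ) :
    ∃ a' b', a ≤ a' ∧ b' ≤ b ∧
      (Finset.Ico a b).filter (fun n => u ≤ g n ∧ g n ≤ v) = Finset.Ico a' b' := by
  set s := (Finset.Ico a b).filter (fun n => u ≤ g n ∧ g n ≤ v) with hs
  rcases s.eq_empty_or_nonempty with h | h
  · exact ⟨a, 0, le_rfl, Nat.zero_le _, by rw [h, Finset.Ico_eq_empty_of_le (Nat.zero_le _)]⟩
  have hmem : ∀ n, n ∈ s ↔ (a ≤ n ∧ n < b) ∧ u ≤ g n ∧ g n ≤ v := by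
    intro n; rw [hs, Finset.mem_filter, Finset.mem_Ico]
  have hmin := (hmem _).1 (s.min'_mem h)
  have hmax := (hmem _).1 (s.max'_mem h)
  refine ⟨s.min' h, s.max' h + 1, hmin.1.1, hmax.1.2, ?_⟩
  ext n
  rw [Finset.mem_Ico]
  constructor
  · exact fun hn => ⟨s.min'_le n hn, Nat.lt_succ_of_le (s.le_max' n hn)⟩
  · rintro ⟨h1, h2⟩
    have h2 : n ≤ s.max' h := Nat.lt_succ_iff.1 h2
    exact (hmem n).2 ⟨⟨hmin.1.1.trans h1, h2.trans_lt hmax.1.2⟩,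
      hmin.2.1.trans (hg _ _ hmin.1.1 h1 (h2.trans_lt hmax.1.2)),
      (hg _ _ (hmin.1.1.trans h1) h2 hmax.1.2).trans hmax.2.2⟩

theorem norm_sum_expi_le_card (f : ℕ → ℝ) (s : Finset ℕ) :
    ‖∑ n ∈ s, expi (f n)‖ ≤ s.card :=
  (norm_sum_le _ _).trans (by simp [norm_expi])

/-- The second derivative test of van der Corput, in terms of second differences. -/
theorem norm_sum_expi_le {f : ℕ → ℝ} {a b : ℕ} {lam h : ℝ} (hlam : 0 < lam) (hh : 1 ≤ h)
    (h1 : ∀ n, a ≤ n → n + 2 < b → lam ≤ f (n + 2) - 2 * f (n + 1) + f n)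
    (h2 : ∀ n, a ≤ n → n + 2 < b → f (n + 2) - 2 * f (n + 1) + f n ≤ h * lam) :
    ‖∑ n ∈ Finset.Ico a b, expi (f n)‖ ≤ 11 * h * (((b - a : ℕ) : ℝ) * √lam + 1 / √lam) := by
  have hsl : 0 < √lam := Real.sqrt_pos.2 hlam
  have hslsq : √lam * √lam = lam := Real.mul_self_sqrt hlam.le
  have hN0 : 0 ≤ ((b - a : ℕ) : ℝ) := by positivity
  have hi0 : 0 < 1 / √lam := by positivity
  -- For lam ≥ 1/4 the trivial bound by the number of terms is already at most twice that number
  -- times √lam.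
  rcases le_or_gt (1 / 4) lam with hbig | hsmall
  · refine (norm_sum_expi_le_card f _).trans ?_
    rw [Nat.card_Ico]
    have : 1 / 2 ≤ √lam := Real.le_sqrt_of_sq_le (by norm_num; linarith)
    have h3 : ((b - a : ℕ) : ℝ) ≤ 2 * (((b - a : ℕ) : ℝ) * √lam) := by nlinarith
    nlinarith [mul_nonneg hN0 hsl.le]
  have hδ : √lam ≤ 1 / 2 := Real.sqrt_le_iff.2 ⟨by norm_num, by norm_num; linarith⟩
  have hi2 : 2 ≤ 1 / √lam := by rw [le_div_iff₀ hsl]; linarith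
  rcases le_or_gt b a with hab | hab
  · rw [Finset.Ico_eq_empty_of_le hab]
    simp only [Finset.sum_empty, norm_zero]; positivity
  -- The last term is split off: the difference g n involves f (n + 1), so it is controlled only for
  -- n < B.
  obtain ⟨B, rfl⟩ : ∃ B, b = B + 1 := ⟨b - 1, by omega⟩
  have haB : a ≤ B := by omega
  set g : ℕ → ℝ := fun n => f (n + 1) - f n with hg
  have hstep1 : ∀ n, a ≤ n → n + 1 < B → lam ≤ g (n + 1) - g n := by
    intro n hn hn'
    have := h1 n hn (by omega)
    simp only [hg]; linarith
  have hstep2 : ∀ n, a ≤ n → n + 1 < B → g (n + 1) - g n ≤ h * lam := by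
    intro n hn hn'
    have := h2 n hn (by omega)
    simp only [hg]; linarith
  have hgap : ∀ n m, a ≤ n → n ≤ m → m < B →
      lam * ((m : ℝ) - n) ≤ g m - g n ∧ g m - g n ≤ h * lam * ((m : ℝ) - n) := by
    intro n m hn hnm
    induction m, hnm using Nat.le_induction with
    | base => intro _; simp
    | succ m hm ih =>
      intro hmB
      have ih := ih (by omega)
      have e1 := hstep1 m (by omega) hmB
      have e2 := hstep2 m (by omega) hmB
      push_cast
      constructor <;> nlinarith [ih.1, ih.2]
  have hmono : ∀ n m, a ≤ n → n ≤ m → m < B → g n ≤ g m := by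
    intro n m hn hnm hm
    have := (hgap n m hn hnm hm).1
    have h3 : (n : ℝ) ≤ m := by exact_mod_cast hnm
    nlinarith
  set I := Finset.Ico a B with hI
  have hIm : ∀ n, n ∈ I ↔ a ≤ n ∧ n < B := fun n => Finset.mem_Ico
  -- On the indices where g has integer part ν, Kusmin–Landau handles those with g at distance at
  -- least δ from ν and ν + 1, at cost 2/δ. The two edges have at most δ/lam + 1 terms each and are
  -- bounded trivially. The choice δ = √lam balances the two.
  have hfib : ∀ ν : ℤ, ‖∑ n ∈ I with ⌊g n⌋ = ν, expi (f n)‖ ≤ 5 * (1 / √lam) := by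
    intro ν
    have hmid : ‖∑ n ∈ I with ⌊g n⌋ = ν ∧ (ν + √lam ≤ g n ∧ g n ≤ ν + 1 - √lam), expi (f n)‖ ≤
        2 / √lam := by
      obtain ⟨a', b', ha', hb', hE⟩ := exists_filter_eq_Ico hmono (ν + √lam) (ν + 1 - √lam)
      have hE' : I.filter (fun n => ⌊g n⌋ = ν ∧ (ν + √lam ≤ g n ∧ g n ≤ ν + 1 - √lam)) =
          Finset.Ico a' b' := by
        rw [← hE]
        refine Finset.filter_congr fun n _ => ?_
        refine and_iff_right_of_imp fun hn => ?_
        rw [Int.floor_eq_iff]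
        exact ⟨by linarith [hn.1], by linarith [hn.2]⟩
      have hin : ∀ n, a' ≤ n → n < b' → ν + √lam ≤ g n ∧ g n ≤ ν + 1 - √lam := by
        intro n hn hn'
        have : n ∈ Finset.Ico a' b' := Finset.mem_Ico.2 ⟨hn, hn'⟩
        rw [← hE] at this
        exact (Finset.mem_filter.1 this).2
      rw [hE']
      refine norm_sum_expi_le_of_monotone hsl hδ ν (fun n hn hn' => ?_)
        (fun n hn hn' => (hin n hn hn').1) (fun n hn hn' => (hin n hn hn').2)
      exact hmono n (n + 1) (by omega) (by omega) (by omega)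
    have hlow : (((I.filter (fun n => ⌊g n⌋ = ν)).filter
        (fun n => g n < ν + √lam)).card : ℝ) ≤ √lam / lam + 1 := by
      refine card_le_of_gap (g := g) (u := ν) hlam hsl.le ?_ ?_ ?_
      · intro n hn m hm hnm
        simp only [Finset.mem_filter, hIm] at hn hm
        exact (hgap n m hn.1.1.1 hnm hm.1.1.2).1
      · intro n hn
        simp only [Finset.mem_filter, Int.floor_eq_iff] at hn
        exact hn.1.2.1
      · intro n hn
        simp only [Finset.mem_filter] at hn
        exact hn.2.le
    have hhigh : (((I.filter (fun n => ⌊g n⌋ = ν)).filter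
        (fun n => ν + 1 - √lam < g n)).card : ℝ) ≤ √lam / lam + 1 := by
      refine card_le_of_gap (g := g) (u := ν + 1 - √lam) hlam hsl.le ?_ ?_ ?_
      · intro n hn m hm hnm
        simp only [Finset.mem_filter, hIm] at hn hm
        exact (hgap n m hn.1.1.1 hnm hm.1.1.2).1
      · intro n hn
        simp only [Finset.mem_filter] at hn
        exact hn.2.le
      · intro n hn
        simp only [Finset.mem_filter, Int.floor_eq_iff] at hn
        linarith [hn.1.2.2]
    have hdiv : √lam / lam = 1 / √lam := by
      rw [← hslsq]; field_simp; rw [Real.sqrt_sq hsl.le]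
    rw [hdiv] at hlow hhigh
    rw [← Finset.sum_filter_add_sum_filter_not (I.filter (fun n => ⌊g n⌋ = ν))
      (fun n => ν + √lam ≤ g n ∧ g n ≤ ν + 1 - √lam), Finset.filter_filter]
    refine (norm_add_le _ _).trans ?_
    have hrest : ‖∑ n ∈ (I.filter (fun n => ⌊g n⌋ = ν)).filter
        (fun n => ¬ (ν + √lam ≤ g n ∧ g n ≤ ν + 1 - √lam)), expi (f n)‖ ≤
        (1 / √lam + 1) + (1 / √lam + 1) := by
      refine (norm_sum_expi_le_card f _).trans (le_trans ?_ (add_le_add hlow hhigh))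
      rw [← Nat.cast_add, Nat.cast_le]
      refine (Finset.card_le_card fun n hn => ?_).trans (Finset.card_union_le _ _)
      rw [Finset.mem_filter] at hn
      by_cases hc : ν + √lam ≤ g n
      · exact Finset.mem_union_right _
          (Finset.mem_filter.2 ⟨hn.1, by by_contra! h'; exact hn.2 ⟨hc, h'⟩⟩)
      · exact Finset.mem_union_left _ (Finset.mem_filter.2 ⟨hn.1, not_le.1 hc⟩)
    have : 2 / √lam = 2 * (1 / √lam) := by ring
    linarith
  have hN : ((B + 1 - a : ℕ) : ℝ) = B - a + 1 := by
    rw [Nat.cast_sub (by omega)]; push_cast; ring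
  rw [hN]
  -- Over the block g increases by at most h·lam per step, which limits the number of integer parts.
  have hsum : ‖∑ n ∈ I, expi (f n)‖ ≤ (h * lam * ((B : ℝ) - a + 1) + 2) * (5 * (1 / √lam)) := by
    rcases haB.eq_or_lt with rfl | haB'
    · rw [hI, Finset.Ico_self]
      simp only [Finset.sum_empty, norm_zero, sub_self, zero_add]
      positivity
    have hmaps : ∀ n ∈ I, ⌊g n⌋ ∈ Finset.Icc ⌊g a⌋ ⌊g (B - 1)⌋ := by
      intro n hn
      rw [hIm] at hn
      exact Finset.mem_Icc.2 ⟨Int.floor_le_floor (hmono _ _ le_rfl hn.1 hn.2),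
        Int.floor_le_floor (hmono _ _ hn.1 (by omega) (by omega))⟩
    rw [← Finset.sum_fiberwise_of_maps_to hmaps]
    refine (norm_sum_le _ _).trans ((Finset.sum_le_sum fun ν _ => hfib ν).trans ?_)
    rw [Finset.sum_const, nsmul_eq_mul, Int.card_Icc]
    have hle : ⌊g a⌋ ≤ ⌊g (B - 1)⌋ := Int.floor_le_floor (hmono _ _ le_rfl (by omega) (by omega))
    gcongr
    have h3 : (((⌊g (B - 1)⌋ + 1 - ⌊g a⌋).toNat : ℤ) : ℝ) =
        ((⌊g (B - 1)⌋ + 1 - ⌊g a⌋ : ℤ) : ℝ) := by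
      rw [Int.toNat_of_nonneg (by omega)]
    rw [Int.cast_natCast] at h3
    rw [h3]
    push_cast
    have e1 := Int.floor_le (g (B - 1))
    have e2 := Int.lt_floor_add_one (g a)
    have e3 := (hgap a (B - 1) le_rfl (by omega) (by omega)).2
    rw [Nat.cast_sub (by omega)] at e3
    push_cast at e3
    have : 0 < h * lam := by positivity
    nlinarith
  rw [Finset.sum_Ico_succ_top haB]
  refine (norm_add_le _ _).trans ?_
  rw [norm_expi]
  have h4 : h * lam * ((B : ℝ) - a + 1) * (5 * (1 / √lam)) =
      5 * h * (((B : ℝ) - a + 1) * √lam) := by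
    have : lam * (1 / √lam) = √lam := by
      rw [mul_one_div, div_eq_iff hsl.ne', hslsq]
    linear_combination (5 * h * ((B : ℝ) - a + 1)) * this
  have h5 : 0 ≤ h * (((B : ℝ) - a + 1) * √lam) := by
    rw [← hN]; positivity
  have h6 : 1 / √lam ≤ h * (1 / √lam) := le_mul_of_one_le_left hi0.le hh
  nlinarith

/-- The sup norm sphere of radius n has 8n integer points and contributes 8/n, so the sum is 8 times
a harmonic number. -/
theorem sum_norm_rpow_neg_two_le (X : ℕ) :
    ∑ k ∈ Finset.Icc (-(X : ℤ × ℤ)) X, ‖k‖ ^ (-2 : ℝ) ≤ 8 * (1 + Real.log X) := by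
  have key : ∀ n : ℕ, ∑ k ∈ Finset.Icc (-(n : ℤ × ℤ)) n, ‖k‖ ^ (-2 : ℝ) = 8 * (harmonic n : ℝ) := by
    intro n
    induction n with
    | zero => simp
    | succ n ih =>
      rw [← Nat.succ_eq_add_one, ← Finset.box_succ_disjUnion, Finset.sum_disjUnion, ih]
      have hc : ∑ k ∈ (Finset.box (n + 1) : Finset (ℤ × ℤ)), ‖k‖ ^ (-2 : ℝ) =
          ∑ k ∈ (Finset.box (n + 1) : Finset (ℤ × ℤ)), ((n : ℝ) + 1) ^ (-2 : ℝ) := by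
        refine Finset.sum_congr rfl fun k hk => ?_
        rw [Int.mem_box] at hk
        have hk' : ‖k‖ = (n : ℝ) + 1 := by
          rw [Prod.norm_def, Int.norm_eq_abs, Int.norm_eq_abs]
          have : ((max k.1.natAbs k.2.natAbs : ℕ) : ℝ) = ((n + 1 : ℕ) : ℝ) := by rw [hk]
          simpa [Nat.cast_natAbs] using this
        rw [hk']
      rw [hc, Finset.sum_const, Int.card_box (Nat.succ_ne_zero n), harmonic_succ, nsmul_eq_mul,
        Real.rpow_neg (by positivity), Real.rpow_two]
      push_cast
      field_simp
      ring
  rw [key]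
  gcongr
  exact harmonic_le_one_add_log X

/-- Abel summation. The real sequence v majorises the variation of u, so that the total variation
telescopes. -/
theorem norm_sum_mul_le {u z : ℕ → ℂ} {v : ℕ → ℝ} {a b : ℕ} {M V B : ℝ} (hB : 0 ≤ B)
    (hM0 : 0 ≤ M) (hV0 : 0 ≤ V)
    (hz : ∀ b' ≤ b, ‖∑ n ∈ Finset.Ico a b', z n‖ ≤ B) (hM : ∀ n, a ≤ n → n < b → ‖u n‖ ≤ M)
    (huv : ∀ n, a ≤ n → n + 1 < b → ‖u (n + 1) - u n‖ ≤ v n - v (n + 1))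
    (hV : a < b → v a - v (b - 1) ≤ V) :
    ‖∑ n ∈ Finset.Ico a b, u n * z n‖ ≤ (M + V) * B := by
  rcases le_or_gt b a with hab | hab
  · rw [Finset.Ico_eq_empty_of_le hab]
    simp only [Finset.sum_empty, norm_zero]; positivity
  have hind : ∀ b', a < b' → b' ≤ b →
      ‖∑ n ∈ Finset.Ico a b', u n * z n - u (b' - 1) * ∑ n ∈ Finset.Ico a b', z n‖ ≤
        (v a - v (b' - 1)) * B := by
    intro b' hb'
    induction b', hb' using Nat.le_induction with
    | base => intro _; simp
    | succ b' hb' ih =>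
      intro hb
      have ih := ih (by omega)
      obtain ⟨m, rfl⟩ : ∃ m, b' = m + 1 := ⟨b' - 1, by omega⟩
      rw [Finset.sum_Ico_succ_top (b := m + 1) (by omega),
        Finset.sum_Ico_succ_top (b := m + 1) (by omega)]
      rw [Nat.add_sub_cancel] at ih ⊢
      rw [show ∑ n ∈ Finset.Ico a (m + 1), u n * z n + u (m + 1) * z (m + 1) -
          u (m + 1) * (∑ n ∈ Finset.Ico a (m + 1), z n + z (m + 1)) =
          (∑ n ∈ Finset.Ico a (m + 1), u n * z n - u m * ∑ n ∈ Finset.Ico a (m + 1), z n) -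
          (u (m + 1) - u m) * ∑ n ∈ Finset.Ico a (m + 1), z n by ring]
      refine (norm_sub_le _ _).trans ?_
      rw [norm_mul]
      have h1 := huv m (by omega) (by omega)
      have h2 : ‖u (m + 1) - u m‖ * ‖∑ n ∈ Finset.Ico a (m + 1), z n‖ ≤
          (v m - v (m + 1)) * B :=
        mul_le_mul h1 (hz _ (by omega)) (norm_nonneg _) ((norm_nonneg _).trans h1)
      linarith
  have h1 := hind b hab le_rfl
  have h2 : ‖u (b - 1) * ∑ n ∈ Finset.Ico a b, z n‖ ≤ M * B := by
    rw [norm_mul]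
    exact mul_le_mul (hM _ (by omega) (by omega)) (hz _ le_rfl) (norm_nonneg _) hM0
  have h3 := norm_add_le (∑ n ∈ Finset.Ico a b, u n * z n -
    u (b - 1) * ∑ n ∈ Finset.Ico a b, z n) (u (b - 1) * ∑ n ∈ Finset.Ico a b, z n)
  rw [sub_add_cancel] at h3
  have h4 : (v a - v (b - 1)) * B ≤ V * B := mul_le_mul_of_nonneg_right (hV hab) hB
  linarith

/-! ### Exponential sums over a block of radii -/

/-- A decreasing sequence of radii with comparable values, whose second differences are negative
and comparable. -/
structure IsConcaveBlock (r : ℕ → ℝ) (a b : ℕ) (ρ lam h : ℝ) : Prop where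
  two_le : 2 ≤ ρ
  lam_pos : 0 < lam
  one_le : 1 ≤ h
  anti : ∀ n, a ≤ n → n + 1 < b → r (n + 1) ≤ r n
  lower : ∀ n, a ≤ n → n < b → ρ ≤ r n
  upper : ∀ n, a ≤ n → n < b → r n ≤ 2 * ρ
  le_diff : ∀ n, a ≤ n → n + 2 < b → lam ≤ 2 * r (n + 1) - r (n + 2) - r n
  diff_le : ∀ n, a ≤ n → n + 2 < b → 2 * r (n + 1) - r (n + 2) - r n ≤ h * lam

/-- The bound of the second derivative test for the phase `κ r`. -/
noncomputable def phaseBound (N lam h κ : ℝ) : ℝ :=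
  11 * h * (N * √(κ * lam) + 1 / √(κ * lam))

theorem phaseBound_nonneg {N lam h κ : ℝ} (hN : 0 ≤ N) (hh : 1 ≤ h) :
    0 ≤ phaseBound N lam h κ := by
  unfold phaseBound; positivity

theorem norm_expi_neg_sum (f : ℕ → ℝ) (s : Finset ℕ) :
    ‖∑ n ∈ s, expi (-f n)‖ = ‖∑ n ∈ s, expi (f n)‖ := by
  rw [← Complex.norm_conj (∑ n ∈ s, expi (f n)), map_sum]
  congr 1
  refine Finset.sum_congr rfl fun n _ => ?_
  rw [expi, expi, ← Complex.exp_conj, map_mul, Complex.conj_ofReal, Complex.conj_I]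
  push_cast; ring_nf

section Sequences

variable {r : ℕ → ℝ} {a b : ℕ} {ρ lam h : ℝ}

/-- Conjugation turns the concave phase κr into a convex one. The bound is uniform in the upper end
b', as Abel summation requires. -/
theorem IsConcaveBlock.norm_sum_expi_mul_le (H : IsConcaveBlock r a b ρ lam h) {κ : ℝ} (hκ : 0 < κ)
    {b' : ℕ} (hb' : b' ≤ b) :
    ‖∑ n ∈ Finset.Ico a b', expi (κ * r n)‖ ≤ phaseBound ((b - a : ℕ) : ℝ) lam h κ := by
  rw [← norm_expi_neg_sum]
  have hp : 0 < κ * lam := mul_pos hκ H.lam_pos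
  refine (norm_sum_expi_le (lam := κ * lam) (h := h) hp H.one_le (fun n hn hn' => ?_)
    (fun n hn hn' => ?_)).trans ?_
  · nlinarith [H.le_diff n hn (by omega)]
  · nlinarith [H.diff_le n hn (by omega)]
  · have h1 := H.one_le
    rw [phaseBound]
    gcongr

theorem rpow_neg_half_nonneg {x : ℝ} (hx : 0 ≤ x) : 0 ≤ x ^ (-(1 / 2) : ℝ) := Real.rpow_nonneg hx _

theorem IsConcaveBlock.rpow_le (H : IsConcaveBlock r a b ρ lam h) {n : ℕ} (h1 : a ≤ n)
    (h2 : n < b) : r n ^ (-(1 / 2) : ℝ) ≤ ρ ^ (-(1 / 2) : ℝ) :=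
  Real.rpow_le_rpow_of_nonpos (by linarith [H.two_le]) (H.lower n h1 h2) (by norm_num)

theorem IsConcaveBlock.rpow_mono (H : IsConcaveBlock r a b ρ lam h) {n : ℕ} (h1 : a ≤ n)
    (h2 : n + 1 < b) : r n ^ (-(1 / 2) : ℝ) ≤ r (n + 1) ^ (-(1 / 2) : ℝ) :=
  Real.rpow_le_rpow_of_nonpos (by linarith [H.two_le, H.lower (n + 1) (by omega) h2])
    (H.anti n h1 h2) (by norm_num)

theorem IsConcaveBlock.pos (H : IsConcaveBlock r a b ρ lam h) {n : ℕ} (h1 : a ≤ n)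
    (h2 : n < b) : 0 < r n := by linarith [H.two_le, H.lower n h1 h2]

theorem IsConcaveBlock.norm_sum_rpow_mul_expi_le (H : IsConcaveBlock r a b ρ lam h) {κ : ℝ}
    (hκ : 0 < κ) :
    ‖∑ n ∈ Finset.Ico a b, ((r n ^ (-(1 / 2) : ℝ) : ℝ) : ℂ) * expi (κ * r n)‖ ≤
      2 * ρ ^ (-(1 / 2) : ℝ) * phaseBound ((b - a : ℕ) : ℝ) lam h κ := by
  have hρ0 : 0 < ρ := by linarith [H.two_le]
  have hp := rpow_neg_half_nonneg hρ0.le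
  rw [two_mul]
  refine norm_sum_mul_le (v := fun n => -r n ^ (-(1 / 2) : ℝ))
    (phaseBound_nonneg (by positivity) H.one_le) hp hp
    (fun b' hb' => H.norm_sum_expi_mul_le hκ hb') (fun n h1 h2 => ?_) (fun n h1 h2 => ?_)
    (fun hab => ?_)
  · rw [Complex.norm_real, Real.norm_of_nonneg (rpow_neg_half_nonneg (H.pos h1 h2).le)]
    exact H.rpow_le h1 h2
  · rw [← Complex.ofReal_sub, Complex.norm_real,
      Real.norm_of_nonneg (by linarith [H.rpow_mono h1 h2])]
    linarith
  · have h1 := H.rpow_le (n := b - 1) (by omega) (by omega)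
    have h2 := rpow_neg_half_nonneg (H.pos (n := a) le_rfl hab).le
    linarith

theorem norm_expi_sub_one_le (x : ℝ) : ‖expi x - 1‖ ≤ 2 * Real.pi * |x| := by
  rw [expi, mul_comm _ Complex.I]
  refine (Real.norm_exp_I_mul_ofReal_sub_one_le).trans ?_
  rw [Real.norm_eq_abs, abs_mul, abs_of_pos (by positivity)]

theorem norm_expi_sub_expi_le (x y : ℝ) : ‖expi x - expi y‖ ≤ 2 * Real.pi * |x - y| := by
  have : expi x - expi y = expi y * (expi (x - y) - 1) := by
    rw [mul_sub, ← expi_add]; ring_nf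
  rw [this, norm_mul, norm_expi, one_mul]
  exact norm_expi_sub_one_le _

theorem rpow_three_half_bounds {μ : ℝ} (h1 : 1 / 2 ≤ μ) (h2 : μ ≤ 3 / 2) :
    |μ ^ (3 / 2 : ℝ) - 1| ≤ 3 * |μ - 1| ∧ μ ^ (3 / 2 : ℝ) ≤ 2 := by
  have h0 : 0 < μ := by linarith
  have hE : μ ^ (3 / 2 : ℝ) = μ * √μ := by
    rw [show (3 / 2 : ℝ) = 1 + 1 / 2 by norm_num, Real.rpow_add h0, Real.rpow_one,
      ← Real.sqrt_eq_rpow]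
  have hs : √μ ≤ 5 / 4 := Real.sqrt_le_iff.2 ⟨by norm_num, by norm_num; linarith⟩
  have hs0 : 0 ≤ √μ := Real.sqrt_nonneg μ
  have hsq : √μ * √μ = μ := Real.mul_self_sqrt h0.le
  rw [hE]
  refine ⟨?_, by nlinarith⟩
  have h3 : |√μ - 1| ≤ |μ - 1| := by
    have : μ - 1 = (√μ - 1) * (√μ + 1) := by linear_combination -hsq
    rw [this, abs_mul, abs_of_pos (by linarith : 0 < √μ + 1)]
    exact le_mul_of_one_le_right (abs_nonneg _) (by linarith)
  have h4 : μ * √μ - 1 = (μ - 1) * √μ + (√μ - 1) := by ring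
  rw [h4]
  refine (abs_add_le _ _).trans ?_
  rw [abs_mul, abs_of_nonneg hs0]
  nlinarith [abs_nonneg (μ - 1)]

theorem sqrt_le_two_mul_sqrt {x y : ℝ} (h : x ≤ 4 * y) : √x ≤ 2 * √y := by
  have h4 : √(4 : ℝ) = 2 := by
    rw [show (4 : ℝ) = 2 ^ 2 by norm_num, Real.sqrt_sq (by norm_num)]
  rw [← h4, ← Real.sqrt_mul (by norm_num)]
  exact Real.sqrt_le_sqrt h

/-- The difference `∑ r^{-1/2} (μ^{3/2} e(κμr) - e(κr))`. -/
noncomputable def phaseDiff (r : ℕ → ℝ) (a b : ℕ) (μ κ : ℝ) : ℂ :=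
  ∑ n ∈ Finset.Ico a b, ((r n ^ (-(1 / 2) : ℝ) : ℝ) : ℂ) *
    ((μ ^ (3 / 2 : ℝ) : ℝ) * expi (κ * (μ * r n)) - expi (κ * r n))

/-- The trivial bound, independent of κ; it serves the far tail of the frequencies. -/
theorem IsConcaveBlock.norm_phaseDiff_le_card (H : IsConcaveBlock r a b ρ lam h) {κ μ : ℝ}
    (h1 : 1 / 2 ≤ μ) (h2 : μ ≤ 3 / 2) :
    ‖phaseDiff r a b μ κ‖ ≤ 3 * ((b - a : ℕ) : ℝ) * ρ ^ (-(1 / 2) : ℝ) := by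
  refine (norm_sum_le _ _).trans ?_
  have : ∀ n ∈ Finset.Ico a b, ‖((r n ^ (-(1 / 2) : ℝ) : ℝ) : ℂ) *
      ((μ ^ (3 / 2 : ℝ) : ℝ) * expi (κ * (μ * r n)) - expi (κ * r n))‖ ≤
      ρ ^ (-(1 / 2) : ℝ) * 3 := by
    intro n hn
    rw [Finset.mem_Ico] at hn
    rw [norm_mul, Complex.norm_real, Real.norm_of_nonneg
      (rpow_neg_half_nonneg (H.pos hn.1 hn.2).le)]
    refine mul_le_mul (H.rpow_le hn.1 hn.2) ?_ (norm_nonneg _)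
      (rpow_neg_half_nonneg (by linarith [H.two_le]))
    refine (norm_sub_le _ _).trans ?_
    rw [norm_mul, norm_expi, norm_expi, Complex.norm_real, Real.norm_of_nonneg (by positivity)]
    linarith [(rpow_three_half_bounds h1 h2).2]
  refine (Finset.sum_le_sum this).trans ?_
  rw [Finset.sum_const, Nat.card_Ico, nsmul_eq_mul]
  apply le_of_eq
  ring

/-- The two phases are estimated separately, since for large κ they are too far apart to cancel. The
phase κμr is again κ'r with κ' comparable to κ, which is why the radii are changed by a factor and
not by a shift. -/
theorem IsConcaveBlock.norm_phaseDiff_le (H : IsConcaveBlock r a b ρ lam h) {κ μ : ℝ} (hκ : 0 < κ)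
    (h1 : 1 / 2 ≤ μ) (h2 : μ ≤ 3 / 2) :
    ‖phaseDiff r a b μ κ‖ ≤
      10 * ρ ^ (-(1 / 2) : ℝ) * phaseBound ((b - a : ℕ) : ℝ) lam h κ := by
  have hρ0 : 0 < ρ := by linarith [H.two_le]
  have hp := rpow_neg_half_nonneg hρ0.le
  have hμ0 : 0 < μ := by linarith
  have hsplit : phaseDiff r a b μ κ = ((μ ^ (3 / 2 : ℝ) : ℝ) : ℂ) *
      (∑ n ∈ Finset.Ico a b, ((r n ^ (-(1 / 2) : ℝ) : ℝ) : ℂ) * expi (κ * μ * r n)) -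
      ∑ n ∈ Finset.Ico a b, ((r n ^ (-(1 / 2) : ℝ) : ℝ) : ℂ) * expi (κ * r n) := by
    rw [phaseDiff, Finset.mul_sum, ← Finset.sum_sub_distrib]
    refine Finset.sum_congr rfl fun n _ => ?_
    rw [mul_assoc κ μ]; ring
  have hBμ : phaseBound ((b - a : ℕ) : ℝ) lam h (κ * μ) ≤
      2 * phaseBound ((b - a : ℕ) : ℝ) lam h κ := by
    have hl := H.lam_pos
    have hh := H.one_le
    have e1 : √(κ * μ * lam) ≤ 2 * √(κ * lam) := by
      apply sqrt_le_two_mul_sqrt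
      nlinarith [mul_pos hκ hl]
    have e2 : √(κ * lam) ≤ 2 * √(κ * μ * lam) := by
      apply sqrt_le_two_mul_sqrt
      nlinarith [mul_pos hκ hl]
    have e3 : 1 / √(κ * μ * lam) ≤ 2 * (1 / √(κ * lam)) := by
      have : 0 < √(κ * lam) := Real.sqrt_pos.2 (by positivity)
      have : 0 < √(κ * μ * lam) := Real.sqrt_pos.2 (by positivity)
      rw [mul_one_div, div_le_div_iff₀ (by positivity) (by positivity)]
      linarith
    rw [phaseBound, phaseBound, mul_left_comm]
    refine mul_le_mul_of_nonneg_left ?_ (by positivity)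
    have : ((b - a : ℕ) : ℝ) * √(κ * μ * lam) ≤ ((b - a : ℕ) : ℝ) * (2 * √(κ * lam)) := by gcongr
    linarith
  rw [hsplit]
  refine (norm_sub_le _ _).trans ?_
  rw [norm_mul, Complex.norm_real, Real.norm_of_nonneg (by positivity)]
  have e4 := H.norm_sum_rpow_mul_expi_le hκ
  have e5 := H.norm_sum_rpow_mul_expi_le (mul_pos hκ hμ0)
  have e6 := (rpow_three_half_bounds h1 h2).2
  have hP := phaseBound_nonneg (N := ((b - a : ℕ) : ℝ)) (lam := lam) (κ := κ) (by positivity)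
    H.one_le
  calc _ ≤ 2 * (2 * ρ ^ (-(1 / 2) : ℝ) * (2 * phaseBound ((b - a : ℕ) : ℝ) lam h κ)) +
        2 * ρ ^ (-(1 / 2) : ℝ) * phaseBound ((b - a : ℕ) : ℝ) lam h κ := by
        refine add_le_add (mul_le_mul e6 (e5.trans ?_) (norm_nonneg _) (by norm_num)) e4
        gcongr
    _ = _ := by ring

/-- After factoring out e(κr), the bracket μ^(3/2) e(κ(μ-1)r) - 1 is an amplitude whose size and
variation are both O(κ|μ-1|ρ). Abel summation transfers this factor to the bound. -/
theorem IsConcaveBlock.norm_phaseDiff_le_mul (H : IsConcaveBlock r a b ρ lam h) {κ μ : ℝ}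
    (hκ : 1 ≤ κ) (h1 : 1 / 2 ≤ μ) (h2 : μ ≤ 3 / 2) :
    ‖phaseDiff r a b μ κ‖ ≤ 50 * (κ * |μ - 1| * ρ) * ρ ^ (-(1 / 2) : ℝ) *
      phaseBound ((b - a : ℕ) : ℝ) lam h κ := by
  have hρ2 := H.two_le
  have hρ0 : 0 < ρ := by linarith
  have hp := rpow_neg_half_nonneg hρ0.le
  have hπ := Real.pi_lt_d2
  have hπ0 := Real.pi_pos
  have hκ0 : 0 < κ := by linarith
  set ε := |μ - 1| with hε
  have hε0 : 0 ≤ ε := abs_nonneg _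
  obtain ⟨hμ1, hμ2⟩ := rpow_three_half_bounds h1 h2
  set m := μ ^ (3 / 2 : ℝ) with hm
  have hm0 : 0 ≤ m := by rw [hm]; exact Real.rpow_nonneg (by linarith) _
  -- The 3 bounds the change of μ^(3/2); the 4π is 2π times the phase change κ|μ-1|r with r ≤ 2ρ.
  set S := (3 + 4 * Real.pi) * (κ * ε * ρ) with hS
  have hS0 : 0 ≤ S := by positivity
  set p : ℕ → ℝ := fun n => r n ^ (-(1 / 2) : ℝ) with hpdef
  set E : ℕ → ℂ := fun n => (m : ℂ) * expi (κ * (μ - 1) * r n) - 1 with hE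
  have hp0 : ∀ n, a ≤ n → n < b → 0 ≤ p n := fun n e1 e2 =>
    rpow_neg_half_nonneg (H.pos e1 e2).le
  have hES : ∀ n, a ≤ n → n < b → ‖E n‖ ≤ S := by
    intro n e1 e2
    have : E n = ((m - 1 : ℝ) : ℂ) * expi (κ * (μ - 1) * r n) +
        (expi (κ * (μ - 1) * r n) - 1) := by
      rw [hE]; push_cast; ring
    rw [this]
    refine (norm_add_le _ _).trans ?_
    rw [norm_mul, norm_expi, mul_one, Complex.norm_real, Real.norm_eq_abs]
    have e3 := norm_expi_sub_one_le (κ * (μ - 1) * r n)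
    rw [abs_mul, abs_mul, abs_of_pos hκ0, abs_of_pos (H.pos e1 e2), ← hε] at e3
    have e4 : 2 * Real.pi * (κ * ε * r n) ≤ 2 * Real.pi * (κ * ε * (2 * ρ)) := by
      gcongr; exact H.upper n e1 e2
    have e5 : ε ≤ κ * ε * ρ := by nlinarith [mul_le_mul hκ hρ2 (by norm_num) hκ0.le]
    rw [hS]
    nlinarith
  have hsum : phaseDiff r a b μ κ = ∑ n ∈ Finset.Ico a b, ((p n : ℂ) * E n) * expi (κ * r n) := by
    refine Finset.sum_congr rfl fun n _ => ?_
    have : expi (κ * (μ * r n)) = expi (κ * (μ - 1) * r n) * expi (κ * r n) := by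
      rw [← expi_add]; ring_nf
    rw [this, hE]
    ring
  have hV0 : 0 ≤ S * ρ ^ (-(1 / 2) : ℝ) + 4 * Real.pi * (κ * ε * ρ) * ρ ^ (-(1 / 2) : ℝ) := by
    positivity
  -- In v, the term with p majorises the variation of the weight r^(-1/2), and the term linear in r
  -- that of the amplitude.
  have hmain := norm_sum_mul_le (u := fun n => (p n : ℂ) * E n) (z := fun n => expi (κ * r n))
    (v := fun n => -p n * S + 4 * Real.pi * κ * ε * ρ ^ (-(1 / 2) : ℝ) * r n) (a := a) (b := b)
    (M := ρ ^ (-(1 / 2) : ℝ) * S)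
    (V := S * ρ ^ (-(1 / 2) : ℝ) + 4 * Real.pi * (κ * ε * ρ) * ρ ^ (-(1 / 2) : ℝ))
    (phaseBound_nonneg (N := ((b - a : ℕ) : ℝ)) (lam := lam) (κ := κ) (by positivity) H.one_le)
    (by positivity) hV0 (fun b' hb' => H.norm_sum_expi_mul_le hκ0 hb') ?_ ?_ ?_
  · rw [hsum]
    refine hmain.trans (mul_le_mul_of_nonneg_right ?_
      (phaseBound_nonneg (by positivity) H.one_le))
    have : 0 ≤ κ * ε * ρ * ρ ^ (-(1 / 2) : ℝ) := by positivity
    rw [hS]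
    nlinarith
  · intro n e1 e2
    rw [norm_mul, Complex.norm_real, Real.norm_of_nonneg (hp0 n e1 e2)]
    exact mul_le_mul (H.rpow_le e1 e2) (hES n e1 e2) (norm_nonneg _) hp
  · intro n e1 e2
    have : (p (n + 1) : ℂ) * E (n + 1) - p n * E n = ((p (n + 1) - p n : ℝ) : ℂ) * E n +
        (p (n + 1) : ℂ) * ((m : ℂ) * (expi (κ * (μ - 1) * r (n + 1)) -
          expi (κ * (μ - 1) * r n))) := by
      rw [hE]; push_cast; ring
    rw [this]
    refine (norm_add_le _ _).trans ?_
    rw [norm_mul, norm_mul, norm_mul, Complex.norm_real, Complex.norm_real, Complex.norm_real,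
      Real.norm_of_nonneg (by linarith [H.rpow_mono e1 e2] : 0 ≤ p (n + 1) - p n),
      Real.norm_of_nonneg (hp0 (n + 1) (by omega) e2), Real.norm_of_nonneg hm0]
    have f1 := norm_expi_sub_expi_le (κ * (μ - 1) * r (n + 1)) (κ * (μ - 1) * r n)
    rw [← mul_sub, abs_mul, abs_mul, abs_of_pos hκ0, ← hε,
      abs_of_nonpos (by linarith [H.anti n e1 e2])] at f1
    have f2 : p (n + 1) ≤ ρ ^ (-(1 / 2) : ℝ) := H.rpow_le (by omega) e2
    have f3 : p (n + 1) * (m * ‖expi (κ * (μ - 1) * r (n + 1)) - expi (κ * (μ - 1) * r n)‖) ≤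
        ρ ^ (-(1 / 2) : ℝ) * (2 * (2 * Real.pi * (κ * ε * -(r (n + 1) - r n)))) := by
      refine mul_le_mul f2 (mul_le_mul hμ2 f1 (norm_nonneg _) (by norm_num)) (by positivity) hp
    have f4 : (p (n + 1) - p n) * ‖E n‖ ≤ (p (n + 1) - p n) * S :=
      mul_le_mul_of_nonneg_left (hES n e1 (by omega)) (by linarith [H.rpow_mono e1 e2])
    nlinarith
  · intro hab
    have f1 := H.upper a le_rfl hab
    have f2 := H.lower (b - 1) (by omega) (by omega)
    have f3 : p (b - 1) * S ≤ ρ ^ (-(1 / 2) : ℝ) * S :=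
      mul_le_mul_of_nonneg_right (H.rpow_le (by omega) (by omega)) hS0
    have f4 : 0 ≤ p a * S := mul_nonneg (hp0 a le_rfl hab) hS0
    have f5 : 4 * Real.pi * κ * ε * ρ ^ (-(1 / 2) : ℝ) * (r a - r (b - 1)) ≤
        4 * Real.pi * κ * ε * ρ ^ (-(1 / 2) : ℝ) * ρ :=
      mul_le_mul_of_nonneg_left (by linarith) (by positivity)
    linarith

end Sequences

/-! ### The circle problem averaged over a block of radii -/

/-- The number of integer points in the disc of squared radius `x`. -/
noncomputable def circleCount (x : ℝ) : ℝ :=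
  ({k : ℤ × ℤ | (k.1 : ℝ) ^ 2 + (k.2 : ℝ) ^ 2 ≤ x}.ncard : ℝ)

theorem rieszMean_eq_sum {x : ℝ} {s : Finset (ℤ × ℤ)}
    (hs : ∀ k : ℤ × ℤ, (k.1 : ℝ) ^ 2 + (k.2 : ℝ) ^ 2 ≤ x → k ∈ s) :
    rieszMean x = ∑ k ∈ s, ramp (x - (k.1 : ℝ) ^ 2) k.2 := by
  refine tsum_eq_sum fun k hk => ramp_eq_zero ?_
  by_contra! h
  exact hk (hs k (by linarith))

/-- As x grows by y, a point already inside adds exactly y to the Riesz mean, a point entering on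
the way adds at most y, and the others add nothing. This exchanges the discontinuous count for the
smoother mean. -/
theorem mul_circleCount_le {x y : ℝ} (hy : 0 ≤ y) :
    y * circleCount x ≤ rieszMean (x + y) - rieszMean x ∧
      rieszMean (x + y) - rieszMean x ≤ y * circleCount (x + y) := by
  set s := (finite_sq_add_sq_le (x + y)).toFinset with hs
  have hmem : ∀ k : ℤ × ℤ, k ∈ s ↔ (k.1 : ℝ) ^ 2 + (k.2 : ℝ) ^ 2 ≤ x + y := fun k => by
    rw [hs, Set.Finite.mem_toFinset]; rfl
  set t := (finite_sq_add_sq_le x).toFinset with ht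
  have hmemt : ∀ k : ℤ × ℤ, k ∈ t ↔ (k.1 : ℝ) ^ 2 + (k.2 : ℝ) ^ 2 ≤ x := fun k => by
    rw [ht, Set.Finite.mem_toFinset]; rfl
  have hts : t ⊆ s := fun k hk => (hmem k).2 (by linarith [(hmemt k).1 hk])
  have hc1 : circleCount x = t.card := by
    rw [circleCount, Set.ncard_eq_toFinset_card _ (finite_sq_add_sq_le x)]
  have hc2 : circleCount (x + y) = s.card := by
    rw [circleCount, Set.ncard_eq_toFinset_card _ (finite_sq_add_sq_le (x + y))]
  rw [rieszMean_eq_sum (s := s) fun k hk => (hmem k).2 hk,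
    rieszMean_eq_sum (s := s) fun k hk => (hmem k).2 (by linarith), ← Finset.sum_sub_distrib]
  have hd0 : ∀ k : ℤ × ℤ, 0 ≤ ramp (x + y - (k.1 : ℝ) ^ 2) k.2 - ramp (x - (k.1 : ℝ) ^ 2) k.2 := by
    intro k
    rw [ramp, ramp, sub_nonneg]
    exact max_le_max_right _ (by linarith)
  constructor
  · rw [hc1, mul_comm, ← nsmul_eq_mul, ← Finset.sum_const]
    refine (Finset.sum_le_sum fun k hk => ?_).trans
      (Finset.sum_le_sum_of_subset_of_nonneg hts fun k _ _ => hd0 k)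
    have := (hmemt k).1 hk
    rw [ramp, ramp, max_eq_left (by linarith), max_eq_left (by linarith)]
    linarith
  · rw [hc2, mul_comm, ← nsmul_eq_mul, ← Finset.sum_const]
    refine Finset.sum_le_sum fun k _ => ?_
    have h1 : x - (k.1 : ℝ) ^ 2 - (k.2 : ℝ) ^ 2 ≤ ramp (x - (k.1 : ℝ) ^ 2) k.2 := le_max_left _ _
    have h2 : 0 ≤ ramp (x - (k.1 : ℝ) ^ 2) k.2 := le_max_right _ _
    rw [ramp, sub_le_iff_le_add]
    exact max_le (by linarith) (by linarith)

/-- A lattice sum whose terms decay like `‖k‖⁻²` is bounded logarithmically when there is a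
second, faster but coarser, bound. -/
theorem exists_abs_tsum_le :
    ∃ C : ℝ, 0 < C ∧ ∀ (f : ℤ × ℤ → ℝ) (A D : ℝ) (X : ℕ), 0 ≤ A → 0 ≤ D → 1 ≤ X →
      (∀ k, |f k| ≤ A * ‖k‖ ^ (-2 : ℝ)) → (∀ k, |f k| ≤ D * ‖k‖ ^ (-(5 / 2) : ℝ)) →
      |∑' k, f k| ≤ C * (A * (1 + Real.log X) + D * (X : ℝ) ^ (-(1 / 4) : ℝ)) := by
  -- Any exponent between 2 and 5/2 would do: outside the box of side X, the decay ‖k‖^(-5/2) is at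
  -- most X^(-1/4) ‖k‖^(-9/4), and the latter is summable.
  have hS := summable_norm_rpow_neg (p := 9 / 4) (by norm_num)
  set T := ∑' k : ℤ × ℤ, ‖k‖ ^ (-(9 / 4) : ℝ) with hT
  have hT0 : 0 ≤ T := tsum_nonneg fun k => Real.rpow_nonneg (norm_nonneg _) _
  refine ⟨T + 8, by positivity, fun f A D X hA hD hX h1 h2 => ?_⟩
  have hX0 : (0 : ℝ) < X := by exact_mod_cast hX
  set I := Finset.Icc (-(X : ℤ × ℤ)) X with hI
  have hsum1 : HasSum (fun k : ℤ × ℤ => if k ∈ I then A * ‖k‖ ^ (-2 : ℝ) else 0)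
      (∑ k ∈ I, A * ‖k‖ ^ (-2 : ℝ)) := by
    have := hasSum_sum_of_ne_finset_zero (s := I) (L := SummationFilter.unconditional _)
      (f := fun k : ℤ × ℤ => if k ∈ I then A * ‖k‖ ^ (-2 : ℝ) else 0) fun k hk => if_neg hk
    rwa [Finset.sum_congr rfl fun k hk => if_pos hk] at this
  have hsum := hsum1.add (hS.hasSum.mul_left (D * (X : ℝ) ^ (-(1 / 4) : ℝ)))
  rw [← Real.norm_eq_abs]
  refine (tsum_of_norm_bounded hsum fun k => ?_).trans ?_
  · have hn : 0 ≤ D * (X : ℝ) ^ (-(1 / 4) : ℝ) * ‖k‖ ^ (-(9 / 4) : ℝ) := by positivity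
    rw [Real.norm_eq_abs]
    split_ifs with hk
    · linarith [h1 k]
    · rw [zero_add]
      refine (h2 k).trans ?_
      have hXk : (X : ℝ) ≤ ‖k‖ := by
        rw [Prod.norm_def, Int.norm_eq_abs, Int.norm_eq_abs]
        by_contra! hlt
        obtain ⟨e1, e2⟩ := max_lt_iff.1 hlt
        refine hk ?_
        rw [hI, Finset.mem_Icc, Prod.le_def, Prod.le_def]
        have e1 := abs_lt.1 e1
        have e2 := abs_lt.1 e2
        refine ⟨⟨?_, ?_⟩, ?_, ?_⟩ <;> simp
        · have := e1.1.le; exact_mod_cast this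
        · have := e2.1.le; exact_mod_cast this
        · have := e1.2.le; exact_mod_cast this
        · have := e2.2.le; exact_mod_cast this
      have hk0 : 0 < ‖k‖ := hX0.trans_le hXk
      rw [mul_assoc]
      refine mul_le_mul_of_nonneg_left ?_ hD
      rw [show (-(5 / 2) : ℝ) = -(1 / 4) + -(9 / 4) by norm_num, Real.rpow_add hk0]
      gcongr ?_ * _
      exact Real.rpow_le_rpow_of_nonpos hX0 hXk (by norm_num)
  · rw [← Finset.mul_sum]
    have e1 := mul_le_mul_of_nonneg_left (sum_norm_rpow_neg_two_le X) hA
    have e2 : 0 ≤ A * (1 + Real.log X) := by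
      have : 0 ≤ Real.log X := Real.log_nonneg (by exact_mod_cast hX)
      positivity
    have e3 : 0 ≤ D * (X : ℝ) ^ (-(1 / 4) : ℝ) := by positivity
    nlinarith [mul_nonneg hT0 e2]

section Sequences

variable {r : ℕ → ℝ} {a b : ℕ} {ρ lam h : ℝ}

/-- For κ ≤ K the cancellation between the phases saves κ/K, which turns 1/√(κλ) into √κ/(K√λ). For
κ > K no saving is needed, since 1/√κ < √κ/K. Both ranges obey one bound proportional to √κ. -/
theorem IsConcaveBlock.norm_phaseDiff_le_sqrt (H : IsConcaveBlock r a b ρ lam h) {κ μ K : ℝ}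
    (hκ : 1 ≤ κ) (h1 : 1 / 2 ≤ μ) (h2 : μ ≤ 3 / 2) (hK : 1 ≤ K) (hμ : |μ - 1| = 1 / (K * ρ)) :
    ‖phaseDiff r a b μ κ‖ ≤ 550 * h * ρ ^ (-(1 / 2) : ℝ) * √κ *
      (((b - a : ℕ) : ℝ) * √lam + 1 / (K * √lam)) := by
  have hρ0 : 0 < ρ := by linarith [H.two_le]
  have hκ0 : 0 < κ := by linarith
  have hK0 : 0 < K := by linarith
  have hl : 0 < √lam := Real.sqrt_pos.2 H.lam_pos
  have hsκ : 0 < √κ := Real.sqrt_pos.2 hκ0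
  have hκκ : √κ * √κ = κ := Real.mul_self_sqrt hκ0.le
  have hp := rpow_neg_half_nonneg hρ0.le
  have hh := H.one_le
  have hN : 0 ≤ ((b - a : ℕ) : ℝ) := by positivity
  set N := ((b - a : ℕ) : ℝ) with hNdef
  have hP : phaseBound N lam h κ = 11 * h * (√κ * (N * √lam) + 1 / (√κ * √lam)) := by
    rw [phaseBound, Real.sqrt_mul hκ0.le]; ring
  rcases le_or_gt κ K with hc | hc
  · refine (H.norm_phaseDiff_le_mul hκ h1 h2).trans ?_
    rw [hμ, hP]
    have e1 : κ * (1 / (K * ρ)) * ρ = κ / K := by field_simp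
    have e2 : κ / K * (√κ * (N * √lam) + 1 / (√κ * √lam)) ≤
        √κ * (N * √lam + 1 / (K * √lam)) := by
      have e3 : κ / K ≤ 1 := (div_le_one hK0).2 hc
      have e4 : κ / K * (1 / (√κ * √lam)) = √κ * (1 / (K * √lam)) := by
        rw [← hκκ]; field_simp; rw [Real.sqrt_sq hsκ.le]
      have e5 : κ / K * (√κ * (N * √lam)) ≤ √κ * (N * √lam) :=
        mul_le_of_le_one_left (by positivity) e3
      rw [mul_add, e4, mul_add]
      linarith
    calc _ = 550 * h * ρ ^ (-(1 / 2) : ℝ) *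
          (κ / K * (√κ * (N * √lam) + 1 / (√κ * √lam))) := by rw [e1]; ring
      _ ≤ 550 * h * ρ ^ (-(1 / 2) : ℝ) * (√κ * (N * √lam + 1 / (K * √lam))) := by gcongr
      _ = _ := by ring
  · refine (H.norm_phaseDiff_le hκ0 h1 h2).trans ?_
    rw [hP]
    have e2 : √κ * (N * √lam) + 1 / (√κ * √lam) ≤ √κ * (N * √lam + 1 / (K * √lam)) := by
      have e4 : 1 / (√κ * √lam) ≤ √κ * (1 / (K * √lam)) := by
        rw [mul_one_div, div_le_div_iff₀ (by positivity) (by positivity)]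
        nlinarith
      rw [mul_add]
      linarith
    calc _ = 110 * h * ρ ^ (-(1 / 2) : ℝ) * (√κ * (N * √lam) + 1 / (√κ * √lam)) := by ring
      _ ≤ 110 * h * ρ ^ (-(1 / 2) : ℝ) * (√κ * (N * √lam + 1 / (K * √lam))) := by gcongr
      _ ≤ 550 * h * ρ ^ (-(1 / 2) : ℝ) * (√κ * (N * √lam + 1 / (K * √lam))) := by
          gcongr; norm_num
      _ = _ := by ring

/-- The coefficient |k|^(-5/2) times the bound √|k| for the phase difference is |k|^(-2), which sums
to a logarithm up to X. Beyond X the trivial bound retains |k|^(-5/2). -/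
theorem exists_abs_sum_latticeWave_le :
    ∃ C : ℝ, 0 < C ∧ ∀ {r : ℕ → ℝ} {a b : ℕ} {ρ lam h : ℝ}, IsConcaveBlock r a b ρ lam h →
      ∀ (Z : ℂ) (μ K : ℝ) (X : ℕ), 1 / 2 ≤ μ → μ ≤ 3 / 2 → 1 ≤ K → |μ - 1| = 1 / (K * ρ) → 1 ≤ X →
      |∑ n ∈ Finset.Ico a b, r n ^ (-(1 / 2) : ℝ) *
        (μ ^ (3 / 2 : ℝ) * latticeWave Z (μ * r n) - latticeWave Z (r n))| ≤
      C * ‖Z‖ * h * ρ ^ (-(1 / 2) : ℝ) * ((((b - a : ℕ) : ℝ) * √lam + 1 / (K * √lam)) *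
        (1 + Real.log X) + ((b - a : ℕ) : ℝ) * (X : ℝ) ^ (-(1 / 4) : ℝ)) := by
  obtain ⟨C, hC, hsum⟩ := exists_abs_tsum_le
  refine ⟨550 * C, by positivity, ?_⟩
  intro r a b ρ lam h H Z μ K X h1 h2 hK hμ hX
  have hρ0 : 0 < ρ := by linarith [H.two_le]
  have hp := rpow_neg_half_nonneg hρ0.le
  have hh := H.one_le
  have hl : 0 < √lam := Real.sqrt_pos.2 H.lam_pos
  have hlog : 0 ≤ Real.log X := Real.log_nonneg (by exact_mod_cast hX)
  set N := ((b - a : ℕ) : ℝ) with hNdef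
  have hN : 0 ≤ N := by positivity
  have hexp : ∀ t κ : ℝ, Complex.exp ((2 * Real.pi * t * κ : ℝ) * Complex.I) = expi (κ * t) := by
    intro t κ
    rw [expi, show 2 * Real.pi * t * κ = 2 * Real.pi * (κ * t) by ring]
  have himr : ∀ (p m : ℝ) (E F : ℂ), (Z * ((p : ℂ) * ((m : ℂ) * E - F))).im =
      p * (m * (Z * E).im - (Z * F).im) := by
    intro p m E F
    rw [show Z * ((p : ℂ) * ((m : ℂ) * E - F)) = (p : ℂ) * ((m : ℂ) * (Z * E) - Z * F) by ring,
      Complex.im_ofReal_mul, Complex.sub_im, Complex.im_ofReal_mul]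
  have heq : ∑ n ∈ Finset.Ico a b, r n ^ (-(1 / 2) : ℝ) *
        (μ ^ (3 / 2 : ℝ) * latticeWave Z (μ * r n) - latticeWave Z (r n)) =
      ∑' k : ℤ × ℤ, planeNorm k ^ (-(5 / 2) : ℝ) *
        (Z * phaseDiff r a b μ (planeNorm k)).im := by
    have hterm : ∀ n, r n ^ (-(1 / 2) : ℝ) *
        (μ ^ (3 / 2 : ℝ) * latticeWave Z (μ * r n) - latticeWave Z (r n)) =
        ∑' k : ℤ × ℤ, planeNorm k ^ (-(5 / 2) : ℝ) * (Z * (((r n ^ (-(1 / 2) : ℝ) : ℝ) : ℂ) *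
          ((μ ^ (3 / 2 : ℝ) : ℝ) * expi (planeNorm k * (μ * r n)) -
            expi (planeNorm k * r n)))).im := by
      intro n
      rw [latticeWave, latticeWave, ← tsum_mul_left, ← ((summable_latticeWave Z _).mul_left
        _).tsum_sub (summable_latticeWave Z _), ← tsum_mul_left]
      refine tsum_congr fun k => ?_
      rw [hexp, hexp, himr]
      ring
    simp only [hterm]
    rw [← Summable.tsum_finsetSum]
    · refine tsum_congr fun k => ?_
      rw [phaseDiff, Finset.mul_sum, Complex.im_sum, Finset.mul_sum]
    · intro n _
      have := (((summable_latticeWave Z (μ * r n)).mul_left (μ ^ (3 / 2 : ℝ))).sub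
        (summable_latticeWave Z (r n))).mul_left (r n ^ (-(1 / 2) : ℝ))
      refine this.congr fun k => ?_
      rw [hexp, hexp, himr]
      ring
  rw [heq]
  have him : ∀ k, |planeNorm k ^ (-(5 / 2) : ℝ) * (Z * phaseDiff r a b μ (planeNorm k)).im| ≤
      planeNorm k ^ (-(5 / 2) : ℝ) * (‖Z‖ * ‖phaseDiff r a b μ (planeNorm k)‖) := by
    intro k
    rw [abs_mul, abs_of_nonneg (planeNorm_rpow_nonneg _ _)]
    refine mul_le_mul_of_nonneg_left ?_ (planeNorm_rpow_nonneg _ _)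
    rw [← norm_mul]
    exact Complex.abs_im_le_norm _
  refine (hsum _ (550 * ‖Z‖ * h * ρ ^ (-(1 / 2) : ℝ) * (N * √lam + 1 / (K * √lam)))
    (3 * ‖Z‖ * N * ρ ^ (-(1 / 2) : ℝ)) X (by positivity) (by positivity) hX (fun k => ?_)
    (fun k => ?_)).trans ?_
  · rcases eq_or_ne k 0 with rfl | hk
    · simp [planeNorm_zero]
    have hk1 := one_le_planeNorm hk
    have hk0 : 0 < planeNorm k := by linarith
    refine (him k).trans ?_
    calc _ ≤ planeNorm k ^ (-(5 / 2) : ℝ) * (‖Z‖ * (550 * h * ρ ^ (-(1 / 2) : ℝ) *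
          √(planeNorm k) * (N * √lam + 1 / (K * √lam)))) := by
          gcongr
          exact H.norm_phaseDiff_le_sqrt hk1 h1 h2 hK hμ
      _ = 550 * ‖Z‖ * h * ρ ^ (-(1 / 2) : ℝ) * (N * √lam + 1 / (K * √lam)) *
          planeNorm k ^ (-2 : ℝ) := by
          rw [Real.sqrt_eq_rpow, show (-2 : ℝ) = -(5 / 2) + 1 / 2 by norm_num,
            Real.rpow_add hk0]
          ring
      _ ≤ _ := mul_le_mul_of_nonneg_left (planeNorm_rpow_neg_le k (by norm_num)) (by positivity)
  · refine (him k).trans ?_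
    calc _ ≤ ‖k‖ ^ (-(5 / 2) : ℝ) * (‖Z‖ * (3 * N * ρ ^ (-(1 / 2) : ℝ))) :=
          mul_le_mul (planeNorm_rpow_neg_le k (by norm_num))
            (mul_le_mul_of_nonneg_left (H.norm_phaseDiff_le_card h1 h2) (norm_nonneg _))
            (by positivity) (by positivity)
      _ = _ := by ring
  · have e1 : 0 ≤ ‖Z‖ * ρ ^ (-(1 / 2) : ℝ) * (N * (X : ℝ) ^ (-(1 / 4) : ℝ)) := by positivity
    have e2 : 3 * (‖Z‖ * ρ ^ (-(1 / 2) : ℝ) * (N * (X : ℝ) ^ (-(1 / 4) : ℝ))) ≤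
        550 * h * (‖Z‖ * ρ ^ (-(1 / 2) : ℝ) * (N * (X : ℝ) ^ (-(1 / 4) : ℝ))) :=
      mul_le_mul_of_nonneg_right (by linarith) e1
    have e3 := mul_le_mul_of_nonneg_left e2 hC.le
    linarith

end Sequences

/-- The error term of the circle problem for the radius `r`. -/
noncomputable def circleError (r : ℝ) : ℝ := circleCount (r ^ 2) - Real.pi * r ^ 2

/-- The difference quotient of the Riesz mean between the radii `r` and `μ r`. -/
noncomputable def rieszQuotient (μ r : ℝ) : ℝ :=
  (rieszMean ((μ * r) ^ 2) - rieszMean (r ^ 2)) / ((μ ^ 2 - 1) * r ^ 2)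

theorem circleCount_le_rieszQuotient {μ r : ℝ} (hμ : 1 < μ) (hr : 0 < r) :
    circleCount (r ^ 2) ≤ rieszQuotient μ r := by
  have h0 : 0 < (μ ^ 2 - 1) * r ^ 2 := mul_pos (by nlinarith) (by positivity)
  rw [rieszQuotient, le_div_iff₀ h0, mul_comm]
  have := (mul_circleCount_le (x := r ^ 2) h0.le).1
  rwa [show r ^ 2 + (μ ^ 2 - 1) * r ^ 2 = (μ * r) ^ 2 by ring] at this

theorem rieszQuotient_le_circleCount {μ r : ℝ} (hμ0 : 0 < μ) (hμ : μ < 1) (hr : 0 < r) :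
    rieszQuotient μ r ≤ circleCount (r ^ 2) := by
  have h0 : 0 < (1 - μ ^ 2) * r ^ 2 := mul_pos (by nlinarith) (by positivity)
  have := (mul_circleCount_le (x := (μ * r) ^ 2) h0.le).2
  rw [show (μ * r) ^ 2 + (1 - μ ^ 2) * r ^ 2 = r ^ 2 by ring] at this
  rw [rieszQuotient, ← neg_div_neg_eq, div_le_iff₀ (by linarith)]
  linarith

/-- The subtracted term is the quotient of the main term, as μ⁴ - 1 = (μ² - 1)(μ² + 1). Division by
μ² - 1 costs Kρ. The wave then carries r^(3/2)/r² = r^(-1/2), and the O(r^(1/2)) remainder becomes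
O(Kρ^(-1/2)) for each radius. -/
theorem exists_abs_sum_rieszQuotient_le :
    ∃ C : ℝ, 0 < C ∧ ∀ {r : ℕ → ℝ} {a b : ℕ} {ρ lam h : ℝ}, IsConcaveBlock r a b ρ lam h →
      ∀ (μ K : ℝ) (X : ℕ), 1 ≤ K → |μ - 1| = 1 / (K * ρ) → 1 ≤ X →
      |∑ n ∈ Finset.Ico a b,
        (rieszQuotient μ (r n) - Real.pi / 2 * (μ ^ 2 + 1) * r n ^ 2)| ≤
      C * h * ((1 + Real.log X) *
          (K * ρ ^ (1 / 2 : ℝ) * ((b - a : ℕ) : ℝ) * √lam + ρ ^ (1 / 2 : ℝ) / √lam) +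
        K * ρ ^ (1 / 2 : ℝ) * ((b - a : ℕ) : ℝ) * (X : ℝ) ^ (-(1 / 4) : ℝ) +
        ((b - a : ℕ) : ℝ) * K * ρ ^ (-(1 / 2) : ℝ)) := by
  obtain ⟨Z, C₁, hC₁, hA⟩ := exists_rieszMean_asymptotic
  obtain ⟨C₂, hC₂, hW⟩ := exists_abs_sum_latticeWave_le
  refine ⟨C₂ * ‖Z‖ + 3 * C₁, by positivity, ?_⟩
  intro r a b ρ lam h H μ K X hK hμ hX
  have hρ2 := H.two_le
  have hρ0 : 0 < ρ := by linarith
  have hK0 : 0 < K := by linarith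
  have hh := H.one_le
  have hl : 0 < √lam := Real.sqrt_pos.2 H.lam_pos
  have hlog : 0 ≤ Real.log X := Real.log_nonneg (by exact_mod_cast hX)
  set N := ((b - a : ℕ) : ℝ) with hNdef
  have hN : 0 ≤ N := by positivity
  set ε := 1 / (K * ρ) with hε
  have hε0 : 0 < ε := by positivity
  have hε2 : ε ≤ 1 / 2 := by
    rw [hε, div_le_div_iff₀ (by positivity) (by norm_num)]
    nlinarith
  have hμb := abs_le.1 (hμ.le.trans hε2)
  have hμ1 : 1 / 2 ≤ μ := by linarith [hμb.1]
  have hμ2 : μ ≤ 3 / 2 := by linarith [hμb.2]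
  have hμ0 : 0 < μ := by linarith
  have hden : ε ≤ |μ ^ 2 - 1| := by
    rw [show μ ^ 2 - 1 = (μ - 1) * (μ + 1) by ring, abs_mul, hμ, abs_of_pos (by linarith)]
    nlinarith
  have hden0 : 0 < |μ ^ 2 - 1| := hε0.trans_le hden
  have hne : μ ^ 2 - 1 ≠ 0 := abs_pos.1 hden0
  have hinv : |μ ^ 2 - 1|⁻¹ ≤ K * ρ := by
    rw [show K * ρ = ε⁻¹ by rw [hε, one_div, inv_inv]]
    exact inv_anti₀ hε0 hden
  set R : ℝ → ℝ := fun r => rieszMean (r ^ 2) - Real.pi / 2 * r ^ 4 -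
    r ^ (3 / 2 : ℝ) * latticeWave Z r with hR
  have hsplit : ∀ n ∈ Finset.Ico a b,
      rieszQuotient μ (r n) - Real.pi / 2 * (μ ^ 2 + 1) * r n ^ 2 =
      (μ ^ 2 - 1)⁻¹ * (r n ^ (-(1 / 2) : ℝ) *
        (μ ^ (3 / 2 : ℝ) * latticeWave Z (μ * r n) - latticeWave Z (r n))) +
      (μ ^ 2 - 1)⁻¹ * ((R (μ * r n) - R (r n)) / r n ^ 2) := by
    intro n hn
    rw [Finset.mem_Ico] at hn
    have hr := H.pos hn.1 hn.2
    have e1 : (μ * r n) ^ (3 / 2 : ℝ) = μ ^ (3 / 2 : ℝ) * r n ^ (3 / 2 : ℝ) :=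
      Real.mul_rpow hμ0.le hr.le
    have e2 : r n ^ (3 / 2 : ℝ) = r n ^ 2 * r n ^ (-(1 / 2) : ℝ) := by
      rw [← Real.rpow_natCast, ← Real.rpow_add hr]; norm_num
    rw [rieszQuotient]
    simp only [hR]
    rw [e1, e2]
    field_simp
    ring
  have herr : ∀ n ∈ Finset.Ico a b,
      |(μ ^ 2 - 1)⁻¹ * ((R (μ * r n) - R (r n)) / r n ^ 2)| ≤
        3 * C₁ * (K * ρ ^ (-(1 / 2) : ℝ)) := by
    intro n hn
    rw [Finset.mem_Ico] at hn
    have hr := H.pos hn.1 hn.2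
    have hrρ := H.lower n hn.1 hn.2
    have f1 : |R (r n)| ≤ C₁ * r n ^ (1 / 2 : ℝ) := hA _ (by linarith)
    have f2 : |R (μ * r n)| ≤ C₁ * (μ * r n) ^ (1 / 2 : ℝ) := hA _ (by nlinarith)
    have f3 : (μ * r n) ^ (1 / 2 : ℝ) ≤ 2 * r n ^ (1 / 2 : ℝ) := by
      rw [← Real.sqrt_eq_rpow, ← Real.sqrt_eq_rpow]
      exact sqrt_le_two_mul_sqrt (by nlinarith)
    have f4 : |R (μ * r n) - R (r n)| ≤ 3 * C₁ * r n ^ (1 / 2 : ℝ) := by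
      refine (abs_sub _ _).trans ?_
      nlinarith [mul_le_mul_of_nonneg_left f3 hC₁.le]
    have f5 : r n ^ (1 / 2 : ℝ) / r n ^ 2 = r n ^ (-(1 / 2) : ℝ) * (r n)⁻¹ := by
      rw [← Real.rpow_natCast, ← Real.rpow_sub hr, ← Real.rpow_neg_one, ← Real.rpow_add hr]
      norm_num
    rw [abs_mul, abs_inv, abs_div, abs_of_nonneg (by positivity : 0 ≤ r n ^ 2)]
    calc |μ ^ 2 - 1|⁻¹ * (|R (μ * r n) - R (r n)| / r n ^ 2) ≤
          (K * ρ) * (3 * C₁ * r n ^ (1 / 2 : ℝ) / r n ^ 2) := by gcongr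
      _ = (K * ρ) * (3 * C₁ * (r n ^ (-(1 / 2) : ℝ) * (r n)⁻¹)) := by rw [mul_div_assoc, f5]
      _ ≤ (K * ρ) * (3 * C₁ * (ρ ^ (-(1 / 2) : ℝ) * ρ⁻¹)) := by
          have := H.rpow_le hn.1 hn.2
          gcongr
      _ = _ := by field_simp
  rw [Finset.sum_congr rfl hsplit, Finset.sum_add_distrib, ← Finset.mul_sum]
  refine (abs_add_le _ _).trans ?_
  have g1 := hW H Z μ K X hμ1 hμ2 hK hμ hX
  have g2 : |(μ ^ 2 - 1)⁻¹ * ∑ n ∈ Finset.Ico a b, r n ^ (-(1 / 2) : ℝ) *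
      (μ ^ (3 / 2 : ℝ) * latticeWave Z (μ * r n) - latticeWave Z (r n))| ≤
      (K * ρ) * (C₂ * ‖Z‖ * h * ρ ^ (-(1 / 2) : ℝ) * ((N * √lam + 1 / (K * √lam)) *
        (1 + Real.log X) + N * (X : ℝ) ^ (-(1 / 4) : ℝ))) := by
    rw [abs_mul, abs_inv]
    exact mul_le_mul hinv g1 (abs_nonneg _) (by positivity)
  have g3 : |∑ n ∈ Finset.Ico a b, (μ ^ 2 - 1)⁻¹ * ((R (μ * r n) - R (r n)) / r n ^ 2)| ≤
      N * (3 * C₁ * (K * ρ ^ (-(1 / 2) : ℝ))) := by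
    refine (Finset.abs_sum_le_sum_abs _ _).trans ((Finset.sum_le_sum herr).trans ?_)
    rw [Finset.sum_const, Nat.card_Ico, nsmul_eq_mul]
  have g4 : ρ * ρ ^ (-(1 / 2) : ℝ) = ρ ^ (1 / 2 : ℝ) := by
    rw [← Real.rpow_one_add' hρ0.le (by norm_num)]; norm_num
  have g5 : (K * ρ) * (C₂ * ‖Z‖ * h * ρ ^ (-(1 / 2) : ℝ) * ((N * √lam + 1 / (K * √lam)) *
        (1 + Real.log X) + N * (X : ℝ) ^ (-(1 / 4) : ℝ))) =
      C₂ * ‖Z‖ * h * ((1 + Real.log X) *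
          (K * ρ ^ (1 / 2 : ℝ) * N * √lam + ρ ^ (1 / 2 : ℝ) / √lam) +
        K * ρ ^ (1 / 2 : ℝ) * N * (X : ℝ) ^ (-(1 / 4) : ℝ)) := by
    rw [← g4]
    field_simp
  rw [g5] at g2
  refine (add_le_add g2 g3).trans ?_
  set U := (1 + Real.log X) * (K * ρ ^ (1 / 2 : ℝ) * N * √lam + ρ ^ (1 / 2 : ℝ) / √lam) +
        K * ρ ^ (1 / 2 : ℝ) * N * (X : ℝ) ^ (-(1 / 4) : ℝ) with hU
  have hU0 : 0 ≤ U := by positivity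
  set V := N * K * ρ ^ (-(1 / 2) : ℝ) with hV
  have hV0 : 0 ≤ V := by positivity
  have g6 : N * (3 * C₁ * (K * ρ ^ (-(1 / 2) : ℝ))) = 3 * C₁ * V := by rw [hV]; ring
  rw [g6]
  have g7 : 3 * C₁ * V ≤ 3 * C₁ * h * V := by
    have : 0 ≤ 3 * C₁ * V := by positivity
    nlinarith
  have g8 : 0 ≤ C₂ * ‖Z‖ * h * V := by positivity
  have g9 : 0 ≤ 3 * C₁ * h * U := by positivity
  have g10 : (C₂ * ‖Z‖ + 3 * C₁) * h * (U + V) = C₂ * ‖Z‖ * h * U + C₂ * ‖Z‖ * h * V +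
      3 * C₁ * h * U + 3 * C₁ * h * V := by ring
  rw [g10]
  linarith

/-- The bound for the sum of the circle problem error terms over a block of radii. -/
theorem exists_abs_sum_circleError_le :
    ∃ C : ℝ, 0 < C ∧ ∀ {r : ℕ → ℝ} {a b : ℕ} {ρ lam h : ℝ}, IsConcaveBlock r a b ρ lam h →
      ∀ (K : ℝ) (X : ℕ), 1 ≤ K → 1 ≤ X →
      |∑ n ∈ Finset.Ico a b, circleError (r n)| ≤
      C * h * (((b - a : ℕ) : ℝ) * ρ / K + ((1 + Real.log X) *
          (K * ρ ^ (1 / 2 : ℝ) * ((b - a : ℕ) : ℝ) * √lam + ρ ^ (1 / 2 : ℝ) / √lam) +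
        K * ρ ^ (1 / 2 : ℝ) * ((b - a : ℕ) : ℝ) * (X : ℝ) ^ (-(1 / 4) : ℝ) +
        ((b - a : ℕ) : ℝ) * K * ρ ^ (-(1 / 2) : ℝ))) := by
  obtain ⟨C, hC, hQ⟩ := exists_abs_sum_rieszQuotient_le
  refine ⟨C + 20, by positivity, ?_⟩
  intro r a b ρ lam h H K X hK hX
  have hρ2 := H.two_le
  have hρ0 : 0 < ρ := by linarith
  have hK0 : 0 < K := by linarith
  have hh := H.one_le
  have hl : 0 < √lam := Real.sqrt_pos.2 H.lam_pos
  have hlog : 0 ≤ Real.log X := Real.log_nonneg (by exact_mod_cast hX)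
  set N := ((b - a : ℕ) : ℝ) with hNdef
  have hN : 0 ≤ N := by positivity
  set W := (1 + Real.log X) * (K * ρ ^ (1 / 2 : ℝ) * N * √lam + ρ ^ (1 / 2 : ℝ) / √lam) +
        K * ρ ^ (1 / 2 : ℝ) * N * (X : ℝ) ^ (-(1 / 4) : ℝ) + N * K * ρ ^ (-(1 / 2) : ℝ) with hW
  have hW0 : 0 ≤ W := by positivity
  set ε := 1 / (K * ρ) with hε
  have hε0 : 0 < ε := by positivity
  have hε2 : ε ≤ 1 / 2 := by
    rw [hε, div_le_div_iff₀ (by positivity) (by norm_num)]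
    nlinarith
  have hεK : ε * ρ ^ 2 = ρ / K := by rw [hε]; field_simp
  -- The factor 1 + ε bounds the count from above and 1 - ε bounds it from below.
  have h1 := hQ H (1 + ε) K X hK (by rw [add_sub_cancel_left, abs_of_pos hε0]) hX
  have h2 := hQ H (1 - ε) K X hK
    (by rw [show 1 - ε - 1 = -ε by ring, abs_neg, abs_of_pos hε0]) hX
  rw [← hNdef, ← hW] at h1 h2
  have hsq : ∀ n ∈ Finset.Ico a b, r n ^ 2 ≤ 4 * ρ ^ 2 := by
    intro n hn
    rw [Finset.mem_Ico] at hn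
    nlinarith [H.upper n hn.1 hn.2, H.pos hn.1 hn.2]
  have hpi := Real.pi_lt_d2
  have hpi0 := Real.pi_pos
  -- The bias of the main term, (π/2)|μ² - 1|r² with r ≤ 2ρ, is below 20ερ² = 20ρ/K.
  have hcard : ∑ _n ∈ Finset.Ico a b, 20 * (ρ / K) = 20 * (N * ρ / K) := by
    rw [Finset.sum_const, Nat.card_Ico, nsmul_eq_mul]; ring
  have hup : ∑ n ∈ Finset.Ico a b, circleError (r n) ≤
      ∑ n ∈ Finset.Ico a b, (rieszQuotient (1 + ε) (r n) -
        Real.pi / 2 * ((1 + ε) ^ 2 + 1) * r n ^ 2) + 20 * (N * ρ / K) := by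
    rw [← hcard, ← Finset.sum_add_distrib]
    refine Finset.sum_le_sum fun n hn => ?_
    have e1 := hsq n hn
    rw [Finset.mem_Ico] at hn
    have e2 := circleCount_le_rieszQuotient (μ := 1 + ε) (by linarith) (H.pos hn.1 hn.2)
    rw [circleError, ← hεK]
    have e3 : ε * (2 + ε) * r n ^ 2 ≤ ε * (5 / 2) * (4 * ρ ^ 2) := by gcongr; linarith
    have e4 : Real.pi * (ε * (2 + ε) * r n ^ 2) ≤ 3.15 * (ε * (5 / 2) * (4 * ρ ^ 2)) :=
      mul_le_mul hpi.le e3 (by positivity) (by norm_num)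
    have e5 : Real.pi / 2 * ((1 + ε) ^ 2 + 1) * r n ^ 2 =
      Real.pi * r n ^ 2 + 1 / 2 * (Real.pi * (ε * (2 + ε) * r n ^ 2)) := by ring
    linarith [mul_pos hε0 (pow_pos hρ0 2)]
  have hlo : ∑ n ∈ Finset.Ico a b, (rieszQuotient (1 - ε) (r n) -
        Real.pi / 2 * ((1 - ε) ^ 2 + 1) * r n ^ 2) - 20 * (N * ρ / K) ≤
      ∑ n ∈ Finset.Ico a b, circleError (r n) := by
    rw [← hcard, ← Finset.sum_sub_distrib]
    refine Finset.sum_le_sum fun n hn => ?_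
    have e1 := hsq n hn
    rw [Finset.mem_Ico] at hn
    have e2 := rieszQuotient_le_circleCount (μ := 1 - ε) (by linarith) (by linarith)
      (H.pos hn.1 hn.2)
    rw [circleError, ← hεK]
    have e3 : ε * (2 - ε) * r n ^ 2 ≤ ε * 2 * (4 * ρ ^ 2) := by gcongr; linarith
    have e4 : Real.pi * (ε * (2 - ε) * r n ^ 2) ≤ 3.15 * (ε * 2 * (4 * ρ ^ 2)) :=
      mul_le_mul hpi.le e3 (mul_nonneg (mul_nonneg hε0.le (by linarith)) (by positivity))
        (by norm_num)
    have e5 : Real.pi / 2 * ((1 - ε) ^ 2 + 1) * r n ^ 2 =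
      Real.pi * r n ^ 2 - 1 / 2 * (Real.pi * (ε * (2 - ε) * r n ^ 2)) := by ring
    linarith [mul_pos hε0 (pow_pos hρ0 2)]
  have hY0 : 0 ≤ N * ρ / K := by positivity
  have k1 := (abs_le.1 h1).2
  have k2 := (abs_le.1 h2).1
  have k3 : 20 * (N * ρ / K) ≤ 20 * h * (N * ρ / K) := by nlinarith
  have k4 : 0 ≤ C * h * (N * ρ / K) := by positivity
  have k5 : 0 ≤ 20 * h * W := by positivity
  have k6 : (C + 20) * h * (N * ρ / K + W) =
      C * h * (N * ρ / K) + 20 * h * (N * ρ / K) + C * h * W + 20 * h * W := by ring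
  rw [k6, abs_le]
  constructor <;> linarith

/-- The elementary bound `O(r)` for the error in the circle problem. -/
theorem exists_abs_circleError_le :
    ∃ C : ℝ, 0 < C ∧ ∀ r : ℝ, 0 ≤ r → |circleError r| ≤ C * (r + 1) := by
  obtain ⟨C, hC, hB⟩ := exists_abs_sum_circleError_le
  have hmono : ∀ x y : ℝ, x ≤ y → circleCount x ≤ circleCount y := by
    intro x y hxy
    rw [circleCount, circleCount, Nat.cast_le]
    exact Set.ncard_le_ncard (fun k hk => le_trans (b := x) hk hxy) (finite_sq_add_sq_le y)
  obtain ⟨c, hc⟩ : ∃ c, circleCount (2 ^ 2) = c := ⟨_, rfl⟩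
  have h4 : 0 ≤ c := by rw [← hc, circleCount]; positivity
  refine ⟨5 * C + c + 13, by positivity, fun r hr => ?_⟩
  rcases le_or_gt 2 r with h2 | h2
  · have H : IsConcaveBlock (fun _ => r) 0 1 r 1 1 :=
      ⟨h2, one_pos, le_rfl, fun n _ _ => le_rfl, fun n _ _ => le_rfl, fun n _ _ => by linarith,
        fun n _ h => by omega, fun n _ h => by omega⟩
    have := hB H 1 1 le_rfl le_rfl
    simp only [Nat.Ico_zero_eq_range, Finset.range_one, Finset.sum_singleton] at this
    refine this.trans ?_
    have e1 : r ^ (1 / 2 : ℝ) ≤ r := by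
      conv_rhs => rw [← Real.rpow_one r]
      exact Real.rpow_le_rpow_of_exponent_le (by linarith) (by norm_num)
    have e2 : r ^ (-(1 / 2) : ℝ) ≤ 1 :=
      Real.rpow_le_one_of_one_le_of_nonpos (by linarith) (by norm_num)
    have e3 : C * (4 * r + 1) ≤ (5 * C + c + 13) * (r + 1) := by nlinarith [mul_nonneg h4 hr]
    refine le_trans ?_ e3
    rw [mul_one]
    refine mul_le_mul_of_nonneg_left ?_ hC.le
    simp only [Nat.sub_zero, Nat.cast_one, one_mul, mul_one, div_one, Real.log_one, add_zero,
      Real.sqrt_one, Real.one_rpow]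
    linarith
  · rw [circleError, abs_le]
    have e1 : circleCount (r ^ 2) ≤ c := hc ▸ hmono _ _ (by nlinarith)
    have e2 : 0 ≤ circleCount (r ^ 2) := by rw [circleCount]; positivity
    have e3 : Real.pi * r ^ 2 ≤ 3.15 * 4 :=
      mul_le_mul Real.pi_lt_d2.le (by nlinarith) (by positivity) (by norm_num)
    have e4 : 0 ≤ Real.pi * r ^ 2 := by positivity
    constructor <;> nlinarith [mul_nonneg hC.le hr, mul_nonneg h4 hr]

/-! ### The radii of the slices: second differences on dyadic blocks -/

/-- The mean value theorem twice, first for f(s) - f(s+1) and then for f', makes the second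
difference a value of -f''. -/
theorem second_difference_mem {f f' f'' : ℝ → ℝ} {x L U : ℝ}
    (h1 : ∀ t ∈ Set.Icc x (x + 2), HasDerivAt f (f' t) t)
    (h2 : ∀ t ∈ Set.Icc x (x + 2), HasDerivAt f' (f'' t) t)
    (hb : ∀ t ∈ Set.Icc x (x + 2), L ≤ -f'' t ∧ -f'' t ≤ U) :
    L ≤ 2 * f (x + 1) - f (x + 2) - f x ∧ 2 * f (x + 1) - f (x + 2) - f x ≤ U := by
  have hd : ∀ t ∈ Set.Icc x (x + 1), HasDerivAt (fun s => f s - f (s + 1)) (f' t - f' (t + 1)) t := by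
    intro t ht
    exact (h1 t ⟨ht.1, by linarith [ht.2]⟩).sub
      ((h1 (t + 1) ⟨by linarith [ht.1], by linarith [ht.2]⟩).comp_add_const t 1)
  obtain ⟨ξ, hξ, hξ'⟩ := exists_hasDerivAt_eq_slope _ _ (by linarith : x < x + 1)
    (fun t ht => (hd t ht).continuousAt.continuousWithinAt)
    (fun t ht => hd t (Set.Ioo_subset_Icc_self ht))
  obtain ⟨η, hη, hη'⟩ := exists_hasDerivAt_eq_slope f' f'' (by linarith : ξ < ξ + 1)
    (fun t ht => (h2 t ⟨by linarith [hξ.1, ht.1],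
      by linarith [hξ.2, ht.2]⟩).continuousAt.continuousWithinAt)
    (fun t ht => h2 t ⟨by linarith [hξ.1, ht.1], by linarith [hξ.2, ht.2]⟩)
  have e : 2 * f (x + 1) - f (x + 2) - f x = -f'' η := by
    rw [add_sub_cancel_left, div_one] at hξ' hη'
    rw [show x + 1 + 1 = x + 2 by ring] at hξ'
    linarith
  rw [e]
  exact hb η ⟨by linarith [hξ.1, hη.1], by linarith [hξ.2, hη.2]⟩

/-- The radius of the slice of the dilate at height `t`. -/
noncomputable def rad (α R t : ℝ) : ℝ := (R ^ α - t ^ α) ^ (1 / α)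

section Radius

variable {α R : ℝ}

theorem rpow_sub_rpow_pos (hα : 2 < α) {t : ℝ} (ht0 : 0 ≤ t) (htR : t < R) :
    0 < R ^ α - t ^ α :=
  sub_pos.2 (Real.rpow_lt_rpow ht0 htR (by linarith))

theorem hasDerivAt_rpow_sub (hα : 2 < α) {t p : ℝ} (ht0 : 0 < t) (htR : t < R) :
    HasDerivAt (fun t : ℝ => (R ^ α - t ^ α) ^ p)
      (-(p * α * t ^ (α - 1) * (R ^ α - t ^ α) ^ (p - 1))) t := by
  have h := ((Real.hasDerivAt_rpow_const (x := t) (p := α) (Or.inl ht0.ne')).const_sub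
    (R ^ α)).rpow_const (p := p) (Or.inl (rpow_sub_rpow_pos hα ht0.le htR).ne')
  exact h.congr_deriv (by ring)

theorem hasDerivAt_rad (hα : 2 < α) {t : ℝ} (ht0 : 0 < t) (htR : t < R) :
    HasDerivAt (rad α R) (-(t ^ (α - 1) * (R ^ α - t ^ α) ^ (1 / α - 1))) t := by
  have hα0 : α ≠ 0 := by linarith
  refine (hasDerivAt_rpow_sub (p := 1 / α) hα ht0 htR).congr_deriv ?_
  rw [one_div_mul_cancel hα0, one_mul]

/-- With G = R^α - t^α, the product rule gives (α-1) t^(α-2) G^(1/α-2) times G + t^α = R^α. The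
single term that remains shows concavity and the size of the second differences. -/
theorem hasDerivAt_rad_deriv (hα : 2 < α) {t : ℝ} (ht0 : 0 < t) (htR : t < R) :
    HasDerivAt (fun t => -(t ^ (α - 1) * (R ^ α - t ^ α) ^ (1 / α - 1)))
      (-((α - 1) * R ^ α * t ^ (α - 2) * (R ^ α - t ^ α) ^ (1 / α - 2))) t := by
  have hα0 : α ≠ 0 := by linarith
  have hG := rpow_sub_rpow_pos hα ht0.le htR
  have h1 := Real.hasDerivAt_rpow_const (x := t) (p := α - 1) (Or.inl ht0.ne')
  refine ((h1.mul (hasDerivAt_rpow_sub (p := 1 / α - 1) hα ht0 htR)).neg).congr_deriv ?_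
  have e1 : (R ^ α - t ^ α) ^ (1 / α - 1) =
      (R ^ α - t ^ α) ^ (1 / α - 2) * (R ^ α - t ^ α) := by
    rw [← Real.rpow_add_one hG.ne']; congr 1; ring
  have e2 : t ^ (α - 1) * t ^ (α - 1) = t ^ (α - 2) * t ^ α := by
    rw [← Real.rpow_add ht0, ← Real.rpow_add ht0]; congr 1; ring
  have e3 : (1 / α - 1) * α = 1 - α := by field_simp
  rw [show α - 1 - 1 = α - 2 by ring, show 1 / α - 1 - 1 = 1 / α - 2 by ring, e1, e3]
  linear_combination (R ^ α - t ^ α) ^ (1 / α - 2) * (1 - α) * e2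

theorem rad_anti (hα : 2 < α) {s t : ℝ} (hs : 0 ≤ s) (hst : s ≤ t) (htR : t ≤ R) :
    rad α R t ≤ rad α R s := by
  have h1 : t ^ α ≤ R ^ α := Real.rpow_le_rpow (hs.trans hst) htR (by linarith)
  have h2 : s ^ α ≤ t ^ α := Real.rpow_le_rpow hs hst (by linarith)
  exact Real.rpow_le_rpow (by linarith) (by linarith) (by positivity)

theorem rad_nonneg (hα : 2 < α) {t : ℝ} (ht0 : 0 ≤ t) (htR : t ≤ R) : 0 ≤ rad α R t := by
  have h1 : t ^ α ≤ R ^ α := Real.rpow_le_rpow ht0 htR (by linarith)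
  exact Real.rpow_nonneg (by linarith) _

theorem le_rad_iff (hα : 2 < α) {t x : ℝ} (ht0 : 0 ≤ t) (htR : t ≤ R) (hx : 0 ≤ x) :
    x ≤ rad α R t ↔ x ^ α ≤ R ^ α - t ^ α := by
  have h1 : t ^ α ≤ R ^ α := Real.rpow_le_rpow ht0 htR (by linarith)
  rw [rad, one_div, Real.le_rpow_inv_iff_of_pos hx (by linarith) (by linarith)]

theorem rad_le_iff (hα : 2 < α) {t x : ℝ} (ht0 : 0 ≤ t) (htR : t ≤ R) (hx : 0 ≤ x) :
    rad α R t ≤ x ↔ R ^ α - t ^ α ≤ x ^ α := by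
  have h1 : t ^ α ≤ R ^ α := Real.rpow_le_rpow ht0 htR (by linarith)
  rw [rad, one_div, Real.rpow_inv_le_iff_of_pos (by linarith) hx (by linarith)]

theorem rad_le (hα : 2 < α) {t : ℝ} (ht0 : 0 ≤ t) (htR : t ≤ R) : rad α R t ≤ R := by
  rw [rad_le_iff hα ht0 htR (ht0.trans htR)]
  have : 0 ≤ t ^ α := by positivity
  linarith

theorem isConcaveBlock_rad (hα : 2 < α) {a b : ℕ} {ρ lam h lo hi : ℝ} (hρ : 2 ≤ ρ) (hlam : 0 < lam)
    (hh : 1 ≤ h) (hlo : 0 < lo) (hhi : hi < R) (hmem : ∀ n : ℕ, a ≤ n → n < b → lo ≤ n ∧ (n : ℝ) ≤ hi)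
    (h1 : ∀ t, lo ≤ t → t ≤ hi → ρ ^ α ≤ R ^ α - t ^ α ∧ R ^ α - t ^ α ≤ (2 * ρ) ^ α)
    (h2 : ∀ t, lo ≤ t → t ≤ hi →
      lam ≤ (α - 1) * R ^ α * t ^ (α - 2) * (R ^ α - t ^ α) ^ (1 / α - 2) ∧
      (α - 1) * R ^ α * t ^ (α - 2) * (R ^ α - t ^ α) ^ (1 / α - 2) ≤ h * lam) :
    IsConcaveBlock (fun n => rad α R n) a b ρ lam h := by
  have hsd : ∀ n : ℕ, a ≤ n → n + 2 < b →
      lam ≤ 2 * rad α R ((n + 1 : ℕ) : ℝ) - rad α R ((n + 2 : ℕ) : ℝ) - rad α R n ∧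
      2 * rad α R ((n + 1 : ℕ) : ℝ) - rad α R ((n + 2 : ℕ) : ℝ) - rad α R n ≤ h * lam := by
    intro n hn hn'
    have e1 := (hmem n hn (by omega)).1
    have e2 := (hmem (n + 2) (by omega) hn').2
    push_cast at e2 ⊢
    refine second_difference_mem
      (fun t ht => hasDerivAt_rad hα (by linarith [ht.1]) (by linarith [ht.2]))
      (fun t ht => hasDerivAt_rad_deriv hα (by linarith [ht.1]) (by linarith [ht.2]))
      (fun t ht => ?_)
    rw [neg_neg]
    exact h2 t (by linarith [ht.1]) (by linarith [ht.2])
  refine ⟨hρ, hlam, hh, fun n hn hn' => ?_, fun n hn hn' => ?_, fun n hn hn' => ?_,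
    fun n hn hn' => (hsd n hn hn').1, fun n hn hn' => (hsd n hn hn').2⟩
  · have e2 := (hmem (n + 1) (by omega) hn').2
    exact rad_anti hα (by positivity) (by push_cast; linarith) (by linarith)
  · have e2 := hmem n hn hn'
    rw [le_rad_iff hα (by positivity) (by linarith [e2.2]) (by linarith)]
    exact (h1 n e2.1 e2.2).1
  · have e2 := hmem n hn hn'
    rw [rad_le_iff hα (by positivity) (by linarith [e2.2]) (by linarith)]
    exact (h1 n e2.1 e2.2).2

/-- Blocks of heights near the equator. -/
theorem isConcaveBlock_equator (hα : 2 < α) {T : ℝ} (hR : 4 ≤ R) (hT : 0 < T) (hTR : 4 * T ≤ R) :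
    IsConcaveBlock (fun n => rad α R n) (⌊T⌋₊ + 1) (⌊2 * T⌋₊ + 1) (R / 2)
      ((α - 1) * (T / R) ^ (α - 2) * R⁻¹) (2 ^ α) := by
  have hR0 : 0 < R := by linarith
  have hα0 : 0 < α := by linarith
  have hRα : 0 < R ^ α := by positivity
  -- The lower bound lam is -r'' with t = T and R^α - t^α replaced by R^α.
  have hlamE : (α - 1) * (T / R) ^ (α - 2) * R⁻¹ =
      (α - 1) * R ^ α * T ^ (α - 2) * (R ^ α) ^ (1 / α - 2) := by
    rw [Real.div_rpow hT.le hR0.le, ← Real.rpow_mul hR0.le,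
      show α * (1 / α - 2) = (-1) + (-(α - 2) + -α) by field_simp; ring, Real.rpow_add hR0,
      Real.rpow_add hR0, Real.rpow_neg_one, Real.rpow_neg hR0.le, Real.rpow_neg hR0.le]
    field_simp
  have hG : ∀ t, T ≤ t → t ≤ 2 * T → R ^ α / 2 ≤ R ^ α - t ^ α ∧ R ^ α - t ^ α ≤ R ^ α := by
    intro t h1 h2
    have e1 : t ^ α ≤ (R / 2) ^ α := Real.rpow_le_rpow (by linarith) (by linarith) hα0.le
    rw [Real.div_rpow hR0.le (by norm_num)] at e1
    have e2 : (2 : ℝ) ≤ 2 ^ α := by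
      conv_lhs => rw [← Real.rpow_one 2]
      exact Real.rpow_le_rpow_of_exponent_le (by norm_num) (by linarith)
    have e3 : R ^ α / 2 ^ α ≤ R ^ α / 2 := by gcongr
    have e4 : 0 ≤ t ^ α := Real.rpow_nonneg (by linarith) _
    constructor <;> linarith
  refine isConcaveBlock_rad hα (lo := T) (hi := 2 * T) (by linarith) ?_ ?_ hT (by linarith)
    (fun n hn hn' => ⟨?_, ?_⟩) (fun t h1 h2 => ⟨?_, ?_⟩) (fun t h1 h2 => ⟨?_, ?_⟩)
  · have : 0 < α - 1 := by linarith
    positivity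
  · exact Real.one_le_rpow (by norm_num) hα0.le
  · exact (Nat.lt_of_floor_lt hn).le
  · exact (Nat.le_floor_iff (by linarith)).1 (Nat.lt_succ_iff.1 hn')
  · refine le_trans ?_ (hG t h1 h2).1
    rw [Real.div_rpow hR0.le (by norm_num)]
    have e2 : (2 : ℝ) ≤ 2 ^ α := by
      conv_lhs => rw [← Real.rpow_one 2]
      exact Real.rpow_le_rpow_of_exponent_le (by norm_num) (by linarith)
    gcongr
  · rw [mul_div_cancel₀ R (by norm_num)]
    exact (hG t h1 h2).2
  · rw [hlamE]
    have e1 : (R ^ α) ^ (1 / α - 2) ≤ (R ^ α - t ^ α) ^ (1 / α - 2) := by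
      refine Real.rpow_le_rpow_of_nonpos (by linarith [(hG t h1 h2).1]) (hG t h1 h2).2 ?_
      have : 1 / α ≤ 1 := by rw [div_le_one hα0]; linarith
      linarith
    have e2 : T ^ (α - 2) ≤ t ^ (α - 2) := Real.rpow_le_rpow hT.le h1 (by linarith)
    have : 0 < α - 1 := by linarith
    have ht0 : 0 < t := by linarith
    gcongr
  · rw [hlamE]
    have e0 : 0 ≤ R ^ α - t ^ α := by linarith [(hG t h1 h2).1]
    have e1 : (R ^ α - t ^ α) ^ (1 / α - 2) ≤ (R ^ α / 2) ^ (1 / α - 2) := by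
      refine Real.rpow_le_rpow_of_nonpos (by positivity) (hG t h1 h2).1 ?_
      have : 1 / α ≤ 1 := by rw [div_le_one hα0]; linarith
      linarith
    have e2 : t ^ (α - 2) ≤ (2 * T) ^ (α - 2) :=
      Real.rpow_le_rpow (by linarith) h2 (by linarith)
    have e3 : (R ^ α / 2) ^ (1 / α - 2) = (R ^ α) ^ (1 / α - 2) * 2 ^ (2 - 1 / α) := by
      rw [Real.div_rpow hRα.le (by norm_num), div_eq_mul_inv, ← Real.rpow_neg (by norm_num)]
      congr 2; ring
    -- The ratio of the extreme values: the first factor comes from t ≤ 2T, the second from R^α -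
    -- t^α ≥ R^α/2.
    have e4 : (2 : ℝ) ^ (α - 2) * 2 ^ (2 - 1 / α) ≤ 2 ^ α := by
      rw [← Real.rpow_add (by norm_num)]
      refine Real.rpow_le_rpow_of_exponent_le (by norm_num) ?_
      have : 0 < 1 / α := by positivity
      linarith
    have e5 : 0 < α - 1 := by linarith
    have e6 : 0 ≤ (R ^ α - t ^ α) ^ (1 / α - 2) := Real.rpow_nonneg e0 _
    calc _ ≤ (α - 1) * R ^ α * (2 * T) ^ (α - 2) * (R ^ α / 2) ^ (1 / α - 2) := by gcongr
      _ = 2 ^ (α - 2) * 2 ^ (2 - 1 / α) *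
          ((α - 1) * R ^ α * T ^ (α - 2) * (R ^ α) ^ (1 / α - 2)) := by
          rw [e3, Real.mul_rpow (by norm_num) hT.le]; ring
      _ ≤ _ := by gcongr

/-- Bernoulli's inequality. It ensures that the radii of a pole block stay within a factor 2,
although R^α - r^α type quantities there vary by up to 2α. -/
theorem two_mul_le_two_rpow (hα : 2 < α) : 2 * α ≤ 2 ^ α := by
  have h := one_add_mul_self_le_rpow_one_add (s := 1) (by norm_num) (p := α - 1) (by linarith)
  rw [show (1 : ℝ) + 1 = 2 by norm_num, Real.rpow_sub_one (by norm_num)] at h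
  linarith

/-- The ratio between the extreme values of the second derivative on a block near the poles. -/
noncomputable def poleRatio (α : ℝ) : ℝ := 2 ^ (α - 2) * (2 * α) ^ (2 - 1 / α)

theorem one_le_poleRatio (hα : 2 < α) : 1 ≤ poleRatio α := by
  have : 1 / α ≤ 1 := by rw [div_le_one (by linarith)]; linarith
  exact one_le_mul_of_one_le_of_one_le (Real.one_le_rpow (by norm_num) (by linarith))
    (Real.one_le_rpow (by linarith) (by linarith))

/-- Blocks of heights near the poles. -/
theorem isConcaveBlock_pole (hα : 2 < α) {V : ℝ} (hR : 4 ≤ R) (hV : 1 ≤ V) (hVR : 4 * V ≤ R) :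
    IsConcaveBlock (fun n => rad α R n) (⌊R - 2 * V⌋₊ + 1) (⌊R - V⌋₊ + 1) (R * (V / R) ^ (1 / α))
      ((α - 1) * (V / R) ^ (1 / α - 2) * R⁻¹ / poleRatio α) (poleRatio α) := by
  have hR0 : 0 < R := by linarith
  have hV0 : 0 < V := by linarith
  have hα0 : 0 < α := by linarith
  have hα1 : 0 < α - 1 := by linarith
  have hRα : 0 < R ^ α := by positivity
  have hh := one_le_poleRatio hα
  have hh0 : 0 < poleRatio α := by linarith
  have hinv : 1 / α ≤ 1 / 2 := one_div_le_one_div_of_le (by norm_num) hα.le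
  set σ := V / R with hσ
  have hσ0 : 0 < σ := by positivity
  have hσV : R * σ = V := by rw [hσ]; field_simp
  have hρα : (R * σ ^ (1 / α)) ^ α = R ^ α * σ := by
    rw [Real.mul_rpow hR0.le (by positivity), ← Real.rpow_mul hσ0.le, one_div_mul_cancel hα0.ne',
      Real.rpow_one]
  -- The lower bound uses x^α ≤ x for x = t/R ≤ 1, the upper one Bernoulli's inequality.
  have hG : ∀ t, R - 2 * V ≤ t → t ≤ R - V →
      R ^ α * σ ≤ R ^ α - t ^ α ∧ R ^ α - t ^ α ≤ 2 * α * (R ^ α * σ) := by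
    intro t h1 h2
    have ht0 : 0 < t := by linarith
    have htE : t ^ α = R ^ α * (t / R) ^ α := by
      rw [Real.div_rpow ht0.le hR0.le]; field_simp
    have hx0 : 0 < t / R := by positivity
    have hx1 : t / R ≤ 1 - σ := by
      rw [div_le_iff₀ hR0]; linarith
    have hx2 : 1 - 2 * σ ≤ t / R := by
      rw [le_div_iff₀ hR0]; linarith
    have e1 : (t / R) ^ α ≤ t / R := by
      conv_rhs => rw [← Real.rpow_one (t / R)]
      exact Real.rpow_le_rpow_of_exponent_ge hx0 (by linarith) (by linarith)
    have e2 := one_add_mul_self_le_rpow_one_add (s := t / R - 1) (by linarith) (p := α)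
      (by linarith)
    rw [add_sub_cancel] at e2
    have e3 : 1 - 2 * α * σ ≤ (t / R) ^ α := by nlinarith
    rw [htE]
    constructor
    · nlinarith
    · nlinarith
  have hUE : (α - 1) * σ ^ (1 / α - 2) * R⁻¹ =
      (α - 1) * R ^ α * R ^ (α - 2) * (R ^ α * σ) ^ (1 / α - 2) := by
    rw [Real.mul_rpow hRα.le hσ0.le, ← Real.rpow_mul hR0.le,
      show α * (1 / α - 2) = (-1) + (-(α - 2) + -α) by field_simp; ring, Real.rpow_add hR0,
      Real.rpow_add hR0, Real.rpow_neg_one, Real.rpow_neg hR0.le, Real.rpow_neg hR0.le]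
    field_simp
  have hlam : (α - 1) * σ ^ (1 / α - 2) * R⁻¹ / poleRatio α =
      (α - 1) * R ^ α * (R / 2) ^ (α - 2) * (2 * α * (R ^ α * σ)) ^ (1 / α - 2) := by
    rw [div_eq_iff hh0.ne', hUE, poleRatio, Real.div_rpow hR0.le (by norm_num),
      Real.mul_rpow (x := 2 * α) (y := R ^ α * σ) (by positivity) (by positivity),
      show 2 - 1 / α = -(1 / α - 2) by ring, Real.rpow_neg (by positivity)]
    field_simp
  refine isConcaveBlock_rad hα (lo := R - 2 * V) (hi := R - V) ?_ (by positivity) hh (by linarith)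
    (by linarith) (fun n hn hn' => ⟨?_, ?_⟩) (fun t h1 h2 => ⟨?_, ?_⟩) (fun t h1 h2 => ⟨?_, ?_⟩)
  · have e1 : (R⁻¹) ^ (1 / 2 : ℝ) ≤ σ ^ (1 / α) := by
      calc (R⁻¹) ^ (1 / 2 : ℝ) ≤ (R⁻¹) ^ (1 / α) :=
            Real.rpow_le_rpow_of_exponent_ge (by positivity)
              (inv_le_one_of_one_le₀ (by linarith)) hinv
        _ ≤ σ ^ (1 / α) := by
            refine Real.rpow_le_rpow (by positivity) ?_ (by positivity)
            rw [hσ, inv_eq_one_div]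
            gcongr
    have e2 : R * (R⁻¹) ^ (1 / 2 : ℝ) = √R := by
      rw [← Real.sqrt_eq_rpow, Real.sqrt_inv]
      nth_rw 1 [← Real.mul_self_sqrt hR0.le]
      have : √R ≠ 0 := (Real.sqrt_pos.2 hR0).ne'
      field_simp
    have e3 : 2 ≤ √R := Real.le_sqrt_of_sq_le (by linarith)
    calc 2 ≤ R * (R⁻¹) ^ (1 / 2 : ℝ) := by rw [e2]; exact e3
      _ ≤ _ := by gcongr
  · exact (Nat.lt_of_floor_lt hn).le
  · exact (Nat.le_floor_iff (by linarith)).1 (Nat.lt_succ_iff.1 hn')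
  · rw [hρα]
    exact (hG t h1 h2).1
  · rw [Real.mul_rpow (by norm_num) (by positivity), hρα]
    refine (hG t h1 h2).2.trans ?_
    exact mul_le_mul_of_nonneg_right (two_mul_le_two_rpow hα) (by positivity)
  · rw [hlam]
    have e0 : 0 < R ^ α - t ^ α := lt_of_lt_of_le (by positivity) (hG t h1 h2).1
    have e1 := Real.rpow_le_rpow_of_nonpos e0 (hG t h1 h2).2
      (by linarith : 1 / α - 2 ≤ 0)
    have e2 : (R / 2) ^ (α - 2) ≤ t ^ (α - 2) :=
      Real.rpow_le_rpow (by positivity) (by linarith) (by linarith)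
    have ht0 : 0 < t := by linarith
    gcongr
  · rw [mul_div_cancel₀ _ hh0.ne', hUE]
    have e0 : 0 < R ^ α - t ^ α := lt_of_lt_of_le (by positivity) (hG t h1 h2).1
    have e1 := Real.rpow_le_rpow_of_nonpos (by positivity) (hG t h1 h2).1
      (by linarith : 1 / α - 2 ≤ 0)
    have e2 : t ^ (α - 2) ≤ R ^ (α - 2) :=
      Real.rpow_le_rpow (by linarith) (by linarith) (by linarith)
    have e3 : 0 ≤ t ^ (α - 2) := Real.rpow_nonneg (by linarith) _
    gcongr

end Radius

/-! ### Summation of the circle errors over dyadic blocks -/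

theorem one_le_log {R : ℝ} (hR : 4 ≤ R) : 1 ≤ Real.log R := by
  rw [Real.le_log_iff_exp_le (by linarith)]
  linarith [Real.exp_one_lt_d9]

/-- The block bound with the truncation parameter chosen as a power of `R`. -/
theorem exists_abs_sum_circleError_le_log :
    ∃ C : ℝ, 0 < C ∧ ∀ {r : ℕ → ℝ} {a b : ℕ} {ρ lam h : ℝ}, IsConcaveBlock r a b ρ lam h →
      ∀ R K N : ℝ, 4 ≤ R → ρ ≤ R → 1 ≤ K → ((b - a : ℕ) : ℝ) ≤ N →
      |∑ n ∈ Finset.Ico a b, circleError (r n)| ≤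
        C * h * Real.log R * (N * ρ / K + K * N * √(ρ * lam) + √(ρ / lam) + N * K) := by
  obtain ⟨C, hC, hB⟩ := exists_abs_sum_circleError_le
  refine ⟨10 * C, by positivity, ?_⟩
  intro r a b ρ lam h H R K N hR hρR hK hNle
  have hρ2 := H.two_le
  have hρ0 : 0 < ρ := by linarith
  have hK0 : 0 < K := by linarith
  have hR0 : 0 < R := by linarith
  have hh := H.one_le
  have hlam := H.lam_pos
  have hL := one_le_log hR
  set M := ((b - a : ℕ) : ℝ) with hM
  have hM0 : 0 ≤ M := by positivity
  have hN0 : 0 ≤ N := hM0.trans hNle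
  have hceil : 1 ≤ ⌈R⌉₊ := Nat.one_le_ceil_iff.2 hR0
  have hcR : R ≤ ⌈R⌉₊ := Nat.le_ceil R
  have hcR2 : (⌈R⌉₊ : ℝ) ≤ R ^ 2 := by
    have := (Nat.ceil_lt_add_one hR0.le).le
    nlinarith
  have hX1 : 1 ≤ ⌈R⌉₊ ^ 4 := Nat.one_le_pow _ _ hceil
  -- The fourth power makes X^(-1/4) ≤ 1/R, so the tail is harmless, while log X stays O(log R).
  have h0 := hB H K (⌈R⌉₊ ^ 4) hK hX1
  have hlogX : 1 + Real.log ((⌈R⌉₊ ^ 4 : ℕ) : ℝ) ≤ 9 * Real.log R := by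
    push_cast
    rw [Real.log_pow]
    have := Real.log_le_log (by linarith) hcR2
    rw [Real.log_pow] at this
    push_cast at this ⊢
    linarith
  have hXpow : (((⌈R⌉₊ ^ 4 : ℕ) : ℝ)) ^ (-(1 / 4) : ℝ) ≤ R⁻¹ := by
    have : (((⌈R⌉₊ ^ 4 : ℕ) : ℝ)) ^ (-(1 / 4) : ℝ) = (⌈R⌉₊ : ℝ)⁻¹ := by
      push_cast
      rw [← Real.rpow_natCast, ← Real.rpow_mul (by positivity), ← Real.rpow_neg_one]
      norm_num
    rw [this]
    exact inv_anti₀ hR0 hcR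
  rw [← Real.sqrt_eq_rpow] at h0
  have hsρR : √ρ ≤ R := Real.sqrt_le_iff.2 ⟨hR0.le, by nlinarith⟩
  have e1 : M * ρ / K ≤ Real.log R * (N * ρ / K) := by
    have : M * ρ / K ≤ N * ρ / K := by gcongr
    have h' : 0 ≤ N * ρ / K := by positivity
    nlinarith
  have e2 : (1 + Real.log ((⌈R⌉₊ ^ 4 : ℕ) : ℝ)) * (K * √ρ * M * √lam + √ρ / √lam) ≤
      9 * Real.log R * (K * N * √(ρ * lam) + √(ρ / lam)) := by
    rw [Real.sqrt_mul hρ0.le, Real.sqrt_div hρ0.le]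
    have : K * √ρ * M * √lam ≤ K * N * (√ρ * √lam) := by
      calc K * √ρ * M * √lam ≤ K * √ρ * N * √lam := by gcongr
        _ = _ := by ring
    gcongr
  have e3 : K * √ρ * M * (((⌈R⌉₊ ^ 4 : ℕ) : ℝ)) ^ (-(1 / 4) : ℝ) ≤ N * K := by
    calc _ ≤ K * R * N * R⁻¹ := by gcongr
      _ = N * K := by field_simp
  have e4 : M * K * ρ ^ (-(1 / 2) : ℝ) ≤ N * K := by
    have : ρ ^ (-(1 / 2) : ℝ) ≤ 1 :=
      Real.rpow_le_one_of_one_le_of_nonpos (by linarith) (by norm_num)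
    calc _ ≤ N * K * 1 := by gcongr
      _ = N * K := mul_one _
  refine h0.trans ?_
  have hNK : N * K ≤ Real.log R * (N * K) := by
    have : 0 ≤ N * K := by positivity
    nlinarith
  have hCh : 0 ≤ C * h := by positivity
  have f1 : 0 ≤ Real.log R * (N * ρ / K) := by positivity
  have f2 : 0 ≤ Real.log R * (K * N * √(ρ * lam) + √(ρ / lam)) := by positivity
  have f3 : 0 ≤ Real.log R * (N * K) := by positivity
  calc C * h * _ ≤ C * h * (10 * (Real.log R *
        (N * ρ / K + K * N * √(ρ * lam) + √(ρ / lam) + N * K))) := by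
        refine mul_le_mul_of_nonneg_left ?_ hCh
        linarith
    _ = _ := by ring

/-- The sum of the circle problem errors over the heights `1 ≤ n ≤ y`. -/
noncomputable def errorSum (α R y : ℝ) : ℝ :=
  ∑ n ∈ Finset.Ico 1 (⌊y⌋₊ + 1), circleError (rad α R n)

theorem errorSum_sub (α R : ℝ) {x y : ℝ} (hxy : x ≤ y) :
    errorSum α R y - errorSum α R x =
      ∑ n ∈ Finset.Ico (⌊x⌋₊ + 1) (⌊y⌋₊ + 1), circleError (rad α R n) := by
  have h : ⌊x⌋₊ ≤ ⌊y⌋₊ := Nat.floor_le_floor hxy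
  rw [errorSum, errorSum, ← Finset.sum_Ico_consecutive _ (by omega : 1 ≤ ⌊x⌋₊ + 1)
    (by omega : ⌊x⌋₊ + 1 ≤ ⌊y⌋₊ + 1), add_sub_cancel_left]

theorem cast_floor_sub_le {x y d : ℝ} (hx : 0 ≤ x) (hxy : x ≤ y) (hd : y - x + 1 ≤ d) :
    (((⌊y⌋₊ + 1 - (⌊x⌋₊ + 1) : ℕ)) : ℝ) ≤ d := by
  have h : ⌊x⌋₊ ≤ ⌊y⌋₊ := Nat.floor_le_floor hxy
  rw [Nat.cast_sub (by omega)]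
  push_cast
  have := Nat.floor_le (hx.trans hxy)
  have := Nat.lt_floor_add_one x
  linarith

/-- Here N = 2T, ρ = R/2, and K = √R balances Nρ/K against NK. The second term is √(ρ/λ), which
records the flatness of the body at the equator. -/
theorem exists_abs_errorSum_equator_le {α : ℝ} (hα : 2 < α) :
    ∃ C : ℝ, 0 < C ∧ ∀ R T : ℝ, 4 ≤ R → 1 ≤ T → 4 * T ≤ R →
      |errorSum α R (2 * T) - errorSum α R T| ≤
        C * Real.log R * (T * √R + R * (T / R) ^ (-((α - 2) / 2))) := by
  obtain ⟨C, hC, hB⟩ := exists_abs_sum_circleError_le_log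
  refine ⟨C * 2 ^ α * (4 + 2 * α), by positivity, fun R T hR hT hTR => ?_⟩
  have hR0 : 0 < R := by linarith
  have hT0 : 0 < T := by linarith
  have hα1 : 0 < α - 1 := by linarith
  have hL := one_le_log hR
  rw [errorSum_sub _ _ (by linarith)]
  set τ := T / R with hτ
  have hτ0 : 0 < τ := by positivity
  have hτ1 : τ ≤ 1 := by rw [hτ, div_le_one hR0]; linarith
  have hsR : 1 ≤ √R := Real.le_sqrt_of_sq_le (by linarith)
  have hRR : √R * √R = R := Real.mul_self_sqrt hR0.le
  refine (hB (isConcaveBlock_equator hα hR hT0 hTR) R √R (2 * T) hR (by linarith) hsR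
    (cast_floor_sub_le hT0.le (by linarith) (by linarith))).trans ?_
  have hτp : τ ^ (α - 2) ≤ 1 := Real.rpow_le_one hτ0.le hτ1 (by linarith)
  have hτp0 : 0 < τ ^ (α - 2) := by positivity
  have e1 : 2 * T * (R / 2) / √R ≤ 2 * (T * √R) := by
    rw [div_le_iff₀ (by linarith)]
    nlinarith
  have e2 : √(R / 2 * ((α - 1) * τ ^ (α - 2) * R⁻¹)) ≤ α := by
    refine Real.sqrt_le_iff.2 ⟨by linarith, ?_⟩
    have : R / 2 * ((α - 1) * τ ^ (α - 2) * R⁻¹) = (α - 1) * τ ^ (α - 2) / 2 := by field_simp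
    rw [this]
    nlinarith
  have e3 : √(R / 2 / ((α - 1) * τ ^ (α - 2) * R⁻¹)) ≤ R * τ ^ (-((α - 2) / 2)) := by
    refine Real.sqrt_le_iff.2 ⟨by positivity, ?_⟩
    have : (R * τ ^ (-((α - 2) / 2))) ^ 2 = R ^ 2 / τ ^ (α - 2) := by
      have : (τ ^ (-((α - 2) / 2))) ^ 2 = (τ ^ (α - 2))⁻¹ := by
        rw [← Real.rpow_natCast (τ ^ _), ← Real.rpow_mul hτ0.le, ← Real.rpow_neg hτ0.le]
        congr 1
        push_cast; ring
      rw [mul_pow, this, div_eq_mul_inv]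
    rw [this, show R / 2 / ((α - 1) * τ ^ (α - 2) * R⁻¹) =
      R ^ 2 / τ ^ (α - 2) * (1 / (2 * (α - 1))) by field_simp]
    refine mul_le_of_le_one_right (by positivity) ?_
    rw [div_le_one (by positivity)]
    linarith
  have e4 : √R * (2 * T) * √(R / 2 * ((α - 1) * τ ^ (α - 2) * R⁻¹)) ≤ √R * (2 * T) * α := by
    gcongr
  have g1 : 0 ≤ T * √R := by positivity
  have g2 : 0 ≤ R * τ ^ (-((α - 2) / 2)) := by positivity
  calc _ ≤ C * 2 ^ α * Real.log R *
        ((4 + 2 * α) * (T * √R + R * τ ^ (-((α - 2) / 2)))) := by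
        refine mul_le_mul_of_nonneg_left ?_ (by positivity)
        nlinarith
    _ = _ := by ring

/-- Here N = 2V and √(ρλ) = O(R/V). The choice K = √V makes Nρ/K and KN√(ρλ) both O(R√V), while
√(ρ/λ) is only O(V). -/
theorem exists_abs_errorSum_pole_le {α : ℝ} (hα : 2 < α) :
    ∃ C : ℝ, 0 < C ∧ ∀ R V : ℝ, 4 ≤ R → 1 ≤ V → 4 * V ≤ R →
      |errorSum α R (R - V) - errorSum α R (R - 2 * V)| ≤ C * Real.log R * (R * √V) := by
  obtain ⟨C, hC, hB⟩ := exists_abs_sum_circleError_le_log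
  have hh := one_le_poleRatio hα
  refine ⟨C * poleRatio α * (4 + 2 * α + poleRatio α), by positivity, fun R V hR hV hVR => ?_⟩
  have hR0 : 0 < R := by linarith
  have hV0 : 0 < V := by linarith
  have hα0 : 0 < α := by linarith
  have hα1 : 0 < α - 1 := by linarith
  have hL := one_le_log hR
  rw [errorSum_sub _ _ (by linarith)]
  set h := poleRatio α with hhdef
  have hh0 : 0 < h := by linarith
  have hblock := isConcaveBlock_pole hα hR hV hVR
  set σ := V / R with hσ
  have hσ0 : 0 < σ := by positivity
  have hσ1 : σ ≤ 1 := by rw [hσ, div_le_one hR0]; linarith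
  have hσV : R * σ = V := by rw [hσ]; field_simp
  have hsV : 1 ≤ √V := Real.le_sqrt_of_sq_le (by linarith)
  have hVV : √V * √V = V := Real.mul_self_sqrt hV0.le
  have hσα : σ ^ (1 / α) ≤ 1 := Real.rpow_le_one hσ0.le hσ1 (by positivity)
  have hσα0 : 0 < σ ^ (1 / α) := by positivity
  have hρR : R * σ ^ (1 / α) ≤ R := mul_le_of_le_one_right hR0.le hσα
  refine (hB hblock R √V (2 * V) hR hρR hsV
    (cast_floor_sub_le (by linarith) (by linarith) (by linarith))).trans ?_
  have hσ2 : σ ^ (1 / α - 2) = σ ^ (1 / α) / σ ^ 2 := by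
    rw [Real.rpow_sub hσ0, Real.rpow_two]
  have hsVR : √V ≤ R := Real.sqrt_le_iff.2 ⟨hR0.le, by nlinarith⟩
  have e1 : 2 * V * (R * σ ^ (1 / α)) / √V ≤ 2 * (R * √V) := by
    rw [div_le_iff₀ (by linarith)]
    calc 2 * V * (R * σ ^ (1 / α)) ≤ 2 * V * R := by gcongr
      _ = 2 * (R * √V) * √V := by linear_combination (-2 * R) * hVV
  have e2 : √(R * σ ^ (1 / α) * ((α - 1) * σ ^ (1 / α - 2) * R⁻¹ / h)) ≤ α * (R / V) := by
    refine Real.sqrt_le_iff.2 ⟨by positivity, ?_⟩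
    have : R * σ ^ (1 / α) * ((α - 1) * σ ^ (1 / α - 2) * R⁻¹ / h) =
        (σ ^ (1 / α) * σ ^ (1 / α) * (α - 1) / h) * (R / V) ^ 2 := by
      rw [hσ2, ← hσV]; field_simp
    rw [this, mul_pow]
    refine mul_le_mul_of_nonneg_right ?_ (by positivity)
    calc σ ^ (1 / α) * σ ^ (1 / α) * (α - 1) / h ≤ 1 * 1 * (α - 1) / 1 := by gcongr
      _ ≤ α ^ 2 := by nlinarith
  have e3 : √(R * σ ^ (1 / α) / ((α - 1) * σ ^ (1 / α - 2) * R⁻¹ / h)) ≤ h * (R * √V) := by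
    refine Real.sqrt_le_iff.2 ⟨by positivity, ?_⟩
    have : R * σ ^ (1 / α) / ((α - 1) * σ ^ (1 / α - 2) * R⁻¹ / h) =
        h * V ^ 2 / (α - 1) := by
      rw [hσ2, ← hσV]; field_simp
    rw [this]
    calc h * V ^ 2 / (α - 1) ≤ h * V ^ 2 / 1 := by gcongr; linarith
      _ ≤ h ^ 2 * V ^ 2 := by rw [div_one]; gcongr; nlinarith
      _ = (h * (√V * √V)) ^ 2 := by rw [hVV]; ring
      _ ≤ (h * (R * √V)) ^ 2 := by gcongr
  have e4 : √V * (2 * V) * √(R * σ ^ (1 / α) * ((α - 1) * σ ^ (1 / α - 2) * R⁻¹ / h)) ≤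
      2 * α * (R * √V) := by
    calc _ ≤ √V * (2 * V) * (α * (R / V)) := by gcongr
      _ = _ := by field_simp
  have e5 : 2 * V * √V ≤ 2 * (R * √V) := by nlinarith
  calc _ ≤ C * h * Real.log R * ((4 + 2 * α + h) * (R * √V)) := by
        refine mul_le_mul_of_nonneg_left ?_ (by positivity)
        linarith
    _ = _ := by ring

/-- Telescoping over the halvings of U. The decaying geometric series is governed by its first term,
the growing one by its last. -/
theorem abs_sub_le_of_dyadic {F : ℝ → ℝ} {U A B q p : ℝ} {n : ℕ} (hA : 0 ≤ A) (hB : 0 ≤ B)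
    (hq0 : 0 ≤ q) (hq : q < 1) (hp : 1 < p)
    (h : ∀ i < n, |F (U / 2 ^ i) - F (U / 2 ^ (i + 1))| ≤ A * q ^ i + B * p ^ i) :
    |F U - F (U / 2 ^ n)| ≤ A / (1 - q) + B * p ^ n / (p - 1) := by
  have hq1 : 0 < 1 - q := by linarith
  have hp1 : 0 < p - 1 := by linarith
  have key : ∀ m ≤ n, |F U - F (U / 2 ^ m)| ≤
      A * (1 - q ^ m) / (1 - q) + B * (p ^ m - 1) / (p - 1) := by
    intro m
    induction m with
    | zero => intro _; simp
    | succ m ih =>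
      intro hm
      have h1 := ih (by omega)
      have h2 := h m (by omega)
      have h3 := abs_sub_le (F U) (F (U / 2 ^ m)) (F (U / 2 ^ (m + 1)))
      have h4 : A * (1 - q ^ (m + 1)) / (1 - q) = A * (1 - q ^ m) / (1 - q) + A * q ^ m := by
        field_simp; ring
      have h5 : B * (p ^ (m + 1) - 1) / (p - 1) = B * (p ^ m - 1) / (p - 1) + B * p ^ m := by
        field_simp; ring
      linarith
  refine (key n le_rfl).trans (add_le_add ?_ ?_)
  · have : 0 ≤ q ^ n := by positivity
    gcongr
    nlinarith
  · gcongr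
    linarith

theorem exists_dyadic_cutoff (R : ℝ) {Y : ℝ} (hY : 0 < Y) :
    ∃ n : ℕ, R / 2 ^ (n + 1) ≤ Y ∧ ∀ i < n, Y < R / 2 ^ (i + 1) := by
  have hex : ∃ n : ℕ, R / 2 ^ (n + 1) ≤ Y := by
    obtain ⟨n, hn⟩ := pow_unbounded_of_one_lt (R / Y) (by norm_num : (1 : ℝ) < 2)
    refine ⟨n, ?_⟩
    rw [div_lt_iff₀ hY] at hn
    rw [div_le_iff₀ (by positivity), pow_succ]
    nlinarith [pow_pos (by norm_num : (0 : ℝ) < 2) n]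
  classical
  exact ⟨Nat.find hex, Nat.find_spec hex, fun i hi => not_le.1 (Nat.find_min hex hi)⟩

/-- Each slice contributes O(R); this covers the heights left over by the dyadic blocks. -/
theorem exists_abs_errorSum_sub_le_mul {α : ℝ} (hα : 2 < α) :
    ∃ C : ℝ, 0 < C ∧ ∀ R x y : ℝ, 1 ≤ R → 0 ≤ x → x ≤ y → y ≤ R →
      |errorSum α R y - errorSum α R x| ≤ C * R * (y - x + 1) := by
  obtain ⟨C, hC, h⟩ := exists_abs_circleError_le
  refine ⟨2 * C, by positivity, fun R x y hR hx hxy hyR => ?_⟩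
  rw [errorSum_sub _ _ hxy]
  refine (Finset.abs_sum_le_sum_abs _ _).trans ?_
  have hterm : ∀ n ∈ Finset.Ico (⌊x⌋₊ + 1) (⌊y⌋₊ + 1), |circleError (rad α R n)| ≤ 2 * C * R := by
    intro n hn
    have hn' : (n : ℝ) ≤ y :=
      (Nat.le_floor_iff (hx.trans hxy)).1 (Nat.lt_succ_iff.1 (Finset.mem_Ico.1 hn).2)
    have h1 := rad_nonneg hα (t := n) (by positivity) (hn'.trans hyR)
    have h2 := rad_le hα (t := n) (by positivity) (hn'.trans hyR)
    refine (h _ h1).trans ?_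
    nlinarith
  refine (Finset.sum_le_sum hterm).trans ?_
  rw [Finset.sum_const, Nat.card_Ico, nsmul_eq_mul, mul_comm]
  have := cast_floor_sub_le hx hxy le_rfl
  gcongr

/-- The sum of the circle problem errors over all positive heights. -/
theorem exists_abs_errorSum_le {α : ℝ} (hα : 2 < α) :
    ∃ C : ℝ, 0 < C ∧ ∀ R : ℝ, 4 ≤ R →
      |errorSum α R R| ≤ C * ((R ^ (3 / 2 : ℝ) + R ^ (2 - 2 / α)) * Real.log R) := by
  obtain ⟨C₁, hC₁, hE⟩ := exists_abs_errorSum_equator_le hα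
  obtain ⟨C₂, hC₂, hP⟩ := exists_abs_errorSum_pole_le hα
  obtain ⟨C₃, hC₃, hT⟩ := exists_abs_errorSum_sub_le_mul hα
  have hα0 : 0 < α := by linarith
  set β := (α - 2) / 2 with hβ
  have hβ0 : 0 < β := by rw [hβ]; linarith
  -- Halving T multiplies the flatness term by p; halving V multiplies √V by q below.
  set p := (2 : ℝ) ^ β with hp
  have hp1 : 1 < p := Real.one_lt_rpow (by norm_num) hβ0
  have hp10 : 0 < p - 1 := by linarith
  set q := √(1 / 2 : ℝ) with hq
  have hq0 : 0 ≤ q := Real.sqrt_nonneg _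
  have hq1 : q < 1 := by rw [hq, Real.sqrt_lt' one_pos]; norm_num
  have hq10 : 0 < 1 - q := by linarith
  refine ⟨2 * C₁ + C₁ * 2 ^ (α - 2) / (p - 1) + C₂ / (1 - q) + 6 * C₃, by positivity,
    fun R hR => ?_⟩
  have hR0 : 0 < R := by linarith
  have hR1 : 1 ≤ R := by linarith
  have hL := one_le_log hR
  set L := Real.log R with hLdef
  have hR32 : R * √R = R ^ (3 / 2 : ℝ) := by
    rw [Real.sqrt_eq_rpow, ← Real.rpow_one_add' hR0.le (by norm_num)]; norm_num
  -- At this height the flatness term R(T/R)^(-β) equals the trivial bound RY = R^(2-2/α).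
  set Y := R ^ (1 - 2 / α) with hY
  have hexp : 0 < 1 - 2 / α := by
    rw [sub_pos, div_lt_one hα0]; exact hα
  have hY1 : 1 ≤ Y := Real.one_le_rpow hR1 hexp.le
  have hRY : R * Y = R ^ (2 - 2 / α) := by
    rw [hY, ← Real.rpow_one_add' hR0.le (by linarith)]; congr 1; ring
  -- the heights near the equator
  obtain ⟨n, hn1, hn2⟩ := exists_dyadic_cutoff R (by linarith : 0 < 2 * Y)
  have hhalf : ∀ i : ℕ, R / 2 / 2 ^ i = R / 2 ^ (i + 1) := fun i => by
    rw [div_div, pow_succ']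
  have heq : |errorSum α R (R / 2) - errorSum α R (R / 2 / 2 ^ n)| ≤
      C₁ * L * R ^ (3 / 2 : ℝ) / (1 - 1 / 2) + C₁ * L * R * 2 ^ (α - 2) * p ^ n / (p - 1) := by
    refine abs_sub_le_of_dyadic (F := errorSum α R) (by positivity) (by positivity) (by norm_num)
      (by norm_num) hp1 fun i hi => ?_
    have hi2 := hn2 i hi
    rw [hhalf, hhalf]
    set T := R / 2 ^ (i + 1 + 1) with hTdef
    have hT2 : R / 2 ^ (i + 1) = 2 * T := by rw [hTdef, pow_succ 2 (i + 1)]; field_simp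
    rw [hT2] at hi2 ⊢
    have hpow : (1 : ℝ) ≤ 2 ^ i := one_le_pow₀ (by norm_num)
    have hT4 : 4 * T * 2 ^ i = R := by
      rw [hTdef, pow_succ, pow_succ]; field_simp; norm_num
    have hT0 : 0 < T := by positivity
    refine (hE R T hR (by linarith) (by nlinarith)).trans ?_
    have e1 : T ≤ R * (1 / 2) ^ i := by
      rw [one_div, inv_pow, ← div_eq_mul_inv, le_div_iff₀ (by positivity)]
      nlinarith
    have e2 : (T / R) ^ (-β) = 2 ^ (α - 2) * p ^ i := by
      have : T / R = (4 * 2 ^ i)⁻¹ := by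
        rw [← hT4]; field_simp
      rw [this, Real.inv_rpow (by positivity), Real.rpow_neg (by positivity), inv_inv,
        Real.mul_rpow (by norm_num) (by positivity), show (4 : ℝ) = 2 ^ (2 : ℝ) by norm_num,
        ← Real.rpow_mul (by norm_num), hp, ← Real.rpow_natCast, ← Real.rpow_natCast,
        ← Real.rpow_mul (by norm_num), ← Real.rpow_mul (by norm_num)]
      congr 2
      · rw [hβ]; ring
      · ring
    rw [e2]
    calc C₁ * L * (T * √R + R * (2 ^ (α - 2) * p ^ i)) ≤
          C₁ * L * (R * (1 / 2) ^ i * √R + R * (2 ^ (α - 2) * p ^ i)) := by gcongr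
      _ = _ := by rw [← hR32]; ring
  -- Before the cutoff the heights exceed 2Y, which forces 2^n ≤ R^(2/α), and R^((2/α)β) = Y.
  have hpn : p ^ n ≤ Y := by
    rcases Nat.eq_zero_or_pos n with hn0 | hn0
    · rw [hn0, pow_zero]; exact hY1
    have h1 := hn2 (n - 1) (by omega)
    rw [Nat.sub_add_cancel hn0, lt_div_iff₀ (by positivity)] at h1
    have h2 : (2 : ℝ) ^ n ≤ R ^ (2 / α) := by
      have h3 : Y * R ^ (2 / α) = R := by
        rw [hY, ← Real.rpow_add hR0]; simp
      have h4 : Y * 2 ^ n ≤ Y * R ^ (2 / α) := by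
        rw [h3]; nlinarith [pow_pos (by norm_num : (0 : ℝ) < 2) n]
      exact le_of_mul_le_mul_left h4 (by linarith)
    calc p ^ n = ((2 : ℝ) ^ n) ^ β := by
          rw [hp, ← Real.rpow_natCast, ← Real.rpow_natCast, ← Real.rpow_mul (by norm_num),
            ← Real.rpow_mul (by norm_num), mul_comm]
      _ ≤ (R ^ (2 / α)) ^ β := Real.rpow_le_rpow (by positivity) h2 hβ0.le
      _ = Y := by
          rw [← Real.rpow_mul hR0.le, hY, hβ]; congr 1; field_simp
  -- the heights near the pole
  obtain ⟨m, hm1, hm2⟩ := exists_dyadic_cutoff R (by norm_num : (0 : ℝ) < 2)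
  have hpo : |errorSum α R (R - R / 2) - errorSum α R (R - R / 2 / 2 ^ m)| ≤
      C₂ * L * R ^ (3 / 2 : ℝ) / (1 - q) + 0 * 2 ^ m / (2 - 1) := by
    refine abs_sub_le_of_dyadic (F := fun v => errorSum α R (R - v)) (by positivity) le_rfl hq0
      hq1 (by norm_num) fun i hi => ?_
    have hi2 := hm2 i hi
    rw [zero_mul, add_zero, hhalf, hhalf]
    set V := R / 2 ^ (i + 1 + 1) with hVdef
    have hV2 : R / 2 ^ (i + 1) = 2 * V := by rw [hVdef, pow_succ 2 (i + 1)]; field_simp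
    rw [hV2] at hi2 ⊢
    have hpow : (1 : ℝ) ≤ 2 ^ i := one_le_pow₀ (by norm_num)
    have hV4 : 4 * V * 2 ^ i = R := by
      rw [hVdef, pow_succ, pow_succ]; field_simp; norm_num
    have hV0 : 0 < V := by positivity
    rw [abs_sub_comm]
    refine (hP R V hR (by linarith) (by nlinarith)).trans ?_
    have e1 : √V ≤ √R * q ^ i := by
      refine Real.sqrt_le_iff.2 ⟨by positivity, ?_⟩
      have : (√R * q ^ i) ^ 2 = R * (1 / 2) ^ i := by
        rw [mul_pow, Real.sq_sqrt hR0.le, ← pow_mul, mul_comm i 2, pow_mul, hq,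
          Real.sq_sqrt (by norm_num)]
      rw [this, one_div, inv_pow, ← div_eq_mul_inv, le_div_iff₀ (by positivity)]
      nlinarith
    calc C₂ * L * (R * √V) ≤ C₂ * L * (R * (√R * q ^ i)) := by gcongr
      _ = _ := by rw [← hR32]; ring
  -- the remaining heights
  rw [hhalf] at heq hpo
  have hlow0 : 0 ≤ R / 2 ^ (n + 1) := by positivity
  have hlowR : R / 2 ^ (n + 1) ≤ R := div_le_self hR0.le (one_le_pow₀ (by norm_num))
  have hlow := hT R 0 (R / 2 ^ (n + 1)) hR1 le_rfl hlow0 hlowR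
  have hzero : errorSum α R 0 = 0 := by simp [errorSum]
  rw [hzero, sub_zero, sub_zero] at hlow
  have hm0 : 0 ≤ R / 2 ^ (m + 1) := by positivity
  have hhigh := hT R (R - R / 2 ^ (m + 1)) R hR1 (by linarith) (by linarith) le_rfl
  have hmid : R - R / 2 = R / 2 := by ring
  rw [hmid] at hpo
  have hlow' : |errorSum α R (R / 2 ^ (n + 1))| ≤ 3 * C₃ * (R * Y) * L := by
    refine hlow.trans ?_
    calc C₃ * R * (R / 2 ^ (n + 1) + 1) ≤ C₃ * R * (3 * Y) := by gcongr; linarith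
      _ ≤ C₃ * R * (3 * Y) * L := le_mul_of_one_le_right (by positivity) hL
      _ = _ := by ring
  have hhigh' : |errorSum α R R - errorSum α R (R - R / 2 ^ (m + 1))| ≤ 3 * C₃ * (R * Y) * L := by
    refine hhigh.trans ?_
    calc C₃ * R * (R - (R - R / 2 ^ (m + 1)) + 1) ≤ C₃ * R * (3 * Y) := by gcongr; linarith
      _ ≤ C₃ * R * (3 * Y) * L := le_mul_of_one_le_right (by positivity) hL
      _ = _ := by ring
  have heq' : C₁ * L * R ^ (3 / 2 : ℝ) / (1 - 1 / 2) +
      C₁ * L * R * 2 ^ (α - 2) * p ^ n / (p - 1) ≤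
      2 * C₁ * (R ^ (3 / 2 : ℝ) * L) + C₁ * 2 ^ (α - 2) / (p - 1) * ((R * Y) * L) := by
    have : C₁ * L * R * 2 ^ (α - 2) * p ^ n / (p - 1) ≤
        C₁ * L * R * 2 ^ (α - 2) * Y / (p - 1) := by gcongr
    have e : C₁ * L * R * 2 ^ (α - 2) * Y / (p - 1) =
        C₁ * 2 ^ (α - 2) / (p - 1) * ((R * Y) * L) := by ring
    have e' : C₁ * L * R ^ (3 / 2 : ℝ) / (1 - 1 / 2) = 2 * C₁ * (R ^ (3 / 2 : ℝ) * L) := by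
      norm_num; ring
    linarith
  have hpo' : C₂ * L * R ^ (3 / 2 : ℝ) / (1 - q) + 0 * 2 ^ m / (2 - 1) =
      C₂ / (1 - q) * (R ^ (3 / 2 : ℝ) * L) := by ring
  rw [hpo'] at hpo
  rw [← hRY]
  set P := R ^ (3 / 2 : ℝ) * L with hPdef
  set Q := R * Y * L with hQdef
  have hP0 : 0 ≤ P := by positivity
  have hQ0 : 0 ≤ Q := by positivity
  have hE1 := heq.trans heq'
  have htot : |errorSum α R R| ≤ 2 * C₁ * P + C₁ * 2 ^ (α - 2) / (p - 1) * Q +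
      C₂ / (1 - q) * P + 3 * C₃ * Q + 3 * C₃ * Q := by
    have h1 := abs_le.1 hE1
    have h2 := abs_le.1 hpo
    have h3 := abs_le.1 hlow'
    have h4 := abs_le.1 hhigh'
    rw [abs_le]
    constructor <;> linarith [h1.1, h1.2, h2.1, h2.2, h3.1, h3.2, h4.1, h4.2]
  refine htot.trans ?_
  have k1 : 0 ≤ 2 * C₁ * Q := by positivity
  have k2 : 0 ≤ C₁ * 2 ^ (α - 2) / (p - 1) * P := by positivity
  have k3 : 0 ≤ C₂ / (1 - q) * Q := by positivity
  have k4 : 0 ≤ 6 * C₃ * P := by positivity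
  have k5 : (2 * C₁ + C₁ * 2 ^ (α - 2) / (p - 1) + C₂ / (1 - q) + 6 * C₃) *
      ((R ^ (3 / 2 : ℝ) + R * Y) * L) = 2 * C₁ * P + C₁ * 2 ^ (α - 2) / (p - 1) * P +
      C₂ / (1 - q) * P + 6 * C₃ * P + 2 * C₁ * Q + C₁ * 2 ^ (α - 2) / (p - 1) * Q +
      C₂ / (1 - q) * Q + 6 * C₃ * Q := by rw [hPdef, hQdef]; ring
  rw [k5]
  linarith

/-! ### The areas of the slices against the volume -/

theorem trapezoid_le_integral_of_concaveOn {g : ℝ → ℝ} {a : ℝ}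
    (hg : ConcaveOn ℝ (Set.Icc a (a + 1)) g) (hc : ContinuousOn g (Set.Icc a (a + 1))) :
    (g a + g (a + 1)) / 2 ≤ ∫ t in a..(a + 1), g t := by
  have h : ∫ t in a..(a + 1), (g a + (t - a) * (g (a + 1) - g a)) ≤ ∫ t in a..(a + 1), g t := by
    refine intervalIntegral.integral_mono_on (by linarith)
      (Continuous.intervalIntegrable (by fun_prop) _ _)
      (ContinuousOn.intervalIntegrable_of_Icc (by linarith) hc) fun t ht => ?_
    have := hg.2 (Set.left_mem_Icc.2 (by linarith)) (Set.right_mem_Icc.2 (by linarith))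
      (by linarith [ht.2] : 0 ≤ a + 1 - t) (by linarith [ht.1] : 0 ≤ t - a) (by ring)
    simp only [smul_eq_mul] at this
    rw [show (a + 1 - t) * a + (t - a) * (a + 1) = t by ring] at this
    linarith
  refine le_trans (le_of_eq ?_) h
  have e : (fun t => g a + (t - a) * (g (a + 1) - g a)) =
      fun t => (g a - a * (g (a + 1) - g a)) + t * (g (a + 1) - g a) := by ext t; ring
  rw [e, intervalIntegral.integral_add intervalIntegrable_const
    (Continuous.intervalIntegrable (by fun_prop) _ _), intervalIntegral.integral_mul_const,
    integral_id]
  simp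
  ring

/-- Beyond a, the graph lies below the extension of the chord over [a - 1, a]. -/
theorem integral_le_of_concaveOn {g : ℝ → ℝ} {a : ℝ}
    (hg : ConcaveOn ℝ (Set.Icc (a - 1) (a + 1)) g)
    (hc : ContinuousOn g (Set.Icc (a - 1) (a + 1))) :
    ∫ t in a..(a + 1), g t ≤ g a + (g a - g (a - 1)) / 2 := by
  have h : ∫ t in a..(a + 1), g t ≤ ∫ t in a..(a + 1), (g a + (t - a) * (g a - g (a - 1))) := by
    refine intervalIntegral.integral_mono_on (by linarith)
      (ContinuousOn.intervalIntegrable_of_Icc (by linarith)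
        (hc.mono (Set.Icc_subset_Icc (by linarith) le_rfl)))
      (Continuous.intervalIntegrable (by fun_prop) _ _) fun t ht => ?_
    have hpos : 0 < 1 + (t - a) := by linarith [ht.1]
    have := hg.2 (Set.left_mem_Icc.2 (by linarith) : a - 1 ∈ _)
      (⟨by linarith [ht.1], ht.2⟩ : t ∈ Set.Icc (a - 1) (a + 1))
      (by have := ht.1; have : 0 ≤ t - a := by linarith
          positivity : 0 ≤ (t - a) / (1 + (t - a))) (by positivity : 0 ≤ 1 / (1 + (t - a)))
      (by field_simp; ring)
    simp only [smul_eq_mul] at this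
    rw [show (t - a) / (1 + (t - a)) * (a - 1) + 1 / (1 + (t - a)) * t = a by
      field_simp; ring, div_mul_eq_mul_div, one_div_mul_eq_div, ← add_div,
      div_le_iff₀ hpos] at this
    linarith
  refine h.trans (le_of_eq ?_)
  have e : (fun t => g a + (t - a) * (g a - g (a - 1))) =
      fun t => (g a - a * (g a - g (a - 1))) + t * (g a - g (a - 1)) := by ext t; ring
  rw [e, intervalIntegral.integral_add intervalIntegrable_const
    (Continuous.intervalIntegrable (by fun_prop) _ _), intervalIntegral.integral_mul_const,
    integral_id]
  simp
  ring

/-- For a concave function the trapezoidal rule errs on one side, and on each unit interval by at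
most half a second difference. These telescope, so only the values near the right end enter. -/
theorem abs_sum_sub_integral_le_of_concaveOn {g : ℝ → ℝ} {R : ℝ} (hR : 1 ≤ R)
    (hg : ConcaveOn ℝ (Set.Icc 0 R) g) (hc : ContinuousOn g (Set.Icc 0 R))
    (ha : AntitoneOn g (Set.Icc 0 R)) (h0 : ∀ t ∈ Set.Icc 0 R, 0 ≤ g t) :
    |g 0 / 2 + ∑ m ∈ Finset.Ico 1 (⌊R⌋₊ + 1), g m - ∫ t in (0 : ℝ)..R, g t| ≤
      2 * g (⌊R⌋₊ - 1) := by
  obtain ⟨n, hn⟩ : ∃ n, ⌊R⌋₊ = n + 1 :=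
    ⟨⌊R⌋₊ - 1, (Nat.sub_add_cancel (Nat.le_floor (by simpa using hR))).symm⟩
  have hnR : (n : ℝ) + 1 ≤ R := by
    have := Nat.floor_le (by linarith : 0 ≤ R)
    rw [hn] at this; push_cast at this; exact this
  have hRn : R < n + 2 := by
    have := Nat.lt_floor_add_one R
    rw [hn] at this; push_cast at this; linarith
  have hint : ∀ x y : ℝ, 0 ≤ x → x ≤ y → y ≤ R → IntervalIntegrable g volume x y :=
    fun x y hx hxy hy => ContinuousOn.intervalIntegrable_of_Icc hxy
      (hc.mono (Set.Icc_subset_Icc hx hy))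
  -- bounds for the integral over an initial segment
  have key : ∀ k : ℕ, (k : ℝ) + 1 ≤ R →
      g 0 / 2 + ∑ m ∈ Finset.Ico 1 (k + 1), g m + g (k + 1) / 2 ≤ ∫ t in (0 : ℝ)..(k + 1), g t ∧
      ∫ t in (0 : ℝ)..(k + 1), g t ≤
        g 0 / 2 + ∑ m ∈ Finset.Ico 1 (k + 1), g m + g (k + 1) / 2 + (g k - g (k + 1)) / 2 := by
    intro k
    induction k with
    | zero =>
      intro hk
      have h1 := trapezoid_le_integral_of_concaveOn (a := 0)
        (hg.subset (Set.Icc_subset_Icc le_rfl (by simpa using hR)) (convex_Icc _ _))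
        (hc.mono (Set.Icc_subset_Icc le_rfl (by simpa using hR)))
      have h2 : ∫ t in (0 : ℝ)..1, g t ≤ ∫ t in (0 : ℝ)..1, g 0 :=
        intervalIntegral.integral_mono_on zero_le_one (hint _ _ le_rfl zero_le_one hR)
          (by simp) fun t ht => ha (Set.left_mem_Icc.2 (by linarith))
            ⟨ht.1, ht.2.trans hR⟩ ht.1
      simp at h1 h2 ⊢
      exact ⟨by linarith, by linarith⟩
    | succ k ih =>
      intro hk
      push_cast at hk ⊢
      obtain ⟨ih1, ih2⟩ := ih (by linarith)
      have hk0 : (0 : ℝ) ≤ k := k.cast_nonneg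
      have h1 := trapezoid_le_integral_of_concaveOn (a := (k : ℝ) + 1)
        (hg.subset (Set.Icc_subset_Icc (by linarith) hk) (convex_Icc _ _))
        (hc.mono (Set.Icc_subset_Icc (by linarith) hk))
      have h2 := integral_le_of_concaveOn (a := (k : ℝ) + 1)
        (hg.subset (Set.Icc_subset_Icc (by linarith) hk) (convex_Icc _ _))
        (hc.mono (Set.Icc_subset_Icc (by linarith) hk))
      rw [add_sub_cancel_right] at h2
      rw [← intervalIntegral.integral_add_adjacent_intervals
        (hint 0 (k + 1) le_rfl (by linarith) (by linarith))
        (hint (k + 1) (k + 1 + 1) (by linarith) (by linarith) hk),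
        Finset.sum_Ico_succ_top (by omega)]
      push_cast
      exact ⟨by linarith, by linarith⟩
  obtain ⟨k1, k2⟩ := key n hnR
  have hn0 : (0 : ℝ) ≤ n := n.cast_nonneg
  have hmem : (n : ℝ) + 1 ∈ Set.Icc 0 R := ⟨by linarith, hnR⟩
  have hg1 := h0 _ hmem
  have hg2 : g (n + 1) ≤ g n := ha ⟨hn0, by linarith⟩ hmem (by linarith)
  have i1 : 0 ≤ ∫ t in ((n : ℝ) + 1)..R, g t :=
    intervalIntegral.integral_nonneg hnR fun t ht => h0 t ⟨by linarith [ht.1], ht.2⟩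
  have i2 : ∫ t in ((n : ℝ) + 1)..R, g t ≤ g (n + 1) := by
    have : ∫ t in ((n : ℝ) + 1)..R, g t ≤ ∫ t in ((n : ℝ) + 1)..R, g (n + 1) :=
      intervalIntegral.integral_mono_on hnR (hint _ _ (by linarith) hnR le_rfl) (by simp)
        fun t ht => ha hmem ⟨by linarith [ht.1], ht.2⟩ ht.1
    rw [intervalIntegral.integral_const, smul_eq_mul] at this
    nlinarith
  rw [hn, Finset.sum_Ico_succ_top (by omega), ← intervalIntegral.integral_add_adjacent_intervals
    (hint 0 (n + 1) le_rfl (by linarith) hnR) (hint (n + 1) R (by linarith) hnR le_rfl)]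
  push_cast
  rw [add_sub_cancel_right, abs_le]
  exact ⟨by linarith, by linarith⟩

theorem rad_zero {α R : ℝ} (hα : 2 < α) (hR : 0 ≤ R) : rad α R 0 = R := by
  have hα0 : α ≠ 0 := by linarith
  rw [rad, Real.zero_rpow hα0, sub_zero, ← Real.rpow_mul hR, mul_one_div_cancel hα0,
    Real.rpow_one]

theorem continuous_rad {α R : ℝ} (hα : 2 < α) : Continuous (rad α R) :=
  (Real.continuous_rpow_const (by positivity : 0 ≤ 1 / α)).comp
    (continuous_const.sub (Real.continuous_rpow_const (by linarith)))

/-- The main term: the areas of the integral slices against the volume. -/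
theorem exists_abs_sum_rad_sq_sub_integral_le {α : ℝ} (hα : 2 < α) :
    ∃ C > 0, ∀ R, 4 ≤ R →
      |R ^ 2 + 2 * ∑ m ∈ Finset.Ico 1 (⌊R⌋₊ + 1), rad α R m ^ 2 -
        2 * ∫ t in (0 : ℝ)..R, rad α R t ^ 2| ≤ C * R ^ (2 - 2 / α) := by
  have hα0 : 0 < α := by linarith
  refine ⟨4 * (2 * α) ^ (2 / α), by positivity, fun R hR => ?_⟩
  have hR0 : 0 < R := by linarith
  have hmem : ∀ t ∈ Set.Icc 0 R, 0 ≤ R ^ α - t ^ α := fun t ht =>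
    sub_nonneg.2 (Real.rpow_le_rpow ht.1 ht.2 hα0.le)
  have hsq : ∀ t ∈ Set.Icc 0 R, rad α R t ^ 2 = (R ^ α - t ^ α) ^ (2 / α) := by
    intro t ht
    rw [rad, ← Real.rpow_natCast, ← Real.rpow_mul (hmem t ht)]
    congr 1; push_cast; ring
  -- The squared radius is the concave increasing power 2/α ≤ 1 of the concave function R^α - t^α.
  have hconc : ConcaveOn ℝ (Set.Icc 0 R) fun t => rad α R t ^ 2 := by
    refine ⟨convex_Icc _ _, fun x hx y hy a b ha hb hab => ?_⟩
    have hxy : a • x + b • y ∈ Set.Icc 0 R := (convex_Icc 0 R) hx hy ha hb hab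
    simp only
    rw [hsq x hx, hsq y hy, hsq _ hxy]
    have h1 := (Real.concaveOn_rpow (p := 2 / α) (by positivity)
      ((div_le_one hα0).2 hα.le)).2 (hmem x hx) (hmem y hy) ha hb hab
    refine h1.trans (Real.rpow_le_rpow ?_ ?_ (by positivity))
    · exact add_nonneg (mul_nonneg ha (hmem x hx)) (mul_nonneg hb (hmem y hy))
    · have h2 := (convexOn_rpow (p := α) (by linarith)).2 hx.1 hy.1 ha hb hab
      simp only [smul_eq_mul] at h2 ⊢
      have : a * R ^ α + b * R ^ α = R ^ α := by rw [← add_mul, hab, one_mul]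
      linarith
  have hcont : Continuous fun t => rad α R t ^ 2 := (continuous_rad hα).pow 2
  have hanti : AntitoneOn (fun t => rad α R t ^ 2) (Set.Icc 0 R) := by
    intro x hx y hy hxy
    exact pow_le_pow_left₀ (rad_nonneg hα hy.1 hy.2) (rad_anti hα hx.1 hxy hy.2) 2
  have h := abs_sum_sub_integral_le_of_concaveOn (by linarith) hconc hcont.continuousOn hanti
    fun t _ => sq_nonneg _
  have hfl : R - 2 ≤ (⌊R⌋₊ : ℝ) - 1 := by linarith [Nat.lt_floor_add_one R]
  have hfl2 : (⌊R⌋₊ : ℝ) - 1 ≤ R := by linarith [Nat.floor_le hR0.le]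
  -- Within distance 2 of the pole, Bernoulli's inequality gives R^α - t^α ≤ 2αR^(α-1), and (α-1) ·
  -- 2/α = 2 - 2/α.
  have hbd : rad α R (⌊R⌋₊ - 1) ^ 2 ≤ (2 * α) ^ (2 / α) * R ^ (2 - 2 / α) := by
    have hm : (⌊R⌋₊ : ℝ) - 1 ∈ Set.Icc 0 R := ⟨by linarith, hfl2⟩
    rw [hsq _ hm]
    have hb : R ^ α - ((⌊R⌋₊ : ℝ) - 1) ^ α ≤ (2 * α) * R ^ (α - 1) := by
      have h1 : (R - 2) ^ α ≤ ((⌊R⌋₊ : ℝ) - 1) ^ α :=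
        Real.rpow_le_rpow (by linarith) hfl hα0.le
      have h2 : R ^ α * (1 + α * (-2 / R)) ≤ (R - 2) ^ α := by
        have h3 := one_add_mul_self_le_rpow_one_add (s := -2 / R) (p := α)
          (by rw [le_div_iff₀ hR0]; linarith) (by linarith)
        have h4 : R - 2 = R * (1 + -2 / R) := by field_simp; ring
        rw [h4, Real.mul_rpow hR0.le (by rw [← sub_nonneg] ; field_simp; linarith)]
        gcongr
      have h5 : R ^ α = R * R ^ (α - 1) := by
        rw [← Real.rpow_one_add' hR0.le (by linarith)]; congr 1; ring
      have h6 : R ^ α * (1 + α * (-2 / R)) = R ^ α - 2 * α * R ^ (α - 1) := by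
        rw [h5]; field_simp; ring
      linarith
    calc (R ^ α - ((⌊R⌋₊ : ℝ) - 1) ^ α) ^ (2 / α) ≤ ((2 * α) * R ^ (α - 1)) ^ (2 / α) :=
          Real.rpow_le_rpow (hmem _ hm) hb (by positivity)
      _ = (2 * α) ^ (2 / α) * R ^ (2 - 2 / α) := by
          rw [Real.mul_rpow (by positivity) (by positivity), ← Real.rpow_mul hR0.le]
          congr 2; field_simp
  rw [rad_zero hα hR0.le] at h
  have e : R ^ 2 + 2 * ∑ m ∈ Finset.Ico 1 (⌊R⌋₊ + 1), rad α R m ^ 2 -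
      2 * ∫ t in (0 : ℝ)..R, rad α R t ^ 2 = 2 * (R ^ 2 / 2 +
        ∑ m ∈ Finset.Ico 1 (⌊R⌋₊ + 1), rad α R m ^ 2 - ∫ t in (0 : ℝ)..R, rad α R t ^ 2) := by
    ring
  rw [e, abs_mul, abs_of_pos (two_pos : (0 : ℝ) < 2)]
  linarith

/-! ### Volume and lattice points by slices -/

theorem mem_dilate_iff {α R : ℝ} (hα : 2 < α) (hR : 0 < R) (p : Space) :
    p ∈ dilate α R ↔ ‖p.1‖ ^ α + |p.2| ^ α ≤ R ^ α := by
  have hα0 : 0 < α := by linarith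
  have hRα : 0 < R ^ α := by positivity
  have hunit : ∀ q : Space, q ∈ unitBody α ↔ ‖q.1‖ ^ α + |q.2| ^ α ≤ 1 := by
    intro q
    change gauge α q ≤ 1 ↔ _
    rw [gauge, one_div, Real.rpow_inv_le_iff_of_pos (by positivity) zero_le_one hα0,
      Real.one_rpow]
  have hscale : ∀ q : Space, ‖R • q.1‖ ^ α + |R * q.2| ^ α =
      R ^ α * (‖q.1‖ ^ α + |q.2| ^ α) := by
    intro q
    rw [norm_smul, abs_mul, Real.norm_eq_abs, abs_of_pos hR,
      Real.mul_rpow hR.le (norm_nonneg _), Real.mul_rpow hR.le (abs_nonneg _)]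
    ring
  constructor
  · rintro ⟨q, hq, rfl⟩
    simp only
    rw [hscale]
    exact mul_le_of_le_one_right hRα.le ((hunit q).1 hq)
  · intro hp
    have hp' : p = (R • (R⁻¹ • p.1), R * (R⁻¹ * p.2)) := by
      rw [smul_inv_smul₀ hR.ne', mul_inv_cancel_left₀ hR.ne']
    refine ⟨(R⁻¹ • p.1, R⁻¹ * p.2), (hunit _).2 ?_, hp'.symm⟩
    have h := hscale (R⁻¹ • p.1, R⁻¹ * p.2)
    simp only at h
    rw [smul_inv_smul₀ hR.ne', mul_inv_cancel_left₀ hR.ne'] at h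
    rw [h] at hp
    exact (mul_le_iff_le_one_right hRα).1 hp

theorem mem_dilate_iff_norm_le_rad {α R : ℝ} (hα : 2 < α) (hR : 0 < R) {t : ℝ} (ht : |t| ≤ R)
    (z : EuclideanSpace ℝ (Fin 2)) : (z, t) ∈ dilate α R ↔ ‖z‖ ≤ rad α R |t| := by
  rw [mem_dilate_iff hα hR, le_rad_iff hα (abs_nonneg t) ht (norm_nonneg z), le_sub_iff_add_le]

/-- The volume of the dilate by slices. -/
theorem volume_dilate {α R : ℝ} (hα : 2 < α) (hR : 0 < R) :
    (volume (dilate α R)).toReal = Real.pi * (2 * ∫ t in (0 : ℝ)..R, rad α R t ^ 2) := by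
  have hα0 : 0 < α := by linarith
  have hcl : IsClosed (dilate α R) := by
    have : dilate α R = {p : Space | ‖p.1‖ ^ α + |p.2| ^ α ≤ R ^ α} := by
      ext p; exact mem_dilate_iff hα hR p
    rw [this]
    refine isClosed_le ?_ continuous_const
    exact ((Real.continuous_rpow_const hα0.le).comp continuous_fst.norm).add
      ((Real.continuous_rpow_const hα0.le).comp continuous_snd.abs)
  -- The slice at height t is a closed disc of radius `rad α R |t|` for |t| ≤ R, and empty
  -- otherwise.
  have hslice : ∀ t : ℝ, volume ((fun z => (z, t)) ⁻¹' dilate α R) =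
      (Set.Icc (-R) R).indicator (fun t => ENNReal.ofReal (rad α R |t| ^ 2 * Real.pi)) t := by
    intro t
    by_cases ht : t ∈ Set.Icc (-R) R
    · rw [Set.indicator_of_mem ht]
      have hr := rad_nonneg hα (abs_nonneg t) (abs_le.2 ht)
      have : (fun z => (z, t)) ⁻¹' dilate α R = Metric.closedBall 0 (rad α R |t|) := by
        ext z
        rw [Set.mem_preimage, mem_dilate_iff_norm_le_rad hα hR (abs_le.2 ht),
          mem_closedBall_zero_iff]
      rw [this, EuclideanSpace.volume_closedBall_fin_two, ENNReal.ofReal_mul (sq_nonneg _),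
        ENNReal.ofReal_pow hr]
    · rw [Set.indicator_of_notMem ht]
      have : (fun z => (z, t)) ⁻¹' dilate α R = ∅ := by
        ext z
        simp only [Set.mem_preimage, Set.mem_empty_iff_false, iff_false]
        intro hz
        have := (abs_le_of_mem_dilate hα0 hz).2
        rw [abs_of_pos hR] at this
        exact ht (abs_le.1 this)
      rw [this, measure_empty]
  have hcont : Continuous fun t : ℝ => rad α R |t| ^ 2 :=
    ((continuous_rad hα).comp continuous_abs).pow 2
  rw [Measure.volume_eq_prod, Measure.prod_apply_symm hcl.measurableSet]
  simp_rw [hslice]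
  rw [lintegral_indicator measurableSet_Icc, ← ofReal_integral_eq_lintegral_ofReal
    (hcont.mul_const _).integrableOn_Icc (Eventually.of_forall fun t => by positivity),
    ENNReal.toReal_ofReal (integral_nonneg fun t => by positivity),
    integral_Icc_eq_integral_Ioc, ← intervalIntegral.integral_of_le (by linarith),
    intervalIntegral.integral_mul_const, ← intervalIntegral.integral_add_adjacent_intervals
      (hcont.intervalIntegrable (-R) 0)
      (hcont.intervalIntegrable 0 R)]
  have e1 : ∫ t in (0 : ℝ)..R, rad α R |t| ^ 2 = ∫ t in (0 : ℝ)..R, rad α R t ^ 2 := by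
    refine intervalIntegral.integral_congr fun t ht => ?_
    rw [Set.uIcc_of_le hR.le] at ht
    simp only [abs_of_nonneg ht.1]
  have e2 : ∫ t in (-R)..0, rad α R |t| ^ 2 = ∫ t in (0 : ℝ)..R, rad α R |t| ^ 2 := by
    have := intervalIntegral.integral_comp_neg (a := -R) (b := 0)
      (fun t : ℝ => rad α R |t| ^ 2)
    simpa using this
  rw [e2, e1]
  ring

/-- The number of lattice points in the dilate by slices. -/
theorem ncard_integerLattice_inter_dilate {α R : ℝ} (hα : 2 < α) (hR : 0 < R) :
    ((integerLattice ∩ dilate α R).ncard : ℝ) =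
      circleCount (R ^ 2) + 2 * ∑ m ∈ Finset.Ico 1 (⌊R⌋₊ + 1), circleCount (rad α R m ^ 2) := by
  have hα0 : 0 < α := by linarith
  let φ : ℤ × ℤ × ℤ → Space := fun n => (!₂[(n.1 : ℝ), (n.2.1 : ℝ)], (n.2.2 : ℝ))
  have hφ : Function.Injective φ := by
    rintro ⟨a, b, c⟩ ⟨a', b', c'⟩ h
    have h2 := congrArg Prod.snd h
    have h0 := congrArg (fun p : Space => p.1 0) h
    have h1 := congrArg (fun p : Space => p.1 1) h
    simp [φ] at h0 h1 h2
    simp [h0, h1, h2]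
  let N : ℤ := ⌊R⌋₊
  have hN : ∀ c : ℤ, |(c : ℝ)| ≤ R ↔ c ∈ Finset.Icc (-N) N := by
    intro c
    rw [Finset.mem_Icc, ← abs_le, ← Int.cast_abs, ← Int.natCast_natAbs, Int.cast_natCast,
      ← Nat.le_floor_iff hR.le]
    exact Int.ofNat_le.symm
  let slice : ℕ → Finset (ℤ × ℤ) := fun m => (finite_sq_add_sq_le (rad α R m ^ 2)).toFinset
  have hmem : ∀ n : ℤ × ℤ × ℤ, φ n ∈ dilate α R ↔
      n.2.2 ∈ Finset.Icc (-N) N ∧ (n.1, n.2.1) ∈ slice n.2.2.natAbs := by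
    rintro ⟨a, b, c⟩
    have hca : ((c.natAbs : ℕ) : ℝ) = |(c : ℝ)| := by
      rw [← Int.cast_abs, ← Int.natCast_natAbs, Int.cast_natCast]
    rw [← hN]
    have hiff : |(c : ℝ)| ≤ R → (φ (a, b, c) ∈ dilate α R ↔ (a, b) ∈ slice c.natAbs) := by
      intro hc
      simp only [slice, Set.Finite.mem_toFinset, Set.mem_ofPred_eq, hca]
      rw [show φ (a, b, c) = (!₂[(a : ℝ), (b : ℝ)], (c : ℝ)) from rfl,
        mem_dilate_iff_norm_le_rad hα hR hc,
        ← sq_le_sq₀ (norm_nonneg _) (rad_nonneg hα (abs_nonneg _) hc), EuclideanSpace.real_norm_sq_eq]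
      simp
    constructor
    · intro h
      have hc := (abs_le_of_mem_dilate hα0 h).2
      rw [abs_of_pos hR] at hc
      exact ⟨hc, (hiff hc).1 h⟩
    · rintro ⟨hc, h⟩
      exact (hiff hc).2 h
  let S : Finset (ℤ × ℤ × ℤ) := (Finset.Icc (-N) N).biUnion fun c =>
    (slice c.natAbs).image fun p => (p.1, p.2, c)
  have hS : integerLattice ∩ dilate α R = φ '' (S : Set (ℤ × ℤ × ℤ)) := by
    ext p
    constructor
    · rintro ⟨⟨n, rfl⟩, hn⟩
      obtain ⟨h1, h2⟩ := (hmem n).1 hn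
      refine ⟨n, ?_, rfl⟩
      simp only [S, Finset.coe_biUnion, Set.mem_iUnion]
      exact ⟨n.2.2, h1, by simpa using ⟨n.1, n.2.1, h2, rfl⟩⟩
    · rintro ⟨n, hn, rfl⟩
      simp only [S, Finset.coe_biUnion, Set.mem_iUnion] at hn
      obtain ⟨c, hc, hn⟩ := hn
      simp only [Finset.coe_image, Set.mem_image] at hn
      obtain ⟨p, hp, rfl⟩ := hn
      exact ⟨⟨_, rfl⟩, (hmem _).2 ⟨hc, hp⟩⟩
  have hcard : S.card = ∑ c ∈ Finset.Icc (-N) N, (slice c.natAbs).card := by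
    rw [Finset.card_biUnion]
    · refine Finset.sum_congr rfl fun c _ => Finset.card_image_of_injective _ ?_
      rintro ⟨a, b⟩ ⟨a', b'⟩ h
      simpa using h
    · intro c _ c' _ hcc
      rw [Function.onFun, Finset.disjoint_left]
      intro n h1 h2
      obtain ⟨p, _, rfl⟩ := Finset.mem_image.1 h1
      obtain ⟨q, _, hq⟩ := Finset.mem_image.1 h2
      simp only [Prod.mk.injEq] at hq
      exact hcc hq.2.2.symm
  have hslice : ∀ m : ℕ, ((slice m).card : ℝ) = circleCount (rad α R m ^ 2) := by
    intro m
    rw [circleCount, Set.ncard_eq_toFinset_card _ (finite_sq_add_sq_le _)]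
  -- The heights c and -c give equal slices, so positive heights count twice and the central slice
  -- once.
  have hsym : ∀ (F : ℕ → ℝ) (n : ℕ), ∑ c ∈ Finset.Icc (-(n : ℤ)) n, F c.natAbs =
      F 0 + 2 * ∑ m ∈ Finset.Ico 1 (n + 1), F m := by
    intro F n
    induction n with
    | zero => simp
    | succ n ih =>
      have hset : Finset.Icc (-((n + 1 : ℕ) : ℤ)) ((n + 1 : ℕ) : ℤ) =
          insert (-((n : ℤ) + 1)) (insert ((n : ℤ) + 1) (Finset.Icc (-(n : ℤ)) n)) := by
        ext c
        simp only [Finset.mem_Icc, Finset.mem_insert]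
        push_cast
        omega
      rw [hset, Finset.sum_insert (fun h => by
          rcases Finset.mem_insert.1 h with h | h
          · omega
          · rw [Finset.mem_Icc] at h; omega),
        Finset.sum_insert (fun h => by rw [Finset.mem_Icc] at h; omega), ih,
        Finset.sum_Ico_succ_top (by omega : 1 ≤ n + 1)]
      have e1 : (-((n : ℤ) + 1)).natAbs = n + 1 := by omega
      have e2 : ((n : ℤ) + 1).natAbs = n + 1 := by omega
      rw [e1, e2]
      ring
  rw [hS, Set.ncard_image_of_injective _ hφ, Set.ncard_coe_finset, hcard]
  push_cast
  simp only [hslice]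
  rw [hsym (fun m => circleCount (rad α R m ^ 2)), Nat.cast_zero, rad_zero hα hR.le]

/-- The lattice error is controlled by the errors of the circular slices and of the main term. -/
theorem latticeError_le {α R : ℝ} (hα : 2 < α) (hR : 0 < R) :
    latticeError α R ≤ |circleError R| + 2 * |errorSum α R R| + Real.pi *
      |R ^ 2 + 2 * ∑ m ∈ Finset.Ico 1 (⌊R⌋₊ + 1), rad α R m ^ 2 -
        2 * ∫ t in (0 : ℝ)..R, rad α R t ^ 2| := by
  have e : ((integerLattice ∩ dilate α R).ncard : ℝ) - (volume (dilate α R)).toReal =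
      circleError R + 2 * errorSum α R R + Real.pi *
        (R ^ 2 + 2 * ∑ m ∈ Finset.Ico 1 (⌊R⌋₊ + 1), rad α R m ^ 2 -
          2 * ∫ t in (0 : ℝ)..R, rad α R t ^ 2) := by
    rw [volume_dilate hα hR, ncard_integerLattice_inter_dilate hα hR]
    simp only [errorSum, circleError, Finset.sum_sub_distrib, ← Finset.mul_sum]
    ring
  rw [latticeError, e]
  refine (abs_add_le _ _).trans (add_le_add ((abs_add_le _ _).trans (add_le_add le_rfl ?_)) ?_)
  · rw [abs_mul, abs_two]
  · rw [abs_mul, abs_of_pos Real.pi_pos]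

end EuclideanDilates

theorem theorem6p1 (α : ℝ) (hα : 2 < α) :
    (fun R : ℝ => EuclideanDilates.latticeError α R) =O[atTop]
      (fun R : ℝ => (R ^ (3 / 2 : ℝ) + R ^ (2 - 2 / α)) * Real.log R) := by
  obtain ⟨C₁, hC₁, h1⟩ := EuclideanDilates.exists_abs_circleError_le
  obtain ⟨C₂, hC₂, h2⟩ := EuclideanDilates.exists_abs_errorSum_le hα
  obtain ⟨C₃, hC₃, h3⟩ := EuclideanDilates.exists_abs_sum_rad_sq_sub_integral_le hα
  refine IsBigO.of_bound (2 * C₁ + 2 * C₂ + Real.pi * C₃) ?_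
  filter_upwards [eventually_ge_atTop 4] with R hR
  have hR0 : 0 < R := by linarith
  have hlog := EuclideanDilates.one_le_log hR
  -- The circle error of the central slice is O(R), which the term R^(3/2) absorbs.
  have hA : R ≤ R ^ (3 / 2 : ℝ) := by
    calc R = R ^ (1 : ℝ) := (Real.rpow_one R).symm
      _ ≤ _ := Real.rpow_le_rpow_of_exponent_le (by linarith) (by norm_num)
  have hB : 0 ≤ R ^ (2 - 2 / α) := by positivity
  have hX : R ^ (3 / 2 : ℝ) + R ^ (2 - 2 / α) ≤
      (R ^ (3 / 2 : ℝ) + R ^ (2 - 2 / α)) * Real.log R :=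
    le_mul_of_one_le_right (by positivity) hlog
  set X := (R ^ (3 / 2 : ℝ) + R ^ (2 - 2 / α)) * Real.log R
  have hX0 : 0 ≤ X := le_trans (by positivity) hX
  rw [Real.norm_of_nonneg (show 0 ≤ EuclideanDilates.latticeError α R from abs_nonneg _),
    Real.norm_of_nonneg hX0]
  have b1 : |EuclideanDilates.circleError R| ≤ 2 * C₁ * X := by
    calc _ ≤ C₁ * (R + 1) := h1 R hR0.le
      _ ≤ C₁ * (2 * X) := by gcongr; linarith
      _ = _ := by ring
  have b3 := mul_le_mul_of_nonneg_left ((h3 R hR).trans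
    (mul_le_mul_of_nonneg_left (by linarith : R ^ (2 - 2 / α) ≤ X) hC₃.le)) Real.pi_pos.le
  linarith [EuclideanDilates.latticeError_le hα hR0, h2 R hR]
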